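/- Let $n\ge 2$, let $M$ be a triangulated space (e.g. a triangulated manifold), and let $E_0\to M$ and $E_1\to M$ be oriented topological $S^{n-1}$-bundles, i.e. locally trivial bundles with fiber $S^{n-1}$ whose transition functions take values in the orientation-preserving homeomorphisms of $S^{n-1}$. A fiberwise bordism between $E_0$ and $E_1$ is an $S^{n-1}\times[0,1]$-bundle $E\to M$, with transition functions that map $S^{n-1}\times\{i\}$ to itself for $i=0,1$, such that for $i=0,1$ the sub-bundle of $E$ with fiber $S^{n-1}\times\{i\}$ is isomorphic to $E_i$. Suppose that there is a fiberwise bordism $E$ that is compatible with the orientations: for each $x\in M$, the orientations of the fibers $(E_0)_x$ and $(E_1)_x$ correspond to each other under the isomorphisms $\pi_{n-1}((E_0)_x)\cong\pi_{n-1}(E_x)\cong\pi_{n-1}((E_1)_x)$ induced by the inclusions. Then $E_0$ and $E_1$ have the same Euler class in the simplicial cohomology group $H^n(M;\pi_{n-1}(S^{n-1}))$. Here the Euler class of an oriented $S^{n-1}$-bundle over $M$ is its primary obstruction class: the bundle has a section $\sigma$ over the $(n-1)$-skeleton of $M$; the cochain that assigns to each $n$-simplex $\Delta$ the element of $\pi_{n-1}(S^{n-1})$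 represented by $\sigma|_{\partial\Delta}$ (using the orientation and the triviality of the bundle over $\Delta$) is a cocycle; and the Euler class is the cohomology class of this cocycle, which does not depend on the choice of $\sigma$. -/

import Mathlib

open scoped unitInterval Topology

noncomputable section

namespace EulerBordism

/-! ### Simplicial complexes: geometric realization, skeleta, simplicial cohomology -/

section Complex

variable {V : Type*}

/-- The geometric realization `|K|` in barycentric coordinates: functions on the vertices with
non-negative values of sum `1`, supported on a simplex of `K`. -/
def Realization (K : AbstractSimplicialComplex V) : Type _ :=
  {x : V → ℝ // (∀ v, 0 ≤ x v) ∧ ∃ s ∈ K.faces, (∀ v, v ∉ s → x v = 0) ∧ ∑ v ∈ s, x v = 1}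

/-- The characteristic map of the simplex `s`: extension of barycentric coordinates by zero. -/
def simplexMap (K : AbstractSimplicialComplex V) (s : {s : Finset V // s ∈ K.faces})
    (x : stdSimplex ℝ s.1) : Realization K :=
  open Classical in
  ⟨fun v => if h : v ∈ s.1 then x.1 ⟨v, h⟩ else 0, by
    refine ⟨fun v => ?_, s.1, s.2, fun v hv => dif_neg hv, ?_⟩
    · dsimp only
      split_ifs with h
      · exact x.2.1 ⟨v, h⟩
      · exact le_rfl
    · rw [← x.2.2, ← Finset.sum_attach, ← Finset.univ_eq_attach]
      exact Finset.sum_congr rfl fun v _ => dif_pos v.2⟩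

/-- The weak topology: the finest topology for which all characteristic maps of simplices are
continuous. -/
instance (K : AbstractSimplicialComplex V) : TopologicalSpace (Realization K) :=
  ⨆ s : {s : Finset V // s ∈ K.faces}, TopologicalSpace.coinduced (simplexMap K s) inferInstance

/-- The closed simplex `|s|` in `|K|`. -/
def closedSimplex (K : AbstractSimplicialComplex V) (s : Finset V) : Set (Realization K) :=
  {x | ∀ v, v ∉ s → x.1 v = 0}

/-- The `m`-skeleton of `|K|`: the union of the closed simplices with at most `m + 1` vertices. -/
def skeleton (K : AbstractSimplicialComplex V) (m : ℕ) : Set (Realization K) :=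
  {x | ∃ s ∈ K.faces, s.card ≤ m + 1 ∧ x ∈ closedSimplex K s}

/-- The `m`-simplices of `K`. -/
def Simplices (K : AbstractSimplicialComplex V) (m : ℕ) : Type _ :=
  {s : Finset V // s ∈ K.faces ∧ s.card = m + 1}

variable [LinearOrder V]

/-- The `i`-th vertex of an `m`-simplex, in the order of the vertices. -/
def vertex {K : AbstractSimplicialComplex V} {m : ℕ} (s : Simplices K m) (i : Fin (m + 1)) : V :=
  s.1.orderEmbOfFin s.2.2 i

lemma vertex_mem {K : AbstractSimplicialComplex V} {m : ℕ} (s : Simplices K m) (i : Fin (m + 1)) :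
    vertex s i ∈ s.1 :=
  s.1.orderEmbOfFin_mem s.2.2 i

/-- The face of an `(m+1)`-simplex opposite to its `i`-th vertex. -/
def oppositeFace {K : AbstractSimplicialComplex V} {m : ℕ} (s : Simplices K (m + 1))
    (i : Fin (m + 2)) : Simplices K m :=
  ⟨s.1.erase (vertex s i), by
    have hc : (s.1.erase (vertex s i)).card = m + 1 := by
      rw [Finset.card_erase_of_mem (vertex_mem s i), s.2.2]; rfl
    exact ⟨(K.isRelLowerSet_faces s.2.1).2 (Finset.erase_subset _ _)
      (Finset.card_pos.1 (by omega)), hc⟩⟩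

variable (K : AbstractSimplicialComplex V) (A : Type*) [AddCommGroup A]

/-- The simplicial coboundary `(δ f)[v₀, …, v_{m+1}] = ∑ i, (-1)^i f[v₀, …, v̂_i, …, v_{m+1}]`,
where simplices are oriented by the order of their vertices. -/
def coboundary (m : ℕ) : (Simplices K m → A) →+ (Simplices K (m + 1) → A) where
  toFun f s := ∑ i : Fin (m + 2), (-1 : ℤ) ^ (i : ℕ) • f (oppositeFace s i)
  map_zero' := by ext s; simp
  map_add' f g := by ext s; simp [Finset.sum_add_distrib]

/-- Simplicial `m`-cocycles with values in `A`. -/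
abbrev cocycles (m : ℕ) : AddSubgroup (Simplices K m → A) := (coboundary K A m).ker

/-- Simplicial `m`-coboundaries with values in `A`. -/
def coboundaries : (m : ℕ) → AddSubgroup (Simplices K m → A)
  | 0 => ⊥
  | m + 1 => (coboundary K A m).range

/-- The simplicial cohomology group `H^m(K; A)`. -/
abbrev Cohomology (m : ℕ) : Type _ :=
  cocycles K A m ⧸ (coboundaries K A m).addSubgroupOf (cocycles K A m)

end Complex

/-! ### The standard parametrization of an ordered simplex by a cube -/

/-- The map from the cube to the simplex,
`y ↦ (1 - y₀, y₀(1 - y₁), …, y₀⋯y_{m-2}(1 - y_{m-1}), y₀⋯y_{m-1})`. It is a homeomorphism of the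
interiors that preserves the standard orientations, and it maps boundary to boundary; on boundaries
it has degree one. -/
def cubeCoord {m : ℕ} (y : Fin m → I) (i : Fin (m + 1)) : ℝ :=
  (∏ j : Fin m with j.castSucc < i, (y j : ℝ)) * if h : (i : ℕ) < m then 1 - (y ⟨i, h⟩ : ℝ) else 1

lemma cubeCoord_nonneg {m : ℕ} (y : Fin m → I) (i : Fin (m + 1)) : 0 ≤ cubeCoord y i := by
  refine mul_nonneg (Finset.prod_nonneg fun j _ => (y j).2.1) ?_
  split_ifs with h
  · exact sub_nonneg.2 (y ⟨i, h⟩).2.2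
  · exact zero_le_one

lemma cubeCoord_zero {m : ℕ} (y : Fin (m + 1) → I) : cubeCoord y 0 = 1 - (y 0 : ℝ) := by
  simp [cubeCoord]

lemma cubeCoord_succ {m : ℕ} (y : Fin (m + 1) → I) (i : Fin (m + 1)) :
    cubeCoord y i.succ = (y 0 : ℝ) * cubeCoord (fun j => y j.succ) i := by
  unfold cubeCoord
  rw [Finset.prod_filter, Fin.prod_univ_succ, Finset.prod_filter]
  simp [mul_assoc]

lemma sum_cubeCoord : ∀ {m : ℕ} (y : Fin m → I), ∑ i, cubeCoord y i = 1
  | 0, y => by simp [cubeCoord]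
  | m + 1, y => by
    rw [Fin.sum_univ_succ, cubeCoord_zero]
    simp_rw [cubeCoord_succ, ← Finset.mul_sum, sum_cubeCoord]
    ring

/-- The parametrization of the closed `m`-simplex `s` of `|K|` by the cube `I^m`. -/
def cubeMap {V : Type*} [LinearOrder V] {K : AbstractSimplicialComplex V} {m : ℕ}
    (s : Simplices K m) (y : Fin m → I) : Realization K :=
  simplexMap K ⟨s.1, s.2.1⟩
    ⟨fun v => cubeCoord y ((s.1.orderIsoOfFin s.2.2).symm v), fun _ => cubeCoord_nonneg y _, by
      rw [← sum_cubeCoord y]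
      exact (s.1.orderIsoOfFin s.2.2).symm.toEquiv.sum_comp (cubeCoord y)⟩

/-! ### Spheres and the coefficient group -/

/-- The unit sphere `S^{n-1}` in `ℝ^n`. -/
abbrev Sph (n : ℕ) : Type := Metric.sphere (0 : EuclideanSpace ℝ (Fin n)) 1

/-- The base point `(1, 0, …, 0)`. -/
def basePt (k : ℕ) : Sph (k + 1) := ⟨EuclideanSpace.single 0 1, by simp⟩

/-- The homotopy groups of a space that has a continuous multiplication for which the base point is
a strict unit are commutative. -/
lemma homotopyGroup_mul_comm {N X : Type*} [DecidableEq N] [Nonempty N] [TopologicalSpace X] {e : X}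
    (m : C(X × X, X)) (hl : ∀ x, m (e, x) = x) (hr : ∀ x, m (x, e) = x)
    (a b : HomotopyGroup N X e) : a * b = b * a := by
  let op : GenLoop N X e → GenLoop N X e → GenLoop N X e := fun f g =>
    ⟨m.comp (f.1.prodMk g.1), fun y hy => by
      change m (f.1 y, g.1 y) = e
      rw [f.2 y hy, g.2 y hy, hl]⟩
  have hop : ∀ f g y, op f g y = m (f y, g y) := fun _ _ _ => rfl
  let op' : HomotopyGroup N X e → HomotopyGroup N X e → HomotopyGroup N X e :=
    Quotient.map₂ op (by
      rintro f f' ⟨F⟩ g g' ⟨G⟩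
      refine ⟨⟨⟨m.comp (F.toContinuousMap.prodMk G.toContinuousMap), fun y => ?_, fun y => ?_⟩,
        fun t y hy => ?_⟩⟩
      · change m (F (0, y), G (0, y)) = _
        rw [F.apply_zero, G.apply_zero]; rfl
      · change m (F (1, y), G (1, y)) = _
        rw [F.apply_one, G.apply_one]; rfl
      · change m (F (t, y), G (t, y)) = m (f.1 y, g.1 y)
        rw [F.eq_fst t hy, G.eq_fst t hy])
  let i : N := Classical.arbitrary N
  let mk : GenLoop N X e → HomotopyGroup N X e := fun f => Quotient.mk _ f
  have hmk : Function.Surjective mk := Quotient.mk_surjective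
  have hop' : ∀ f g, op' (mk f) (mk g) = mk (op f g) := fun _ _ => rfl
  have hmul : ∀ f g, mk f * mk g = mk (GenLoop.transAt i g f) :=
    fun f g => HomotopyGroup.mul_spec (i := i)
  have h1 : EckmannHilton.IsUnital (fun a b : HomotopyGroup N X e => a * b) 1 :=
    { left_id := one_mul, right_id := mul_one }
  have h2 : EckmannHilton.IsUnital op' (mk GenLoop.const) :=
    { left_id := fun a => by
        obtain ⟨f, rfl⟩ := hmk a
        rw [hop']
        congr 1; ext y; rw [hop]; exact hl _
      right_id := fun a => by
        obtain ⟨f, rfl⟩ := hmk a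
        rw [hop']
        congr 1; ext y; rw [hop]; exact hr _ }
  have hd : ∀ a b c d : HomotopyGroup N X e,
      op' (a * b) (c * d) = op' a c * op' b d := by
    intro a b c d
    obtain ⟨a, rfl⟩ := hmk a
    obtain ⟨b, rfl⟩ := hmk b
    obtain ⟨c, rfl⟩ := hmk c
    obtain ⟨d, rfl⟩ := hmk d
    rw [hop', hop', hmul, hmul, hmul, hop']
    congr 1
    ext y
    simp only [hop, GenLoop.transAt, GenLoop.coe_copy]
    split_ifs <;> rfl
  exact (EckmannHilton.mul_comm h2 h1 hd).comm a b

/-- Complex multiplication on the unit circle in `ℝ²`. -/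
def circleMul : C(Sph 2 × Sph 2, Sph 2) where
  toFun z := ⟨!₂[z.1.1 0 * z.2.1 0 - z.1.1 1 * z.2.1 1, z.1.1 0 * z.2.1 1 + z.1.1 1 * z.2.1 0], by
    have h1 := z.1.2
    have h2 := z.2.2
    rw [mem_sphere_zero_iff_norm, EuclideanSpace.norm_eq, Real.sqrt_eq_one,
      Fin.sum_univ_two] at h1 h2 ⊢
    simp only [Real.norm_eq_abs, sq_abs] at h1 h2 ⊢
    simp only [Matrix.cons_val_zero, Matrix.cons_val_one]
    linear_combination h2 * ((z.1.1 0) ^ 2 + (z.1.1 1) ^ 2) + h1⟩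
  continuous_toFun := by
    refine Continuous.subtype_mk ((PiLp.continuous_toLp 2 _).comp (continuous_pi fun i => ?_)) _
    fin_cases i <;> simp <;> fun_prop

lemma sphere_mul_comm : ∀ (k : ℕ) (a b : π_ (k + 1) (Sph (k + 2)) (basePt (k + 1))), a * b = b * a
  | 0 => homotopyGroup_mul_comm circleMul
      (fun x => by ext i; fin_cases i <;> simp [circleMul, basePt])
      (fun x => by ext i; fin_cases i <;> simp [circleMul, basePt])
  | k + 1 => fun a b => mul_comm a b

/-- The coefficient group `π_{n-1}(S^{n-1})` for `n = k + 2`, written additively. -/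
def SphereCoeff (k : ℕ) : Type := Additive (π_ (k + 1) (Sph (k + 2)) (basePt (k + 1)))

instance (k : ℕ) : AddCommGroup (SphereCoeff k) :=
  { (inferInstance : AddGroup (Additive (π_ (k + 1) (Sph (k + 2)) (basePt (k + 1))))) with
    add_comm := sphere_mul_comm k }

/-- The class in `π_{n-1}(S^{n-1})` of a map of pairs `(I^{n-1}, ∂I^{n-1}) → (S^{n-1}, *)`. -/
def SphereCoeff.mk {k : ℕ} (f : GenLoop (Fin (k + 1)) (Sph (k + 2)) (basePt (k + 1))) :
    SphereCoeff k :=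
  Additive.ofMul (Quotient.mk _ f : π_ (k + 1) (Sph (k + 2)) (basePt (k + 1)))

/-- A map of pairs `(I^d, ∂I^d) → (X, b)` seen as a map on the `d`-sphere `∂I^{d+1}`: it is `f` on
the face `y₀ = 1`, and constant on the other faces. The free homotopy class of the map
`∂I^{d+1} → X` is the one that corresponds to the class of `f` in `π_d(X, b)`. -/
def onCubeBoundary {d : ℕ} {X : Type*} [TopologicalSpace X] {b : X} (f : GenLoop (Fin d) X b)
    (y : Fin (d + 1) → I) : X :=
  open Classical in if y 0 = 1 then f (fun j => y j.succ) else b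

/-! ### Oriented sphere bundles and their Euler classes -/

section Bundles

variable {M E : Type*} [TopologicalSpace M] [TopologicalSpace E]

/-- The inclusion of the fiber over `x` given by a local trivialization. -/
def fiberMap {F : Type*} [TopologicalSpace F] {p : E → M} (e : Bundle.Trivialization F p) (x : M)
    (v : F) : E :=
  e.toOpenPartialHomeomorph.symm (x, v)

/-- The maps `f` and `g` from `F` to the fiber `p⁻¹(x)` are homotopic as maps to `p⁻¹(x)`. -/
def FiberHomotopic {F : Type*} [TopologicalSpace F] (p : E → M) (x : M) (f g : F → E) : Prop :=
  ∃ H : C(I × F, E), (∀ t v, p (H (t, v)) = x) ∧ (∀ v, H (0, v) = f v) ∧ ∀ v, H (1, v) = g v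

/-- An oriented topological `S^{n-1}`-bundle structure on `p : E → M`: an atlas of local
trivializations whose transition maps `S^{n-1} → S^{n-1}` over each point preserve the orientation,
i.e. are homotopic to the identity (equivalently, have degree one). -/
structure OrientedSphereBundle (n : ℕ) (p : E → M) where
  charts : Set (Bundle.Trivialization (Sph n) p)
  exists_chart : ∀ x, ∃ e ∈ charts, x ∈ e.baseSet
  oriented : ∀ e ∈ charts, ∀ e' ∈ charts, ∀ x ∈ e.baseSet ∩ e'.baseSet,
    FiberHomotopic p x (fiberMap e x) (fiberMap e' x)

variable {V : Type*} {K : AbstractSimplicialComplex V} (T : Realization K ≃ₜ M)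

/-- `s` is a section of `p : E → M` over the `m`-skeleton of the triangulation `T` of `M`. (The
values of `s` outside the skeleton are irrelevant.) -/
def IsSkeletonSection (p : E → M) (m : ℕ) (s : Realization K → E) : Prop :=
  ContinuousOn s (skeleton K m) ∧ ∀ x ∈ skeleton K m, p (s x) = T x

variable [LinearOrder V] {k : ℕ} {p : E → M} (ξ : OrientedSphereBundle (k + 2) p)

/-- With `n = k + 2`: `α ∈ π_{n-1}(S^{n-1})` is the obstruction to extending the section `s` over
the `n`-simplex `τ`. That is, if `E|_τ` is the restriction of the bundle to `τ` and `x₀` is the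
leading vertex of `τ`, then `s` restricted to `∂τ` represents the image of `α` under the
bijections `π_{n-1}(S^{n-1}) ≅ [S^{n-1}, S^{n-1}] ≅ [S^{n-1}, E_{x₀}] ≅ [∂τ, E|_τ]`, of which the
second is given by the orientation of the bundle and the third by the inclusion of the fiber. -/
def IsObstruction (s : Realization K → E) (τ : Simplices K (k + 2)) (α : SphereCoeff k) : Prop :=
  ∃ f, SphereCoeff.mk f = α ∧
    ∃ e ∈ ξ.charts, T (cubeMap τ fun _ => 0) ∈ e.baseSet ∧
      ∃ H : C(I × Cube.boundary (Fin (k + 2)), E),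
        (∀ t y, p (H (t, y)) ∈ T '' closedSimplex K τ.1) ∧
        (∀ y, H (0, y) = s (cubeMap τ y)) ∧
        ∀ y, H (1, y) = fiberMap e (T (cubeMap τ fun _ => 0)) (onCubeBoundary f y)

/-- With `n = k + 2`: `z` is the obstruction cochain of the section `s` over the
`(n-1)`-skeleton. -/
def IsObstructionCochain (s : Realization K → E) (z : Simplices K (k + 2) → SphereCoeff k) : Prop :=
  ∀ τ, IsObstruction T ξ s τ (z τ)

/-- With `n = k + 2`: `c ∈ H^n(M; π_{n-1}(S^{n-1}))` is the Euler class of the oriented sphere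
bundle `ξ`, computed in the triangulation `T` of `M`. That is, the bundle has sections over the
`(n-1)`-skeleton, and for each such section `s` the obstruction cochain of `s` exists,
is a cocycle and represents `c`. -/
def IsEulerClass (c : Cohomology K (SphereCoeff k) (k + 2)) : Prop :=
  (∃ s, IsSkeletonSection T p (k + 1) s) ∧
  ∀ s, IsSkeletonSection T p (k + 1) s →
    (∃ z, IsObstructionCochain T ξ s z) ∧
    ∀ z, IsObstructionCochain T ξ s z →
      ∃ hz : z ∈ cocycles K (SphereCoeff k) (k + 2), QuotientAddGroup.mk ⟨z, hz⟩ = c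

end Bundles

/-! ### Fiberwise bordisms -/

section Bordism

variable {M : Type*} [TopologicalSpace M]

/-- An `F × [0,1]`-bundle structure on `q : W → M` with structure group the homeomorphisms of
`F × [0,1]` that map `F × {i}` to itself for `i = 0, 1`. -/
structure IntervalBundle (F : Type*) [TopologicalSpace F] {W : Type*} [TopologicalSpace W]
    (q : W → M) where
  charts : Set (Bundle.Trivialization (F × I) q)
  exists_chart : ∀ x, ∃ e ∈ charts, x ∈ e.baseSet
  preserves_ends : ∀ e ∈ charts, ∀ e' ∈ charts, ∀ w, q w ∈ e.baseSet ∩ e'.baseSet →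
    ((e w).2.2 = 0 ↔ (e' w).2.2 = 0) ∧ ((e w).2.2 = 1 ↔ (e' w).2.2 = 1)

/-- For `i = 0, 1`, the subspace of `W` whose fibers are the copies of `F × {i}`. -/
def IntervalBundle.endSet {F : Type*} [TopologicalSpace F] {W : Type*} [TopologicalSpace W]
    {q : W → M} (ω : IntervalBundle F q) (i : I) : Set W :=
  {w | ∃ e ∈ ω.charts, q w ∈ e.baseSet ∧ (e w).2.2 = i}

variable {E₀ E₁ : Type*} [TopologicalSpace E₀] [TopologicalSpace E₁]

/-- A fiberwise bordism between the `F`-bundles `p₀` and `p₁`: an `F × [0,1]`-bundle `q : W → M`,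
and bundle isomorphisms of `E₀` and `E₁` with the bundles of fibers `F × {0}` and `F × {1}`. -/
structure FiberwiseBordism (F : Type*) [TopologicalSpace F] (p₀ : E₀ → M) (p₁ : E₁ → M)
    {W : Type*} [TopologicalSpace W] (q : W → M) extends IntervalBundle F q where
  iso₀ : E₀ ≃ₜ toIntervalBundle.endSet 0
  iso₁ : E₁ ≃ₜ toIntervalBundle.endSet 1
  proj_iso₀ : ∀ z, q (iso₀ z) = p₀ z
  proj_iso₁ : ∀ z, q (iso₁ z) = p₁ z

/-- The bordism is compatible with the orientations of the two sphere bundles: over each point `x`,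
oriented parametrizations of the two ends of the fiber `W_x ≅ S^{n-1} × [0,1]` are homotopic in
`W_x`. In other words, the orientations correspond to each other under
`π_{n-1}((E₀)_x) ≅ π_{n-1}(W_x) ≅ π_{n-1}((E₁)_x)`. -/
def FiberwiseBordism.IsOriented {n : ℕ} {p₀ : E₀ → M} {p₁ : E₁ → M} {W : Type*}
    [TopologicalSpace W] {q : W → M} (B : FiberwiseBordism (Sph n) p₀ p₁ q)
    (ξ₀ : OrientedSphereBundle n p₀) (ξ₁ : OrientedSphereBundle n p₁) : Prop :=
  ∀ e₀ ∈ ξ₀.charts, ∀ e₁ ∈ ξ₁.charts, ∀ x ∈ e₀.baseSet ∩ e₁.baseSet,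
    FiberHomotopic q x (fun v => (B.iso₀ (fiberMap e₀ x v) : W))
      (fun v => (B.iso₁ (fiberMap e₁ x v) : W))

end Bordism

end EulerBordism

end

/-! Sections of the two ends `E₀` and `E₁` are sections of the bordism `W`, and the oriented
parametrizations of the fibers of `E₀` and `E₁` give, up to homotopy, the same maps
`S^{n-1} → W_x`, which are homotopy equivalences because the fiber of `W` is `S^{n-1} × [0,1]`. So
both Euler classes are equal to the primary obstruction to a section of `W`, once this is known to
be well defined.

Over a simplex, `W` is trivial, and an oriented retraction to `S^{n-1}` turns maps to `W` into maps
to the sphere. The value of the obstruction cochain of a section on a simplex is the degree of a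
map from the boundary of a cube to `S^{n-1}`, computed by summing a cocycle on the singular
`(n-1)`-cubes of `S^{n-1}`, the fundamental cocycle, over the faces. The relation `d² = 0` for
`(n+1)`-cubes, applied to a section over the `(n-1)`-skeleton, shows that the obstruction cochain
is a cocycle. Applied to the prism over an `n`-simplex, with two sections at its ends and a
homotopy of their restrictions to the `(n-2)`-skeleton in between, it shows that the cocycles of
the two sections are cohomologous. -/

open scoped unitInterval Topology

noncomputable section

namespace EulerBordism

/-! ### Faces of cubes -/

section Faces

variable {m : ℕ}

/-- The inclusion of the face `yᵢ = ε` of the cube `I^(m+1)`. -/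
def face (i : Fin (m + 1)) (ε : I) (y : Fin m → I) : Fin (m + 1) → I :=
  Fin.insertNth (α := fun _ => I) i ε y

@[simp] lemma face_same (i : Fin (m + 1)) (ε : I) (y : Fin m → I) : face i ε y i = ε :=
  Fin.insertNth_apply_same (α := fun _ => I) i ε y

@[simp] lemma face_succAbove (i : Fin (m + 1)) (ε : I) (y : Fin m → I) (j : Fin m) :
    face i ε y (i.succAbove j) = y j :=
  Fin.insertNth_apply_succAbove (α := fun _ => I) i ε y j

lemma face_zero (ε : I) (y : Fin m → I) : face 0 ε y = Fin.cons ε y :=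
  Fin.insertNth_zero' ε y

@[simp] lemma face_zero_succ (ε : I) (y : Fin m → I) (j : Fin m) : face 0 ε y j.succ = y j := by
  rw [face_zero, Fin.cons_succ]

lemma face_succ_zero (i : Fin (m + 1)) (ε : I) (y : Fin (m + 1) → I) :
    face i.succ ε y 0 = y 0 := by
  rw [← Fin.succ_succAbove_zero i, face_succAbove]

lemma face_succ_succ (i : Fin (m + 1)) (ε : I) (y : Fin (m + 1) → I) (j : Fin (m + 1)) :
    face i.succ ε y j.succ = face i ε (fun l => y l.succ) j := by
  rcases Fin.eq_self_or_eq_succAbove i j with rfl | ⟨l, rfl⟩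
  · rw [face_same, face_same]
  · rw [← Fin.succ_succAbove_succ, face_succAbove, face_succAbove]

lemma face_removeNth {i : Fin (m + 1)} {ε : I} {y : Fin (m + 1) → I} (h : y i = ε) :
    face i ε (fun j => y (i.succAbove j)) = y :=
  h ▸ Fin.insertNth_self_removeNth i y

lemma face_zero_tail (y : Fin (m + 1) → I) : face 0 (y 0) (fun j => y j.succ) = y :=
  (face_zero _ _).trans (Fin.cons_self_tail y)

lemma face_injective (i : Fin (m + 1)) (ε : I) : Function.Injective (face i ε) :=
  Fin.insertNth_right_injective (α := fun _ => I) ε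

lemma face_face (i : Fin (m + 2)) (l : Fin (m + 1)) (ε ε' : I) (w : Fin m → I) :
    face i ε (face l ε' w) = face (i.succAbove l) ε' (face (l.predAbove i) ε w) := by
  ext1 j
  rcases Fin.eq_self_or_eq_succAbove i j with rfl | ⟨j, rfl⟩
  · have h := face_succAbove (j.succAbove l) ε' (face (l.predAbove j) ε w) (l.predAbove j)
    rw [Fin.succAbove_succAbove_predAbove, face_same] at h
    rw [face_same, h]
  rw [face_succAbove]
  rcases Fin.eq_self_or_eq_succAbove l j with rfl | ⟨j, rfl⟩
  · rw [face_same, face_same]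
  · rw [face_succAbove, ← Fin.succAbove_succAbove_succAbove_predAbove, face_succAbove,
      face_succAbove]

lemma face_eq_face {i i' : Fin (m + 2)} (h : i ≠ i') {ε ε' : I} {y y' : Fin (m + 1) → I}
    (hy : face i ε y = face i' ε' y') :
    ∃ l w, i' = i.succAbove l ∧ y = face l ε' w ∧ y' = face (l.predAbove i) ε w := by
  obtain ⟨l, rfl⟩ := Fin.exists_succAbove_eq h.symm
  have hl : y l = ε' := by rw [← face_succAbove i ε y, hy, face_same]
  refine ⟨l, fun j => y (l.succAbove j), rfl, (face_removeNth hl).symm, ?_⟩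
  apply face_injective (i.succAbove l) ε'
  rw [← face_face, face_removeNth hl, hy]

lemma continuous_face_uncurry (i : Fin (m + 1)) :
    Continuous fun z : I × (Fin m → I) => face i z.1 z.2 :=
  Continuous.finInsertNth (A := fun _ : Fin (m + 1) => I) i continuous_fst continuous_snd

@[fun_prop] lemma continuous_face (i : Fin (m + 1)) (ε : I) : Continuous (face i ε) :=
  continuous_const.finInsertNth i continuous_id

lemma continuous_tail : Continuous fun y : Fin (m + 1) → I => fun j : Fin m => y j.succ := by
  fun_prop

lemma isClosed_boundary (N : Type*) [Finite N] : IsClosed (Cube.boundary N) := by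
  have : Cube.boundary N = ⋃ i, {y : N → I | y i = 0 ∨ y i = 1} := by
    ext y
    simp only [Cube.boundary, Set.mem_ofPred_eq, Set.mem_iUnion]
  rw [this]
  exact isClosed_iUnion_of_finite fun i =>
    (isClosed_eq (continuous_apply i) continuous_const).union
      (isClosed_eq (continuous_apply i) continuous_const)

lemma face_mem_boundary (i : Fin (m + 1)) {ε : I} (hε : ε = 0 ∨ ε = 1) (y : Fin m → I) :
    face i ε y ∈ Cube.boundary (Fin (m + 1)) :=
  ⟨i, by rwa [face_same]⟩

lemma exists_eq_face_of_mem_boundary {y : Fin (m + 1) → I}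
    (hy : y ∈ Cube.boundary (Fin (m + 1))) :
    ∃ i, ∃ ε : I, (ε = 0 ∨ ε = 1) ∧ ∃ w, y = face i ε w := by
  obtain ⟨i, hi⟩ := hy
  exact ⟨i, y i, hi, _, (face_removeNth rfl).symm⟩

lemma face_zero_mem_boundary_iff {t : I} {y : Fin m → I} :
    face 0 t y ∈ Cube.boundary (Fin (m + 1)) ↔
      (t = 0 ∨ t = 1) ∨ y ∈ Cube.boundary (Fin m) := by
  simp only [Cube.boundary, Set.mem_ofPred_eq, Fin.exists_fin_succ, face_same, face_zero_succ]

end Faces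

section BoundaryContinuity

variable {m : ℕ} {X Z : Type*} [TopologicalSpace X] [TopologicalSpace Z]

lemma continuousOn_prod_boundary {G : Z × (Fin (m + 1) → I) → X}
    (h : ∀ i, ∀ ε : I, (ε = 0 ∨ ε = 1) → Continuous fun z : Z × (Fin m → I) =>
      G (z.1, face i ε z.2)) :
    ContinuousOn G (Set.univ ×ˢ Cube.boundary (Fin (m + 1))) := by
  let side : Fin (m + 1) × Bool → Set (Z × (Fin (m + 1) → I)) :=
    fun a => {z | z.2 a.1 = if a.2 then 1 else 0}
  have hside : (Set.univ : Set Z) ×ˢ Cube.boundary (Fin (m + 1)) = ⋃ a, side a := by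
    ext z
    simp [side, Cube.boundary, Prod.exists]
  rw [hside]
  refine (locallyFinite_of_finite side).continuousOn_iUnion (fun a => ?_) fun a => ?_
  · exact isClosed_eq ((continuous_apply a.1).comp continuous_snd) continuous_const
  · have h1 := h a.1 (if a.2 then 1 else 0) (by cases a.2 <;> simp)
    have h2 : Continuous fun z : Z × (Fin (m + 1) → I) =>
        (z.1, fun j => z.2 (a.1.succAbove j)) := by fun_prop
    refine (h1.comp h2).continuousOn.congr fun z hz => ?_
    change G z = G (z.1, face a.1 _ fun j => z.2 (a.1.succAbove j))
    rw [face_removeNth hz]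

lemma continuousOn_boundary {g : (Fin (m + 1) → I) → X}
    (h : ∀ i, ∀ ε : I, (ε = 0 ∨ ε = 1) → Continuous fun y => g (face i ε y)) :
    ContinuousOn g (Cube.boundary (Fin (m + 1))) := by
  have := continuousOn_prod_boundary (Z := Unit) (G := fun z => g z.2)
    fun i ε hε => (h i ε hε).comp continuous_snd
  exact this.comp (f := fun y => ((), y)) (by fun_prop) fun y hy => ⟨trivial, hy⟩

lemma exists_eq_on_faces {X Z : Type*} (u : Fin (m + 1) → I → Z × (Fin m → I) → X)
    (hu : ∀ i i' ε ε' z y y', (ε = 0 ∨ ε = 1) → (ε' = 0 ∨ ε' = 1) →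
      face i ε y = face i' ε' y' → u i ε (z, y) = u i' ε' (z, y')) :
    ∃ G : Z × (Fin (m + 1) → I) → X, ∀ i, ∀ ε : I, (ε = 0 ∨ ε = 1) →
      ∀ z y, G (z, face i ε y) = u i ε (z, y) := by
  have glue : ∀ z : Z × (Fin (m + 1) → I), ∃ x, ∀ i ε y, (ε = 0 ∨ ε = 1) → z.2 = face i ε y →
      x = u i ε (z.1, y) := by
    rintro ⟨z, y⟩
    by_cases hy : y ∈ Cube.boundary (Fin (m + 1))
    · obtain ⟨i, ε, hε, w, rfl⟩ := exists_eq_face_of_mem_boundary hy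
      exact ⟨u i ε (z, w), fun i' ε' w' hε' h => hu _ _ _ _ _ _ _ hε hε' h⟩
    · refine ⟨u 0 0 (z, fun j => y j.succ), fun i ε w hε h => absurd ?_ hy⟩
      exact Set.mem_of_eq_of_mem h (face_mem_boundary i hε w)
  choose G hG using glue
  exact ⟨G, fun i ε hε z y => hG (z, face i ε y) i ε y hε rfl⟩

end BoundaryContinuity

/-! ### Homotopy extension for the boundary of a cube -/

section HomotopyExtension

variable {N : Type*} [Fintype N]

/-- The scaling factor of the radial retraction of `I × I^N` from the point `(2, 1/2, …, 1/2)`. -/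
def boxScale (z : I × (N → I)) : ℝ :=
  max ‖fun i => 2 * (z.2 i : ℝ) - 1‖ (1 - (z.1 : ℝ) / 2)

/-- The radial retraction of `I × I^N` onto `{0} × I^N ∪ I × ∂I^N`. The projections onto `[0, 1]`
only serve to make the codomain right. -/
def boxRetract (z : I × (N → I)) : I × (N → I) :=
  (Set.projIcc 0 1 zero_le_one (2 - (2 - (z.1 : ℝ)) / boxScale z),
    fun i => Set.projIcc 0 1 zero_le_one (((2 * (z.2 i : ℝ) - 1) / boxScale z + 1) / 2))

lemma boxScale_pos (z : I × (N → I)) : 0 < boxScale z :=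
  lt_max_of_lt_right (by linarith [z.1.2.2])

lemma continuous_boxRetract : Continuous (boxRetract (N := N)) := by
  have h : Continuous (boxScale (N := N)) := by unfold boxScale; fun_prop
  have h0 := fun z => (boxScale_pos (N := N) z).ne'
  refine Continuous.prodMk (continuous_projIcc.comp ?_)
    (continuous_pi fun i => continuous_projIcc.comp ?_) <;> fun_prop (disch := exact h0)

lemma boxRetract_fst_eq_zero {z : I × (N → I)} (h : boxScale z = 1 - (z.1 : ℝ) / 2) :
    (boxRetract z).1 = 0 := by
  have hpos := boxScale_pos z
  have hzero : 2 - (2 - (z.1 : ℝ)) / boxScale z = 0 := by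
    field_simp
    linarith
  simp only [boxRetract, hzero]
  exact Set.projIcc_left zero_le_one

lemma boxRetract_snd_mem_boundary {z : I × (N → I)}
    (h : boxScale z = ‖fun i => 2 * (z.2 i : ℝ) - 1‖) :
    (boxRetract z).2 ∈ Cube.boundary N := by
  have hpos := boxScale_pos z
  obtain ⟨i, hi⟩ : ∃ i, boxScale z ≤ |2 * (z.2 i : ℝ) - 1| := by
    by_contra! hlt
    exact ((pi_norm_lt_iff hpos).2 hlt).ne h.symm
  refine ⟨i, (le_abs.1 hi).symm.imp (fun hi => ?_) fun hi => ?_⟩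
  · refine Set.projIcc_of_le_left zero_le_one ?_
    have : (2 * (z.2 i : ℝ) - 1) / boxScale z ≤ -1 := by rw [div_le_iff₀ hpos]; linarith
    linarith
  · refine Set.projIcc_of_right_le zero_le_one ?_
    have : 1 ≤ (2 * (z.2 i : ℝ) - 1) / boxScale z := (one_le_div hpos).2 hi
    linarith

lemma boxRetract_mem (z : I × (N → I)) :
    (boxRetract z).1 = 0 ∨ (boxRetract z).2 ∈ Cube.boundary N :=
  (max_choice _ _).symm.imp boxRetract_fst_eq_zero boxRetract_snd_mem_boundary

lemma boxScale_eq_one {z : I × (N → I)} (hz : z.1 = 0 ∨ z.2 ∈ Cube.boundary N) :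
    boxScale z = 1 := by
  refine le_antisymm (max_le ?_ (by linarith [z.1.2.1])) ?_
  · refine (pi_norm_le_iff_of_nonneg zero_le_one).2 fun i => abs_le.2 ?_
    constructor <;> linarith [(z.2 i).2.1, (z.2 i).2.2]
  · rcases hz with hz | ⟨i, hi⟩
    · refine le_max_of_le_right ?_
      rw [hz, Set.Icc.coe_zero, zero_div, sub_zero]
    · refine le_max_of_le_left (le_trans ?_ (norm_le_pi_norm (fun i => 2 * (z.2 i : ℝ) - 1) i))
      rcases hi with hi | hi <;> rw [hi] <;> norm_num

lemma boxRetract_eq_self {z : I × (N → I)} (hz : z.1 = 0 ∨ z.2 ∈ Cube.boundary N) :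
    boxRetract z = z := by
  have hfst : 2 - (2 - (z.1 : ℝ)) / 1 = z.1 := by ring
  have hsnd : ∀ i, ((2 * (z.2 i : ℝ) - 1) / 1 + 1) / 2 = z.2 i := fun i => by ring
  simp only [boxRetract, boxScale_eq_one hz, hfst, hsnd, Set.projIcc_val]

theorem exists_homotopy_extension {N X : Type*} [Finite N] [TopologicalSpace X] {g : (N → I) → X}
    (hg : Continuous g) {H : I × (N → I) → X}
    (hH : ContinuousOn H (Set.univ ×ˢ Cube.boundary N))
    (h0 : ∀ y ∈ Cube.boundary N, H (0, y) = g y) :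
    ∃ G : I × (N → I) → X, Continuous G ∧ (∀ y, G (0, y) = g y) ∧
      ∀ t, ∀ y ∈ Cube.boundary N, G (t, y) = H (t, y) := by
  classical
  cases nonempty_fintype N
  let β : I × (N → I) → X := fun z => if z.1 = 0 then g z.2 else H z
  have hβH : Set.EqOn β H (Set.univ ×ˢ Cube.boundary N) := by
    rintro ⟨t, y⟩ ⟨-, hy⟩
    by_cases ht : t = 0
    · simp only [β, ht, if_true, h0 y hy]
    · exact if_neg ht
  have hβ : ContinuousOn β ({z | z.1 = 0} ∪ Set.univ ×ˢ Cube.boundary N) := by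
    refine ContinuousOn.union_of_isClosed ?_ (hH.congr hβH)
      (isClosed_eq continuous_fst continuous_const) (isClosed_univ.prod (isClosed_boundary N))
    exact (hg.comp continuous_snd).continuousOn.congr fun z hz => if_pos hz
  refine ⟨β ∘ boxRetract, hβ.comp_continuous continuous_boxRetract fun z =>
    (boxRetract_mem z).imp_right fun h => ⟨trivial, h⟩, fun y => ?_, fun t y hy => ?_⟩
  · rw [Function.comp_apply, boxRetract_eq_self (Or.inl rfl)]
    exact if_pos rfl
  · rw [Function.comp_apply, boxRetract_eq_self (Or.inr hy)]
    exact hβH ⟨trivial, hy⟩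

end HomotopyExtension

/-! ### The cubical coboundary -/

section CubicalCoboundary

variable {m : ℕ} {X A : Type*} [AddCommGroup A]

/-- The cubical coboundary of a function on (not necessarily continuous) cubes in `X`. -/
def cubeD (φ : ((Fin m → I) → X) → A) (h : (Fin (m + 1) → I) → X) : A :=
  ∑ i : Fin (m + 1), (-1 : ℤ) ^ (i : ℕ) • (φ (h ∘ face i 1) - φ (h ∘ face i 0))

lemma cubeD_congr {X' : Type*} {φ : ((Fin m → I) → X) → A} {φ' : ((Fin m → I) → X') → A}
    {h : (Fin (m + 1) → I) → X} {h' : (Fin (m + 1) → I) → X'}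
    (H : ∀ i, ∀ ε : I, (ε = 0 ∨ ε = 1) → φ (h ∘ face i ε) = φ' (h' ∘ face i ε)) :
    cubeD φ h = cubeD φ' h' :=
  Finset.sum_congr rfl fun i _ => by rw [H i 1 (Or.inr rfl), H i 0 (Or.inl rfl)]

lemma cubeD_eq_sub_sum {φ : ((Fin m → I) → X) → A} {h : (Fin (m + 1) → I) → X} :
    cubeD φ h = (φ (h ∘ face 0 1) - φ (h ∘ face 0 0)) -
      ∑ i : Fin m, (-1 : ℤ) ^ (i : ℕ) • (φ (h ∘ face i.succ 1) - φ (h ∘ face i.succ 0)) := by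
  simp only [cubeD, Fin.sum_univ_succ, Fin.val_zero, pow_zero, one_smul, Fin.val_succ, pow_succ,
    mul_neg_one, neg_smul, Finset.sum_neg_distrib, sub_eq_add_neg]

lemma cubeD_eq_sub {φ : ((Fin m → I) → X) → A} {h : (Fin (m + 1) → I) → X}
    (H : ∀ l : Fin m, φ (h ∘ face l.succ 1) = φ (h ∘ face l.succ 0)) :
    cubeD φ h = φ (h ∘ face 0 1) - φ (h ∘ face 0 0) := by
  rw [cubeD_eq_sub_sum, Finset.sum_eq_zero fun l _ => by rw [H, sub_self, smul_zero], sub_zero]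

lemma sum_neg_one_pow_smul_eq_zero {c : Fin (m + 2) → Fin (m + 1) → A}
    (hc : ∀ i l, c i l = c (i.succAbove l) (l.predAbove i)) :
    ∑ i : Fin (m + 2), ∑ l : Fin (m + 1), (-1 : ℤ) ^ ((i : ℕ) + l) • c i l = 0 := by
  rw [← Fintype.sum_prod_type']
  refine Finset.sum_involution (fun a _ => (a.1.succAbove a.2, a.2.predAbove a.1)) ?_ ?_ ?_ ?_
  · rintro ⟨i, l⟩ -
    rw [Fin.neg_one_pow_succAbove_add_predAbove, ← hc, neg_smul, add_neg_cancel]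
  · rintro ⟨i, l⟩ - - h
    exact Fin.succAbove_ne i l (Prod.ext_iff.1 h).1
  · exact fun _ _ => Finset.mem_univ _
  · rintro ⟨i, l⟩ -
    have h := Fin.succAbove_succAbove_predAbove (i.succAbove l) (l.predAbove i)
    rw [Fin.succAbove_succAbove_predAbove i l] at h
    exact Prod.ext (Fin.succAbove_succAbove_predAbove i l) (Fin.succAbove_right_injective h)

lemma cubeD_cubeD (φ : ((Fin m → I) → X) → A) (h : (Fin (m + 2) → I) → X) :
    cubeD (cubeD φ) h = 0 := by
  let b : Fin (m + 2) → Fin (m + 1) → I → I → A := fun i l ε ε' => φ ((h ∘ face i ε) ∘ face l ε')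
  have hb : ∀ i l ε ε', b i l ε ε' = b (i.succAbove l) (l.predAbove i) ε' ε := fun i l ε ε' =>
    congrArg φ (funext fun w => congrArg h (face_face i l ε ε' w))
  rw [← sum_neg_one_pow_smul_eq_zero
    (c := fun i l => b i l 1 1 - b i l 1 0 - b i l 0 1 + b i l 0 0)
    fun i l => by rw [hb i l 1 1, hb i l 1 0, hb i l 0 1, hb i l 0 0]; abel]
  refine Finset.sum_congr rfl fun i _ => ?_
  rw [cubeD, cubeD, ← Finset.sum_sub_distrib, Finset.smul_sum]
  refine Finset.sum_congr rfl fun l _ => ?_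
  rw [← smul_sub, smul_smul, ← pow_add]
  congr 1
  simp only [b]
  abel

end CubicalCoboundary

/-! ### The homotopy addition theorem for cubes -/

section HomotopyAddition

open Function

variable {m d : ℕ} {X A : Type*} [TopologicalSpace X] [AddCommGroup A] {b : X}

/-- `f` is a continuous map on a cube that is constant with value `b` on the boundary. -/
def IsLoop (b : X) (f : (Fin m → I) → X) : Prop :=
  Continuous f ∧ ∀ y ∈ Cube.boundary (Fin m), f y = b

lemma isLoop_const : IsLoop b fun _ : Fin m → I => b := ⟨continuous_const, fun _ _ => rfl⟩

/-- Concatenation of maps on cubes in the `i`-th direction. -/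
def concat {X : Type*} (i : Fin m) (f g : (Fin m → I) → X) (y : Fin m → I) : X :=
  if (y i : ℝ) ≤ 1 / 2 then f (update y i (Set.projIcc 0 1 zero_le_one (2 * (y i : ℝ))))
  else g (update y i (Set.projIcc 0 1 zero_le_one (2 * (y i : ℝ) - 1)))

lemma continuous_concat {i : Fin m} {f g : (Fin m → I) → X} (hf : Continuous f)
    (hg : Continuous g) (h : ∀ y, f (update y i 1) = g (update y i 0)) :
    Continuous (concat i f g) := by
  refine Continuous.if_le (hf.comp ?_) (hg.comp ?_) (by fun_prop) continuous_const ?_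
  · exact continuous_id.update i (continuous_projIcc.comp (by fun_prop))
  · exact continuous_id.update i (continuous_projIcc.comp (by fun_prop))
  · intro y hy
    rw [hy, show (2 : ℝ) * (1 / 2) = 1 by norm_num, sub_self, Set.projIcc_left, Set.projIcc_right]
    exact h y

lemma concat_zero {X : Type*} {i : Fin m} {f g : (Fin m → I) → X} {y : Fin m → I} (h : y i = 0) :
    concat i f g y = f y := by
  have h0 : Set.projIcc (0 : ℝ) 1 zero_le_one (2 * (y i : ℝ)) = y i := by
    rw [h, Set.Icc.coe_zero, mul_zero, Set.projIcc_left]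
    rfl
  rw [concat, if_pos (by rw [h]; norm_num), h0, update_eq_self]

lemma concat_one {X : Type*} {i : Fin m} {f g : (Fin m → I) → X} {y : Fin m → I} (h : y i = 1) :
    concat i f g y = g y := by
  have h0 : Set.projIcc (0 : ℝ) 1 zero_le_one (2 * (y i : ℝ) - 1) = y i := by
    rw [h, Set.Icc.coe_one, show (2 : ℝ) * 1 - 1 = 1 by norm_num, Set.projIcc_right]
    rfl
  rw [concat, if_neg (by rw [h]; norm_num), h0, update_eq_self]

lemma concat_comp_face_same_zero {X : Type*} (i : Fin (m + 1)) (f g : (Fin (m + 1) → I) → X) :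
    concat i f g ∘ face i 0 = f ∘ face i 0 := by
  ext1 y; exact concat_zero (face_same i 0 y)

lemma concat_comp_face_same_one {X : Type*} (i : Fin (m + 1)) (f g : (Fin (m + 1) → I) → X) :
    concat i f g ∘ face i 1 = g ∘ face i 1 := by
  ext1 y; exact concat_one (face_same i 1 y)

lemma update_face_succAbove (j : Fin (m + 1)) (ε : I) (i : Fin m) (y : Fin m → I) (a : I) :
    update (face j ε y) (j.succAbove i) a = face j ε (update y i a) :=
  (Fin.insertNth_update (α := fun _ => I) j ε i a y).symm

lemma concat_comp_face {X : Type*} (j : Fin (m + 1)) (ε : I) (i : Fin m)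
    (f g : (Fin (m + 1) → I) → X) :
    concat (j.succAbove i) f g ∘ face j ε = concat i (f ∘ face j ε) (g ∘ face j ε) := by
  ext1 y
  simp only [concat, comp_apply, face_succAbove, update_face_succAbove]

lemma concat_const {X : Type*} (b : X) (i : Fin m) :
    concat i (fun _ => b) (fun _ => b) = fun _ => b :=
  funext fun _ => ite_self b

lemma update_mem_boundary {i : Fin m} {a : I} (ha : a = 0 ∨ a = 1) (y : Fin m → I) :
    update y i a ∈ Cube.boundary (Fin m) :=
  ⟨i, by rwa [update_self]⟩

lemma IsLoop.concat {i : Fin m} {f g : (Fin m → I) → X} (hf : IsLoop b f) (hg : IsLoop b g) :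
    IsLoop b (concat i f g) := by
  refine ⟨continuous_concat hf.1 hg.1 fun y => ?_, fun y hy => ?_⟩
  · rw [hf.2 _ (update_mem_boundary (Or.inr rfl) y), hg.2 _ (update_mem_boundary (Or.inl rfl) y)]
  · obtain ⟨j, hj⟩ := hy
    rcases eq_or_ne j i with rfl | hij
    · rcases hj with hj | hj
      · rw [concat_zero hj, hf.2 _ ⟨j, Or.inl hj⟩]
      · rw [concat_one hj, hg.2 _ ⟨j, Or.inr hj⟩]
    · have : ∀ a : I, update y i a ∈ Cube.boundary (Fin m) :=
        fun a => ⟨j, by rwa [update_of_ne hij]⟩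
      rw [EulerBordism.concat, hf.2 _ (this _), hg.2 _ (this _), ite_self]

/-- The reparametrization of a map on a cube by `u : I → I` in the `i`-th coordinate. -/
def reparam {X : Type*} (i : Fin m) (u : I → I) (f : (Fin m → I) → X) (y : Fin m → I) : X :=
  f (update y i (u (y i)))

lemma reparam_id {X : Type*} (i : Fin m) (f : (Fin m → I) → X) : reparam i (fun a => a) f = f :=
  funext fun y => congrArg f (update_eq_self i y)

lemma IsLoop.reparam_zero {f : (Fin m → I) → X} (hf : IsLoop b f) (i : Fin m) :
    reparam i (fun _ => 0) f = fun _ => b :=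
  funext fun y => hf.2 _ (update_mem_boundary (Or.inl rfl) y)

lemma IsLoop.reparam {f : (Fin m → I) → X} (hf : IsLoop b f) (i : Fin m) {u : I → I}
    (hu : Continuous u) (hu01 : ∀ a, a = 0 ∨ a = 1 → u a = 0 ∨ u a = 1) :
    IsLoop b (reparam i u f) := by
  refine ⟨hf.1.comp (continuous_id.update i (hu.comp (continuous_apply i))),
    fun y ⟨j, hj⟩ => hf.2 _ ⟨j, ?_⟩⟩
  rcases eq_or_ne j i with rfl | h
  · rw [update_self]
    exact hu01 _ hj
  · rwa [update_of_ne h]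

/-- An additive homotopy invariant of based maps of `d`-cubes. -/
structure IsLoopClass (b : X) (cl : ((Fin d → I) → X) → A) : Prop where
  const : cl (fun _ => b) = 0
  concat : ∀ i f g, IsLoop b f → IsLoop b g → cl (concat i f g) = cl f + cl g
  symm : ∀ i f, IsLoop b f → cl (reparam i unitInterval.symm f) = -cl f
  homotopy : ∀ h : I × (Fin d → I) → X, Continuous h →
    (∀ t, ∀ y ∈ Cube.boundary (Fin d), h (t, y) = b) →
    cl (fun y => h (0, y)) = cl (fun y => h (1, y))

/-- All faces of the cube `h` are based maps. -/
def HasLoopFaces (b : X) (h : (Fin (m + 1) → I) → X) : Prop :=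
  Continuous h ∧ ∀ i, ∀ ε : I, (ε = 0 ∨ ε = 1) → IsLoop b (h ∘ face i ε)

lemma HasLoopFaces.concat {i : Fin (m + 1)} {f g : (Fin (m + 1) → I) → X}
    (hf : HasLoopFaces b f) (hg : HasLoopFaces b g) (h : f ∘ face i 1 = g ∘ face i 0) :
    HasLoopFaces b (concat i f g) := by
  refine ⟨continuous_concat hf.1 hg.1 fun y => ?_, fun j ε hε => ?_⟩
  · have := congrFun h fun l => y (i.succAbove l)
    have e : ∀ a, face i a (fun l => y (i.succAbove l)) = update y i a := fun a =>
      Fin.insertNth_removeNth (α := fun _ => I) i a y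
    simpa only [comp_apply, e] using this
  · rcases Fin.eq_self_or_eq_succAbove j i with rfl | ⟨l, rfl⟩
    · rcases hε with rfl | rfl
      · rw [concat_comp_face_same_zero]; exact hf.2 _ _ (Or.inl rfl)
      · rw [concat_comp_face_same_one]; exact hg.2 _ _ (Or.inr rfl)
    · rw [concat_comp_face]
      exact (hf.2 _ _ hε).concat (hg.2 _ _ hε)

variable {cl : ((Fin d → I) → X) → A}

lemma IsLoopClass.cubeD_concat (hcl : IsLoopClass b cl) {i : Fin (d + 1)}
    {f g : (Fin (d + 1) → I) → X}
    (hf : HasLoopFaces b f) (hg : HasLoopFaces b g) (h : f ∘ face i 1 = g ∘ face i 0) :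
    cubeD cl (EulerBordism.concat i f g) = cubeD cl f + cubeD cl g := by
  unfold cubeD
  rw [← Finset.sum_add_distrib]
  refine Finset.sum_congr rfl fun j _ => ?_
  rw [← smul_add]
  congr 1
  rcases Fin.eq_self_or_eq_succAbove j i with rfl | ⟨l, rfl⟩
  · rw [concat_comp_face_same_zero, concat_comp_face_same_one, h]
    abel
  · rw [concat_comp_face, concat_comp_face,
      hcl.concat _ _ _ (hf.2 _ _ (Or.inl rfl)) (hg.2 _ _ (Or.inl rfl)),
      hcl.concat _ _ _ (hf.2 _ _ (Or.inr rfl)) (hg.2 _ _ (Or.inr rfl))]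
    abel

lemma succ_succAbove_of_ne {i l : Fin d} (h : l ≠ i) :
    i.succ.succAbove l = i.castSucc.succAbove l := by
  have : (l : ℕ) ≠ i := Fin.val_ne_of_ne h
  simp only [Fin.succAbove, Fin.lt_def, Fin.val_castSucc, Fin.val_succ, Fin.ext_iff]
  split_ifs <;> simp only [Fin.val_castSucc, Fin.val_succ] <;> omega

/-- The cube obtained from `f` by replacing its `i`-th coordinate with a function `w` of two
coordinates. Its faces in all directions other than `i` and `i + 1` are constant if `f` is based. -/
def slide {X : Type*} (i : Fin d) (w : I × I → I) (f : (Fin d → I) → X) (y : Fin (d + 1) → I) : X :=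
  f (update (fun l => y (i.succ.succAbove l)) i (w (y i.castSucc, y i.succ)))

lemma slide_comp_face_succ {X : Type*} (i : Fin d) (w : I × I → I) (f : (Fin d → I) → X) (ε : I) :
    slide i w f ∘ face i.succ ε = reparam i (fun a => w (a, ε)) f := by
  ext1 y
  have h : face i.succ ε y i.castSucc = y i := by
    rw [← Fin.succAbove_succ_self i, face_succAbove]
  simp only [slide, reparam, comp_apply, h, face_same, face_succAbove]

lemma slide_comp_face_castSucc {X : Type*} (i : Fin d) (w : I × I → I)
    (f : (Fin d → I) → X) (ε : I) :
    slide i w f ∘ face i.castSucc ε = reparam i (fun a => w (ε, a)) f := by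
  ext1 y
  have h : face i.castSucc ε y i.succ = y i := by
    rw [← Fin.succAbove_castSucc_self i, face_succAbove]
  simp only [slide, reparam, comp_apply, h, face_same]
  congr 1
  ext1 l
  rcases eq_or_ne l i with rfl | hl
  · rw [update_self, update_self]
  · rw [update_of_ne hl, update_of_ne hl, succ_succAbove_of_ne hl, face_succAbove]

lemma IsLoop.slide_comp_face_of_ne {i : Fin d} {f : (Fin d → I) → X} (hf : IsLoop b f)
    (w : I × I → I) {j : Fin (d + 1)} (hj : j ≠ i.succ) (hj' : j ≠ i.castSucc) {ε : I}
    (hε : ε = 0 ∨ ε = 1) : slide i w f ∘ face j ε = fun _ => b := by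
  ext1 y
  obtain ⟨l, rfl⟩ := Fin.exists_succAbove_eq hj
  refine hf.2 _ ⟨l, ?_⟩
  have hl : l ≠ i := by
    rintro rfl
    exact hj' (Fin.succAbove_succ_self l)
  rwa [update_of_ne hl, face_same]

lemma IsLoop.slide {i : Fin d} {f : (Fin d → I) → X} (hf : IsLoop b f) {w : I × I → I}
    (hw : Continuous w)
    (hw01 : ∀ a c, a = 0 ∨ a = 1 → c = 0 ∨ c = 1 → w (a, c) = 0 ∨ w (a, c) = 1) :
    HasLoopFaces b (slide i w f) := by
  refine ⟨hf.1.comp ((continuous_pi fun _ => continuous_apply _).update i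
    (hw.comp ((continuous_apply _).prodMk (continuous_apply _)))), fun j ε hε => ?_⟩
  by_cases hj : j = i.succ
  · rw [hj, slide_comp_face_succ]
    exact hf.reparam i (by fun_prop) fun a ha => hw01 a ε ha hε
  by_cases hj' : j = i.castSucc
  · rw [hj', slide_comp_face_castSucc]
    exact hf.reparam i (by fun_prop) fun a ha => hw01 ε a hε ha
  · rw [hf.slide_comp_face_of_ne w hj hj' hε]
    exact isLoop_const

lemma IsLoop.cubeD_slide {i : Fin d} {f : (Fin d → I) → X} (hf : IsLoop b f) (w : I × I → I)
    (φ : ((Fin d → I) → X) → A) :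
    cubeD φ (EulerBordism.slide i w f) = (-1 : ℤ) ^ (i : ℕ) •
      ((φ (EulerBordism.reparam i (fun a => w (1, a)) f) -
        φ (EulerBordism.reparam i (fun a => w (0, a)) f)) -
      (φ (EulerBordism.reparam i (fun a => w (a, 1)) f) -
        φ (EulerBordism.reparam i (fun a => w (a, 0)) f))) := by
  rw [cubeD, Fintype.sum_eq_add i.castSucc i.succ (Fin.castSucc_lt_succ (i := i)).ne fun j hj => by
    rw [hf.slide_comp_face_of_ne w hj.2 hj.1 (Or.inl rfl),
      hf.slide_comp_face_of_ne w hj.2 hj.1 (Or.inr rfl), sub_self, smul_zero]]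
  simp only [slide_comp_face_castSucc, slide_comp_face_succ, Fin.val_castSucc, Fin.val_succ,
    pow_succ, mul_neg, mul_one, neg_smul]
  rw [← sub_eq_add_neg, ← smul_sub]

/-- The truncated difference of coordinates. Sliding along it moves the face `y_{i+1} = 0` of a
cube to direction `i`. -/
def truncSub (a : I × I) : I := Set.projIcc 0 1 zero_le_one ((a.1 : ℝ) - a.2)

/-- The truncated sum of coordinates, dual to `truncSub`. -/
def truncAdd (a : I × I) : I := Set.projIcc 0 1 zero_le_one ((a.1 : ℝ) + a.2 - 1)

lemma continuous_truncSub : Continuous truncSub := continuous_projIcc.comp (by fun_prop)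

lemma continuous_truncAdd : Continuous truncAdd := continuous_projIcc.comp (by fun_prop)

lemma truncSub_zero_right (a : I) : truncSub (a, 0) = a := by simp [truncSub]

lemma truncSub_one_right (a : I) : truncSub (a, 1) = 0 :=
  Set.projIcc_of_le_left zero_le_one (sub_nonpos.2 a.2.2)

lemma truncSub_zero_left (a : I) : truncSub (0, a) = 0 :=
  Set.projIcc_of_le_left zero_le_one (sub_nonpos.2 a.2.1)

lemma truncSub_one_left (a : I) : truncSub (1, a) = unitInterval.symm a :=
  Set.projIcc_val zero_le_one (unitInterval.symm a)

lemma truncAdd_one_right (a : I) : truncAdd (a, 1) = a := by simp [truncAdd]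

lemma truncAdd_one_left (a : I) : truncAdd (1, a) = a := by simp [truncAdd]

lemma truncAdd_zero_right (a : I) : truncAdd (a, 0) = 0 :=
  Set.projIcc_of_le_left zero_le_one (by simpa using a.2.2)

lemma truncAdd_zero_left (a : I) : truncAdd (0, a) = 0 :=
  Set.projIcc_of_le_left zero_le_one (by simpa using a.2.2)

lemma IsLoop.slide_truncSub {f : (Fin d → I) → X} (hf : IsLoop b f) (i : Fin d) :
    HasLoopFaces b (EulerBordism.slide i truncSub f) := by
  refine hf.slide continuous_truncSub ?_
  rintro a _ ha (rfl | rfl)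
  · rwa [truncSub_zero_right]
  · exact Or.inl (truncSub_one_right a)

lemma IsLoop.slide_truncAdd {f : (Fin d → I) → X} (hf : IsLoop b f) (i : Fin d) :
    HasLoopFaces b (EulerBordism.slide i truncAdd f) := by
  refine hf.slide continuous_truncAdd ?_
  rintro a _ ha (rfl | rfl)
  · exact Or.inl (truncAdd_zero_right a)
  · rwa [truncAdd_one_right]

lemma IsLoopClass.cubeD_slide_truncSub (hcl : IsLoopClass b cl) (i : Fin d) {f : (Fin d → I) → X}
    (hf : IsLoop b f) : cubeD cl (slide i truncSub f) = 0 := by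
  rw [hf.cubeD_slide]
  simp only [truncSub_one_left, truncSub_zero_left, truncSub_one_right, truncSub_zero_right,
    reparam_id, hf.reparam_zero, hcl.const]
  rw [hcl.symm i f hf, sub_zero, zero_sub, sub_self, smul_zero]

lemma IsLoopClass.cubeD_slide_truncAdd (hcl : IsLoopClass b cl) (i : Fin d) {f : (Fin d → I) → X}
    (hf : IsLoop b f) : cubeD cl (slide i truncAdd f) = 0 := by
  rw [hf.cubeD_slide]
  simp only [truncAdd_one_left, truncAdd_zero_left, truncAdd_one_right, truncAdd_zero_right,
    reparam_id, hf.reparam_zero, hcl.const]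
  rw [sub_self, smul_zero]

/-- The faces in direction `i + 1` are moved to direction `i` by gluing on two slides, whose
coboundary vanishes. -/
lemma IsLoopClass.exists_trivialize_face (hcl : IsLoopClass b cl) (i : Fin d)
    {h : (Fin (d + 1) → I) → X} (hh : HasLoopFaces b h) :
    ∃ h', HasLoopFaces b h' ∧ cubeD cl h' = cubeD cl h ∧
      (∀ ε : I, (ε = 0 ∨ ε = 1) → h' ∘ face i.succ ε = fun _ => b) ∧
      ∀ j, i.succ < j → ∀ ε : I, (ε = 0 ∨ ε = 1) → (h ∘ face j ε = fun _ => b) →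
        h' ∘ face j ε = fun _ => b := by
  have hf₁ := hh.2 i.succ 1 (Or.inr rfl)
  have hr₁ : h ∘ face i.succ 1 = slide i truncSub (h ∘ face i.succ 1) ∘ face i.succ 0 := by
    simp only [slide_comp_face_succ, truncSub_zero_right, reparam_id]
  have hh₁ := hh.concat (hf₁.slide_truncSub i) hr₁
  set h₁ := EulerBordism.concat i.succ h (slide i truncSub (h ∘ face i.succ 1))
  have hf₀ := hh₁.2 i.succ 0 (Or.inl rfl)
  have hr₀ : slide i truncAdd (h₁ ∘ face i.succ 0) ∘ face i.succ 1 = h₁ ∘ face i.succ 0 := by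
    simp only [slide_comp_face_succ, truncAdd_one_right, reparam_id]
  refine ⟨_, (hf₀.slide_truncAdd i).concat hh₁ hr₀, ?_, ?_, fun j hj ε hε hc => ?_⟩
  · rw [hcl.cubeD_concat (hf₀.slide_truncAdd i) hh₁ hr₀, hcl.cubeD_slide_truncAdd i hf₀, zero_add,
      hcl.cubeD_concat hh (hf₁.slide_truncSub i) hr₁, hcl.cubeD_slide_truncSub i hf₁, add_zero]
  · rintro ε (rfl | rfl)
    · rw [concat_comp_face_same_zero, slide_comp_face_succ]
      simp only [truncAdd_zero_right, hf₀.reparam_zero]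
    · rw [concat_comp_face_same_one, concat_comp_face_same_one, slide_comp_face_succ]
      simp only [truncSub_one_right, hf₁.reparam_zero]
  · have hne : j ≠ i.castSucc := ((Fin.castSucc_lt_succ (i := i)).trans hj).ne'
    have hs₁ := hf₁.slide_comp_face_of_ne truncSub hj.ne' hne hε
    have hs₀ := hf₀.slide_comp_face_of_ne truncAdd hj.ne' hne hε
    obtain ⟨l, hl⟩ := Fin.exists_succAbove_eq hj.ne
    have hcc : ∀ f g : (Fin (d + 1) → I) → X, EulerBordism.concat i.succ f g ∘ face j ε =
        EulerBordism.concat l (f ∘ face j ε) (g ∘ face j ε) :=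
      hl ▸ concat_comp_face j ε l
    rw [hcc, hcc, hs₁, hs₀, hc, concat_const, concat_const]

lemma IsLoopClass.cubeD_eq_zero_of_faces (hcl : IsLoopClass b cl) {h : (Fin (d + 1) → I) → X}
    (hh : Continuous h) (hconst : ∀ l : Fin d, ∀ ε : I, (ε = 0 ∨ ε = 1) →
      h ∘ face l.succ ε = fun _ => b) : cubeD cl h = 0 := by
  rw [cubeD_eq_sub fun l => by rw [hconst l 1 (Or.inr rfl), hconst l 0 (Or.inl rfl)], sub_eq_zero]
  refine (hcl.homotopy (fun z => h (face 0 z.1 z.2)) (hh.comp (continuous_face_uncurry 0))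
    ?_).symm
  rintro t y ⟨l, hl⟩
  rw [← face_removeNth (face_zero_succ t y l)]
  exact congrFun (hconst l (y l) hl) _

/-- The homotopy addition theorem: in a cube all of whose faces are based, the faces in directions
`d, d - 1, …, 1` are successively made constant, and what is left is a homotopy. -/
theorem IsLoopClass.cubeD_eq_zero (hcl : IsLoopClass b cl) {h : (Fin (d + 1) → I) → X}
    (hh : HasLoopFaces b h) : cubeD cl h = 0 := by
  suffices H : ∀ n ≤ d, ∀ h : (Fin (d + 1) → I) → X, HasLoopFaces b h →
      (∀ j : Fin (d + 1), n < j → ∀ ε : I, (ε = 0 ∨ ε = 1) → h ∘ face j ε = fun _ => b) →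
      cubeD cl h = 0 from
    H d le_rfl h hh fun j hj => absurd j.2 (by omega)
  intro n
  induction n with
  | zero => exact fun _ h hh hj => hcl.cubeD_eq_zero_of_faces hh.1 fun l => hj l.succ l.succ_pos
  | succ n ih =>
    intro hn h hh hj
    obtain ⟨h', hh', hD, hi, hgt⟩ := hcl.exists_trivialize_face ⟨n, hn⟩ hh
    rw [← hD]
    refine ih (Nat.le_of_succ_le hn) h' hh' fun j hnj ε hε => ?_
    rcases (Nat.succ_le_of_lt hnj).eq_or_lt with e | hlt
    · obtain rfl : Fin.succ ⟨n, hn⟩ = j := Fin.ext e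
      exact hi ε hε
    · exact hgt j hlt ε hε (hj j hlt ε hε)

end HomotopyAddition

/-! ### Extension of maps into spheres -/

section SphereExtension

instance (k : ℕ) : Nonempty (Sph (k + 1)) := ⟨basePt k⟩

/-- Maps from the boundary of the `m`-cube to `X` extend to the cube. -/
def CubeExtension (X : Type*) [TopologicalSpace X] (m : ℕ) : Prop :=
  ∀ g : (Fin m → I) → X, ContinuousOn g (Cube.boundary (Fin m)) →
    ∃ G, Continuous G ∧ Set.EqOn G g (Cube.boundary (Fin m))

/-- Radial projection to the unit sphere, with an arbitrary value at the origin. -/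
def toSphere {k : ℕ} (x : EuclideanSpace ℝ (Fin (k + 1))) : Sph (k + 1) :=
  open Classical in
  if h : x = 0 then basePt k else ⟨‖x‖⁻¹ • x, by simp [norm_smul, h]⟩

lemma continuousOn_toSphere (k : ℕ) :
    ContinuousOn (toSphere (k := k)) {x | x ≠ 0} := by
  rw [Topology.IsInducing.subtypeVal.continuousOn_iff]
  have h : ContinuousOn (fun x : EuclideanSpace ℝ (Fin (k + 1)) => ‖x‖⁻¹ • x) {x | x ≠ 0} :=
    ContinuousOn.smul (continuous_norm.continuousOn.inv₀ fun x hx => norm_ne_zero_iff.2 hx)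
      continuousOn_id
  refine h.congr fun x hx => ?_
  simp only [Function.comp_apply, toSphere, dif_neg hx]

lemma toSphere_coe {k : ℕ} (x : Sph (k + 1)) :
    toSphere (x : EuclideanSpace ℝ (Fin (k + 1))) = x := by
  ext1
  rw [toSphere, dif_neg (ne_zero_of_mem_unit_sphere x)]
  simp only [norm_eq_of_mem_sphere, inv_one, one_smul]

/-- By Sard's theorem, a smooth approximation of the map misses points arbitrarily close to the
origin. -/
lemma exists_ne_zero_approx {m : ℕ} {E : Type*} [NormedAddCommGroup E] [NormedSpace ℝ E]
    [FiniteDimensional ℝ E] (hm : m < Module.finrank ℝ E) {f : (Fin m → I) → E}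
    (hf : Continuous f) {δ : ℝ} (hδ : 0 < δ) :
    ∃ P : (Fin m → I) → E, Continuous P ∧ (∀ y, P y ≠ 0) ∧ ∀ y, ‖P y - f y‖ < δ := by
  let proj : (Fin m → ℝ) → (Fin m → I) := fun x i => Set.projIcc 0 1 zero_le_one (x i)
  have hproj : Continuous proj :=
    continuous_pi fun i => continuous_projIcc.comp (continuous_apply i)
  obtain ⟨q, hq, hqf, -⟩ := (hf.comp hproj).exists_contDiff_approx 1
    (ε := fun _ => δ / 2) continuous_const fun _ => half_pos hδ
  have hdense := hq.dense_compl_range_of_finrank_lt_finrank (by rwa [Module.finrank_fin_fun])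
  obtain ⟨a, ha, haδ⟩ := hdense.exists_mem_open Metric.isOpen_ball
    (⟨0, Metric.mem_ball_self (half_pos hδ)⟩ : (Metric.ball (0 : E) (δ / 2)).Nonempty)
  let incl : (Fin m → I) → (Fin m → ℝ) := fun y i => y i
  have hincl : Continuous incl := by fun_prop
  refine ⟨fun y => q (incl y) - a, (hq.continuous.comp hincl).sub continuous_const,
    fun y h => ha ⟨incl y, sub_eq_zero.1 h⟩, fun y => ?_⟩
  have hy : proj (incl y) = y := funext fun i => Set.projIcc_val zero_le_one (y i)
  have hqy : ‖q (incl y) - f y‖ < δ / 2 := by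
    simpa only [Function.comp_apply, hy, dist_eq_norm] using hqf (incl y)
  calc ‖q (incl y) - a - f y‖ = ‖(q (incl y) - f y) - a‖ := by rw [sub_right_comm]
    _ ≤ ‖q (incl y) - f y‖ + ‖a‖ := norm_sub_le _ _
    _ < δ := by linarith [mem_ball_zero_iff.1 haδ]

lemma lineMap_ne_zero_of_norm_sub_lt {E : Type*} [NormedAddCommGroup E] [NormedSpace ℝ E] {v w : E}
    (h : ‖v - w‖ < ‖w‖) (t : I) : AffineMap.lineMap v w (t : ℝ) ≠ 0 := by
  intro h0
  have hdist := dist_lineMap_right v w (t : ℝ)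
  rw [h0, dist_zero_left, dist_eq_norm, Real.norm_of_nonneg (sub_nonneg.2 t.2.2)] at hdist
  have := mul_le_of_le_one_left (norm_nonneg (v - w)) (sub_le_self 1 t.2.1)
  linarith

/-- The map on the boundary is homotopic to the radial projection of a nearby map that extends to
the cube. -/
theorem cubeExtension_sphere {k m : ℕ} (hm : m ≤ k) : CubeExtension (Sph (k + 1)) m := by
  intro g hg
  obtain ⟨f, hf⟩ := ContinuousMap.exists_restrict_eq (isClosed_boundary (Fin m))
    (⟨fun y => (g y : EuclideanSpace ℝ (Fin (k + 1))),
      continuous_subtype_val.comp hg.domRestrict⟩ : C(Cube.boundary (Fin m), _))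
  have hfg : ∀ y ∈ Cube.boundary (Fin m), f y = g y := fun y hy =>
    DFunLike.congr_fun hf ⟨y, hy⟩
  obtain ⟨P, hP, hP0, hPf⟩ := exists_ne_zero_approx
    (by rw [finrank_euclideanSpace_fin]; exact Nat.lt_succ_of_le hm) f.continuous one_pos
  let R : I × (Fin m → I) → EuclideanSpace ℝ (Fin (k + 1)) :=
    fun z => AffineMap.lineMap (P z.2) (f z.2) (z.1 : ℝ)
  have hR : Continuous R := by
    simp only [R, AffineMap.lineMap_apply_module]
    fun_prop
  have hR0 : Set.MapsTo R (Set.univ ×ˢ Cube.boundary (Fin m)) {x | x ≠ 0} := by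
    rintro ⟨t, y⟩ ⟨-, hy⟩
    refine lineMap_ne_zero_of_norm_sub_lt ?_ t
    rw [hfg y hy, norm_eq_of_mem_sphere, ← hfg y hy]
    exact hPf y
  obtain ⟨G, hG, -, hGb⟩ := exists_homotopy_extension (g := fun y => toSphere (P y))
    (H := fun z => toSphere (R z))
    ((continuousOn_toSphere k).comp_continuous hP hP0)
    ((continuousOn_toSphere k).comp hR.continuousOn hR0)
    fun y _ => congrArg toSphere (AffineMap.lineMap_apply_zero _ _)
  refine ⟨fun y => G (1, y), hG.comp (by fun_prop), fun y hy => ?_⟩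
  have hR1 : R (1, y) = g y := (AffineMap.lineMap_apply_one _ _).trans (hfg y hy)
  change G (1, y) = g y
  rw [hGb 1 y hy, hR1, toSphere_coe]

lemma CubeExtension.prod {X Y : Type*} [TopologicalSpace X] [TopologicalSpace Y] {m : ℕ}
    (hX : CubeExtension X m) (hY : CubeExtension Y m) : CubeExtension (X × Y) m := by
  intro g hg
  obtain ⟨G, hG, hGg⟩ := hX _ (continuous_fst.comp_continuousOn hg)
  obtain ⟨G', hG', hGg'⟩ := hY _ (continuous_snd.comp_continuousOn hg)
  exact ⟨fun y => (G y, G' y), hG.prodMk hG', fun y hy => Prod.ext (hGg hy) (hGg' hy)⟩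

lemma cubeExtension_unitInterval (m : ℕ) : CubeExtension I m := by
  intro g hg
  obtain ⟨f, hf⟩ := ContinuousMap.exists_restrict_eq (isClosed_boundary (Fin m))
    (⟨fun y => (g y : ℝ), continuous_subtype_val.comp hg.domRestrict⟩ : C(Cube.boundary (Fin m), ℝ))
  refine ⟨fun y => Set.projIcc 0 1 zero_le_one (f y), continuous_projIcc.comp f.continuous,
    fun y hy => ?_⟩
  have : f y = g y := DFunLike.congr_fun hf ⟨y, hy⟩
  simp only [this, Set.projIcc_val]

variable {X : Type*} [TopologicalSpace X] {m : ℕ} {g₀ g₁ : (Fin m → I) → X}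
  {H : I × (Fin m → I) → X}

lemma exists_continuousOn_prism_boundary (h₀ : Continuous g₀) (h₁ : Continuous g₁)
    (hH : ContinuousOn H (Set.univ ×ˢ Cube.boundary (Fin m)))
    (H0 : ∀ y ∈ Cube.boundary (Fin m), H (0, y) = g₀ y)
    (H1 : ∀ y ∈ Cube.boundary (Fin m), H (1, y) = g₁ y) :
    ∃ β : (Fin (m + 1) → I) → X, ContinuousOn β (Cube.boundary (Fin (m + 1))) ∧
      (∀ y, β (face 0 0 y) = g₀ y) ∧ (∀ y, β (face 0 1 y) = g₁ y) ∧
      ∀ t, ∀ y ∈ Cube.boundary (Fin m), β (face 0 t y) = H (t, y) := by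
  classical
  let tail : (Fin (m + 1) → I) → (Fin m → I) := fun y j => y j.succ
  have htail : Continuous tail := continuous_tail
  have tail_face : ∀ t y, tail (face 0 t y) = y := fun t y => funext (face_zero_succ t y)
  let β : (Fin (m + 1) → I) → X := fun y =>
    if y 0 = 0 then g₀ (tail y) else if y 0 = 1 then g₁ (tail y) else H (y 0, tail y)
  have β0 : ∀ y, y 0 = 0 → β y = g₀ (tail y) := fun y hy => if_pos hy
  have β1 : ∀ y, y 0 = 1 → β y = g₁ (tail y) := fun y hy => by
    simp only [β, hy, one_ne_zero, if_false, if_true]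
  have βH : ∀ y, tail y ∈ Cube.boundary (Fin m) → β y = H (y 0, tail y) := fun y hy => by
    simp only [β]
    split_ifs with h h
    · rw [h, H0 _ hy]
    · rw [h, H1 _ hy]
    · rfl
  refine ⟨β, ?_, fun y => ?_, fun y => ?_, fun t y hy => ?_⟩
  · have hbdry : Cube.boundary (Fin (m + 1)) =
        ({y | y 0 = 0} ∪ {y | y 0 = 1}) ∪ tail ⁻¹' Cube.boundary (Fin m) := by
      ext y
      rw [← face_zero_tail y, face_zero_mem_boundary_iff]
      simp [tail]
    have closed : ∀ ε : I, IsClosed {y : Fin (m + 1) → I | y 0 = ε} := fun ε =>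
      isClosed_eq (continuous_apply 0) continuous_const
    rw [hbdry]
    refine ContinuousOn.union_of_isClosed (ContinuousOn.union_of_isClosed
      ((h₀.comp htail).continuousOn.congr β0) ((h₁.comp htail).continuousOn.congr β1)
      (closed 0) (closed 1)) ?_ ((closed 0).union (closed 1))
      ((isClosed_boundary (Fin m)).preimage htail)
    refine ContinuousOn.congr ?_ βH
    exact hH.comp ((continuous_apply 0).prodMk htail).continuousOn fun y hy => ⟨trivial, hy⟩
  · rw [β0 _ (face_same _ _ _), tail_face]
  · rw [β1 _ (face_same _ _ _), tail_face]
  · rw [βH _ (by rwa [tail_face]), face_same, tail_face]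

lemma CubeExtension.prism (hX : CubeExtension X (m + 1)) (h₀ : Continuous g₀) (h₁ : Continuous g₁)
    (hH : ContinuousOn H (Set.univ ×ˢ Cube.boundary (Fin m)))
    (H0 : ∀ y ∈ Cube.boundary (Fin m), H (0, y) = g₀ y)
    (H1 : ∀ y ∈ Cube.boundary (Fin m), H (1, y) = g₁ y) :
    ∃ G : I × (Fin m → I) → X, Continuous G ∧ (∀ y, G (0, y) = g₀ y) ∧ (∀ y, G (1, y) = g₁ y) ∧
      ∀ t, ∀ y ∈ Cube.boundary (Fin m), G (t, y) = H (t, y) := by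
  obtain ⟨β, hβ, β0, β1, βH⟩ := exists_continuousOn_prism_boundary h₀ h₁ hH H0 H1
  obtain ⟨G, hG, hGβ⟩ := hX β hβ
  exact ⟨fun z => G (face 0 z.1 z.2), hG.comp (continuous_face_uncurry 0),
    fun y => (hGβ (face_mem_boundary 0 (Or.inl rfl) y)).trans (β0 y),
    fun y => (hGβ (face_mem_boundary 0 (Or.inr rfl) y)).trans (β1 y),
    fun t y hy => (hGβ (face_zero_mem_boundary_iff.2 (Or.inr hy))).trans (βH t y hy)⟩

end SphereExtension

/-! ### The fundamental cocycle of a highly connected space -/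

section FundamentalCocycle

variable {d : ℕ} {X A : Type*} [TopologicalSpace X] [AddCommGroup A] {b : X}

/-- `G` is a homotopy that starts with `s`, ends with a constant if `j < d`, and is constant if `s`
is the constant cube `b`. -/
def IsContraction (b : X) (d : ℕ) {j : ℕ} (s : (Fin j → I) → X) (G : I × (Fin j → I) → X) : Prop :=
  Continuous G ∧ (∀ y, G (0, y) = s y) ∧ (j < d → ∀ y, G (1, y) = b) ∧
    ((s = fun _ => b) → G = fun _ => b)

/-- A contraction of all cubes of dimension less than `d` in a `(d-1)`-connected space, compatible
with faces, and a compatible deformation of the `d`-cubes to based maps. If there is no such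
homotopy, the value is arbitrary. -/
def contraction (b : X) (d : ℕ) : (j : ℕ) → ((Fin j → I) → X) → (I × (Fin j → I) → X)
  | 0, s => haveI : Nonempty X := ⟨b⟩; Classical.epsilon (IsContraction b d s)
  | j + 1, s => haveI : Nonempty X := ⟨b⟩
    Classical.epsilon fun G => IsContraction b d s G ∧ ∀ i, ∀ ε : I, (ε = 0 ∨ ε = 1) → ∀ t y,
      G (t, face i ε y) = contraction b d j (s ∘ face i ε) (t, y)

/-- The contractions of `(j+1)`-cubes extend the contractions of their faces. -/
def ContractsFaces (b : X) (d j : ℕ) : Prop :=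
  ∀ s : (Fin (j + 1) → I) → X, Continuous s → ∀ i, ∀ ε : I, (ε = 0 ∨ ε = 1) → ∀ t y,
    contraction b d (j + 1) s (t, face i ε y) = contraction b d j (s ∘ face i ε) (t, y)

lemma exists_isContraction (hX : ∀ j ≤ d, CubeExtension X j) {j : ℕ} (hj : j ≤ d)
    {s : (Fin j → I) → X} (hs : Continuous s) {H : I × (Fin j → I) → X}
    (hH : ContinuousOn H (Set.univ ×ˢ Cube.boundary (Fin j)))
    (H0 : ∀ y ∈ Cube.boundary (Fin j), H (0, y) = s y)
    (H1 : j < d → ∀ y ∈ Cube.boundary (Fin j), H (1, y) = b)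
    (Hb : (s = fun _ => b) → ∀ t, ∀ y ∈ Cube.boundary (Fin j), H (t, y) = b) :
    ∃ G, IsContraction b d s G ∧ ∀ t, ∀ y ∈ Cube.boundary (Fin j), G (t, y) = H (t, y) := by
  by_cases hsb : s = fun _ => b
  · exact ⟨fun _ => b, ⟨continuous_const, fun y => by rw [hsb], fun _ _ => rfl, fun _ => rfl⟩,
      fun t y hy => (Hb hsb t y hy).symm⟩
  · rcases hj.lt_or_eq with hlt | rfl
    · obtain ⟨G, hG, h0, h1, hb⟩ := (hX (j + 1) hlt).prism hs (continuous_const (y := b)) hH H0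
        (H1 hlt)
      exact ⟨G, ⟨hG, h0, fun _ => h1, fun h => absurd h hsb⟩, hb⟩
    · obtain ⟨G, hG, h0, hb⟩ := exists_homotopy_extension hs hH H0
      exact ⟨G, ⟨hG, h0, fun h => absurd h (lt_irrefl _), fun h => absurd h hsb⟩, hb⟩

lemma contraction_face_congr {j : ℕ} (hc : ∀ l < j, ContractsFaces b d l)
    {s : (Fin (j + 1) → I) → X} (hs : Continuous s) {i i' : Fin (j + 1)} {ε ε' : I}
    {y y' : Fin j → I} (hε : ε = 0 ∨ ε = 1) (hε' : ε' = 0 ∨ ε' = 1)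
    (hy : face i ε y = face i' ε' y') (t : I) :
    contraction b d j (s ∘ face i ε) (t, y) = contraction b d j (s ∘ face i' ε') (t, y') := by
  rcases eq_or_ne i i' with rfl | hi
  · obtain rfl : ε = ε' := by rw [← face_same i ε y, hy, face_same]
    rw [face_injective i ε hy]
  · cases j with
    | zero => exact absurd (Subsingleton.elim (α := Fin 1) i i') hi
    | succ l =>
      obtain ⟨a, w, rfl, rfl, rfl⟩ := face_eq_face hi hy
      rw [hc l l.lt_succ_self _ (hs.comp (continuous_face _ _)) _ _ hε',
        hc l l.lt_succ_self _ (hs.comp (continuous_face _ _)) _ _ hε]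
      congr 1
      ext1 w
      simp only [Function.comp_apply]
      rw [face_face]

lemma exists_contraction_of_faces {j : ℕ}
    (hj : ∀ s : (Fin j → I) → X, Continuous s → IsContraction b d s (contraction b d j s))
    (hc : ∀ l < j, ContractsFaces b d l) {s : (Fin (j + 1) → I) → X} (hs : Continuous s) :
    ∃ H : I × (Fin (j + 1) → I) → X,
      ContinuousOn H (Set.univ ×ˢ Cube.boundary (Fin (j + 1))) ∧
      (∀ y ∈ Cube.boundary (Fin (j + 1)), H (0, y) = s y) ∧
      ∀ i, ∀ ε : I, (ε = 0 ∨ ε = 1) → ∀ t y,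
        H (t, face i ε y) = contraction b d j (s ∘ face i ε) (t, y) := by
  have hf : ∀ i ε, IsContraction b d (s ∘ face i ε) (contraction b d j (s ∘ face i ε)) :=
    fun i ε => hj _ (hs.comp (continuous_face i ε))
  obtain ⟨H, hH⟩ := exists_eq_on_faces (fun i ε => contraction b d j (s ∘ face i ε))
    fun _ _ _ _ t _ _ hε hε' hy => contraction_face_congr hc hs hε hε' hy t
  refine ⟨H, continuousOn_prod_boundary fun i ε hε => ?_, fun y hy => ?_, hH⟩
  · simp only [hH i ε hε]
    exact (hf i ε).1
  · obtain ⟨i, ε, hε, w, rfl⟩ := exists_eq_face_of_mem_boundary hy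
    rw [hH i ε hε, (hf i ε).2.1, Function.comp_apply]

lemma exists_isContraction_succ (hX : ∀ j ≤ d, CubeExtension X j) {j : ℕ} (hjd : j < d)
    (hj : ∀ s : (Fin j → I) → X, Continuous s → IsContraction b d s (contraction b d j s))
    (hc : ∀ l < j, ContractsFaces b d l) {s : (Fin (j + 1) → I) → X} (hs : Continuous s) :
    ∃ G, IsContraction b d s G ∧ ∀ i, ∀ ε : I, (ε = 0 ∨ ε = 1) → ∀ t y,
      G (t, face i ε y) = contraction b d j (s ∘ face i ε) (t, y) := by
  have hf : ∀ i ε, IsContraction b d (s ∘ face i ε) (contraction b d j (s ∘ face i ε)) :=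
    fun i ε => hj _ (hs.comp (continuous_face i ε))
  obtain ⟨H, hHc, H0, hH⟩ := exists_contraction_of_faces hj hc hs
  obtain ⟨G, hG, hGH⟩ := exists_isContraction hX hjd hs hHc H0
    (fun _ y hy => by
      obtain ⟨i, ε, hε, w, rfl⟩ := exists_eq_face_of_mem_boundary hy
      rw [hH i ε hε, (hf i ε).2.2.1 hjd])
    (fun hsb t y hy => by
      obtain ⟨i, ε, hε, w, rfl⟩ := exists_eq_face_of_mem_boundary hy
      rw [hH i ε hε, (hf i ε).2.2.2 (by rw [hsb]; rfl)])
  refine ⟨G, hG, fun i ε hε t y => ?_⟩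
  rw [hGH t _ (face_mem_boundary i hε y), hH i ε hε]

lemma isContraction_and_contractsFaces (hX : ∀ j ≤ d, CubeExtension X j) {j : ℕ} (hj : j ≤ d) :
    (∀ s : (Fin j → I) → X, Continuous s → IsContraction b d s (contraction b d j s)) ∧
      ∀ l < j, ContractsFaces b d l := by
  induction j with
  | zero =>
    refine ⟨fun s hs => Classical.epsilon_spec ?_, fun l hl => absurd hl l.not_lt_zero⟩
    obtain ⟨G, hG, -⟩ := exists_isContraction (b := b) hX hj hs (H := fun _ => b)
      continuousOn_const (fun y hy => hy.choose.elim0) (fun _ _ _ => rfl) fun _ _ _ _ => rfl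
    exact ⟨G, hG⟩
  | succ j ih =>
    obtain ⟨hcontr, hfaces⟩ := ih (Nat.le_of_succ_le hj)
    have hsucc := fun (s : (Fin (j + 1) → I) → X) (hs : Continuous s) =>
      Classical.epsilon_spec (exists_isContraction_succ hX hj hcontr hfaces hs)
    refine ⟨fun s hs => (hsucc s hs).1, fun l hl => ?_⟩
    rcases (Nat.le_of_lt_succ hl).lt_or_eq with hl | rfl
    · exact hfaces l hl
    · exact fun s hs => (hsucc s hs).2

lemma isContraction_contraction (hX : ∀ j ≤ d, CubeExtension X j) {j : ℕ} (hj : j ≤ d)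
    {s : (Fin j → I) → X} (hs : Continuous s) : IsContraction b d s (contraction b d j s) :=
  (isContraction_and_contractsFaces hX hj).1 s hs

lemma contractsFaces (hX : ∀ j ≤ d, CubeExtension X j) {j : ℕ} (hj : j < d) :
    ContractsFaces b d j :=
  (isContraction_and_contractsFaces hX le_rfl).2 j hj

lemma isLoop_contraction_one (hX : ∀ j ≤ d, CubeExtension X j) {s : (Fin d → I) → X}
    (hs : Continuous s) : IsLoop b fun y => contraction b d d s (1, y) := by
  refine ⟨(isContraction_contraction hX le_rfl hs).1.comp (by fun_prop), fun y hy => ?_⟩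
  cases d with
  | zero => exact hy.choose.elim0
  | succ l =>
    obtain ⟨i, ε, hε, w, rfl⟩ := exists_eq_face_of_mem_boundary hy
    change contraction b _ _ s (1, face i ε w) = b
    rw [contractsFaces hX l.lt_succ_self s hs i ε hε]
    exact (isContraction_contraction hX l.le_succ (hs.comp (continuous_face i ε))).2.2.1
      l.lt_succ_self w

lemma IsLoop.contraction_eq (hX : ∀ j ≤ d, CubeExtension X j) {f : (Fin d → I) → X}
    (hf : IsLoop b f) (t : I) {y : Fin d → I} (hy : y ∈ Cube.boundary (Fin d)) :
    contraction b d d f (t, y) = b := by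
  cases d with
  | zero => exact hy.choose.elim0
  | succ l =>
    obtain ⟨i, ε, hε, w, rfl⟩ := exists_eq_face_of_mem_boundary hy
    have hb : f ∘ face i ε = fun _ => b := funext fun w => hf.2 _ (face_mem_boundary i hε w)
    rw [contractsFaces hX l.lt_succ_self f hf.1 i ε hε, hb,
      (isContraction_contraction hX l.le_succ continuous_const).2.2.2 rfl]

lemma exists_hasLoopFaces_contraction (hX : ∀ j ≤ d, CubeExtension X j)
    {h : (Fin (d + 1) → I) → X} (hh : Continuous h) :
    ∃ h', HasLoopFaces b h' ∧ ∀ i, ∀ ε : I, (ε = 0 ∨ ε = 1) →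
      h' ∘ face i ε = fun y => contraction b d d (h ∘ face i ε) (1, y) := by
  obtain ⟨H, hHc, H0, hH⟩ := exists_contraction_of_faces (b := b)
    (fun _ => isContraction_contraction hX le_rfl) (fun _ => contractsFaces hX) hh
  obtain ⟨G, hG, -, hGH⟩ := exists_homotopy_extension hh hHc H0
  have hG1 : ∀ i, ∀ ε : I, (ε = 0 ∨ ε = 1) →
      (fun y => G (1, y)) ∘ face i ε = fun y => contraction b d d (h ∘ face i ε) (1, y) :=
    fun i ε hε => funext fun y => by
      rw [Function.comp_apply, hGH 1 _ (face_mem_boundary i hε y), hH i ε hε]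
  refine ⟨fun y => G (1, y), ⟨hG.comp (by fun_prop), fun i ε hε => ?_⟩, hG1⟩
  rw [hG1 i ε hε]
  exact isLoop_contraction_one hX (hh.comp (continuous_face i ε))

/-- The extension of a function on based `d`-cubes to all `d`-cubes in a `(d-1)`-connected space,
through a deformation to based cubes. -/
def extendByContraction (b : X) (cl : ((Fin d → I) → X) → A) (s : (Fin d → I) → X) : A :=
  cl fun y => contraction b d d s (1, y)

variable {cl : ((Fin d → I) → X) → A}

/-- The faces of a cube are deformed compatibly, so that the homotopy addition theorem applies. -/
theorem IsLoopClass.cubeD_extendByContraction (hcl : IsLoopClass b cl)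
    (hX : ∀ j ≤ d, CubeExtension X j) {h : (Fin (d + 1) → I) → X} (hh : Continuous h) :
    cubeD (extendByContraction b cl) h = 0 := by
  obtain ⟨h', hloop, hface⟩ := exists_hasLoopFaces_contraction (b := b) hX hh
  rw [← hcl.cubeD_eq_zero hloop]
  exact cubeD_congr fun i ε hε => by rw [extendByContraction, hface i ε hε]

theorem IsLoopClass.extendByContraction_eq (hcl : IsLoopClass b cl)
    (hX : ∀ j ≤ d, CubeExtension X j) {f : (Fin d → I) → X} (hf : IsLoop b f) :
    extendByContraction b cl f = cl f := by
  obtain ⟨hcont, h0, -⟩ := isContraction_contraction (b := b) hX le_rfl hf.1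
  refine (hcl.homotopy _ hcont fun t y hy => hf.contraction_eq hX t hy).symm.trans ?_
  exact congrArg cl (funext h0)

end FundamentalCocycle

/-! ### The degree of a map from the boundary of a cube -/

section Degree

variable {k : ℕ}

/-- A map of pairs `(I^d, ∂I^d) → (X, b)` as an element of Mathlib's space of such maps. -/
def IsLoop.toGenLoop {d : ℕ} {X : Type*} [TopologicalSpace X] {b : X} {f : (Fin d → I) → X}
    (hf : IsLoop b f) : GenLoop (Fin d) X b :=
  ⟨⟨f, hf.1⟩, hf.2⟩

lemma isLoop_genLoop {d : ℕ} {X : Type*} [TopologicalSpace X] {b : X} (f : GenLoop (Fin d) X b) :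
    IsLoop b f :=
  ⟨f.1.continuous, f.2⟩

open Classical in
/-- The class in `π_{n-1}(S^{n-1})` of a based map, and `0` for other maps. -/
def loopClass (k : ℕ) (f : (Fin (k + 1) → I) → Sph (k + 2)) : SphereCoeff k :=
  if hf : IsLoop (basePt (k + 1)) f then SphereCoeff.mk hf.toGenLoop else 0

lemma IsLoop.loopClass_eq {f : (Fin (k + 1) → I) → Sph (k + 2)} (hf : IsLoop (basePt (k + 1)) f) :
    loopClass k f = SphereCoeff.mk hf.toGenLoop :=
  dif_pos hf

lemma loopClass_genLoop (f : GenLoop (Fin (k + 1)) (Sph (k + 2)) (basePt (k + 1))) :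
    loopClass k f = SphereCoeff.mk f :=
  (isLoop_genLoop f).loopClass_eq

lemma genLoop_symmAt_eq {d : ℕ} {X : Type*} [TopologicalSpace X] {b : X} (i : Fin d)
    (f : GenLoop (Fin d) X b) :
    (GenLoop.symmAt i f : (Fin d → I) → X) = reparam i unitInterval.symm f := by
  ext1 y
  change f _ = f _
  congr 1
  ext1 j
  rw [Function.update_apply]

lemma isLoopClass_loopClass (k : ℕ) : IsLoopClass (basePt (k + 1)) (loopClass k) where
  const := loopClass_genLoop GenLoop.const
  concat i f g hf hg := by
    have hmul : SphereCoeff.mk (GenLoop.transAt i hf.toGenLoop hg.toGenLoop) =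
        SphereCoeff.mk hg.toGenLoop + SphereCoeff.mk hf.toGenLoop :=
      congrArg Additive.ofMul HomotopyGroup.mul_spec.symm
    rw [hf.loopClass_eq, hg.loopClass_eq, add_comm (SphereCoeff.mk _), ← hmul]
    exact loopClass_genLoop (GenLoop.transAt i hf.toGenLoop hg.toGenLoop)
  symm i f hf := by
    have hinv : SphereCoeff.mk (GenLoop.symmAt i hf.toGenLoop) = -SphereCoeff.mk hf.toGenLoop :=
      congrArg Additive.ofMul HomotopyGroup.inv_spec.symm
    rw [hf.loopClass_eq, ← hinv, ← loopClass_genLoop, genLoop_symmAt_eq]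
    rfl
  homotopy h hc hb := by
    have h0 : IsLoop (basePt (k + 1)) fun y => h (0, y) := ⟨hc.comp (by fun_prop), hb 0⟩
    have h1 : IsLoop (basePt (k + 1)) fun y => h (1, y) := ⟨hc.comp (by fun_prop), hb 1⟩
    rw [h0.loopClass_eq, h1.loopClass_eq]
    exact congrArg Additive.ofMul (Quotient.sound ⟨⟨⟨⟨h, hc⟩, fun _ => rfl, fun _ => rfl⟩,
      fun t y hy => (hb t y hy).trans (h0.2 y hy).symm⟩⟩)

/-- A cocycle on the singular `(n-1)`-cubes of `S^{n-1}` that is the class in `π_{n-1}(S^{n-1})` on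
based cubes. Here `n = k + 2`. -/
def fundamentalCocycle (k : ℕ) : ((Fin (k + 1) → I) → Sph (k + 2)) → SphereCoeff k :=
  extendByContraction (basePt (k + 1)) (loopClass k)

lemma fundamentalCocycle_loop {f : (Fin (k + 1) → I) → Sph (k + 2)}
    (hf : IsLoop (basePt (k + 1)) f) : fundamentalCocycle k f = loopClass k f :=
  (isLoopClass_loopClass k).extendByContraction_eq (fun _ => cubeExtension_sphere) hf

/-- The degree of a map from the boundary of the `n`-cube to `S^{n-1}`, where `n = k + 2`. -/
def degree (g : (Fin (k + 2) → I) → Sph (k + 2)) : SphereCoeff k :=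
  cubeD (fundamentalCocycle k) g

lemma degree_eq_zero {g : (Fin (k + 2) → I) → Sph (k + 2)} (hg : Continuous g) : degree g = 0 :=
  (isLoopClass_loopClass k).cubeD_extendByContraction (fun _ => cubeExtension_sphere) hg

lemma cubeD_degree (h : (Fin (k + 3) → I) → Sph (k + 2)) : cubeD degree h = 0 :=
  cubeD_cubeD _ h

lemma degree_congr {g g' : (Fin (k + 2) → I) → Sph (k + 2)}
    (h : Set.EqOn g g' (Cube.boundary (Fin (k + 2)))) : degree g = degree g' :=
  cubeD_congr fun i _ hε => congrArg _ (funext fun w => h (face_mem_boundary i hε w))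

lemma degree_homotopy {H : I × (Fin (k + 2) → I) → Sph (k + 2)}
    (hH : ContinuousOn H (Set.univ ×ˢ Cube.boundary (Fin (k + 2)))) :
    degree (fun y => H (0, y)) = degree (fun y => H (1, y)) := by
  let h : (Fin (k + 3) → I) → Sph (k + 2) := fun y => H (y 0, fun j => y j.succ)
  have hends : ∀ t, h ∘ face 0 t = fun y => H (t, y) := fun t => funext fun y => by
    simp only [h, Function.comp_apply, face_same, face_zero_succ]
  have hsides : ∀ (i : Fin (k + 2)) (ε : I), (ε = 0 ∨ ε = 1) →
      degree (h ∘ face i.succ ε) = 0 := fun i ε hε => by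
    have hface : h ∘ face i.succ ε = fun y => H (y 0, face i ε fun j => y j.succ) := by
      ext1 y
      simp only [h, Function.comp_apply, face_succ_zero, face_succ_succ]
    rw [hface]
    exact degree_eq_zero (hH.comp_continuous
      ((continuous_apply 0).prodMk ((continuous_face i ε).comp continuous_tail))
      fun y => ⟨trivial, face_mem_boundary (m := k + 1) i hε fun j => y j.succ⟩)
  have hD := cubeD_degree h
  rw [cubeD_eq_sub fun l => by rw [hsides l 1 (Or.inr rfl), hsides l 0 (Or.inl rfl)],
    hends, hends, sub_eq_zero] at hD
  exact hD.symm

section OnCubeBoundary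

variable {d : ℕ} {X : Type*} [TopologicalSpace X] {b : X} (f : GenLoop (Fin d) X b)

lemma onCubeBoundary_comp_face_zero_one : onCubeBoundary f ∘ face 0 1 = f := by
  ext1 y
  rw [Function.comp_apply, onCubeBoundary, if_pos (face_same _ _ _)]
  simp only [face_zero_succ]

lemma onCubeBoundary_comp_face_zero_zero : onCubeBoundary f ∘ face 0 0 = fun _ => b := by
  ext1 y
  rw [Function.comp_apply, onCubeBoundary, face_same, if_neg zero_ne_one]

lemma onCubeBoundary_comp_face_succ (i : Fin d) {ε : I} (hε : ε = 0 ∨ ε = 1) :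
    onCubeBoundary f ∘ face i.succ ε = fun _ => b := by
  ext1 y
  rw [Function.comp_apply, onCubeBoundary, ite_eq_right_iff]
  exact fun _ => f.2 _ ⟨i, by dsimp only; rwa [face_same]⟩

lemma continuousOn_onCubeBoundary :
    ContinuousOn (onCubeBoundary f) (Cube.boundary (Fin (d + 1))) := by
  refine continuousOn_boundary fun i ε hε => ?_
  change Continuous (onCubeBoundary f ∘ face i ε)
  induction i using Fin.cases with
  | zero =>
    rcases hε with rfl | rfl
    · rw [onCubeBoundary_comp_face_zero_zero]
      exact continuous_const
    · rw [onCubeBoundary_comp_face_zero_one]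
      exact f.1.continuous
  | succ i =>
    rw [onCubeBoundary_comp_face_succ f i hε]
    exact continuous_const

end OnCubeBoundary

lemma degree_onCubeBoundary (f : GenLoop (Fin (k + 1)) (Sph (k + 2)) (basePt (k + 1))) :
    degree (onCubeBoundary f) = SphereCoeff.mk f := by
  rw [degree, cubeD_eq_sub fun l => by
    rw [onCubeBoundary_comp_face_succ f l (Or.inr rfl),
      onCubeBoundary_comp_face_succ f l (Or.inl rfl)], onCubeBoundary_comp_face_zero_one,
    onCubeBoundary_comp_face_zero_zero, fundamentalCocycle_loop isLoop_const,
    (isLoopClass_loopClass k).const, sub_zero, fundamentalCocycle_loop (isLoop_genLoop f),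
    loopClass_genLoop]

end Degree

/-! ### Trivializations of bundles over cubes -/

section PullbackTrivialization

lemma continuousOn_inter_union {X Y : Type*} [TopologicalSpace X] [TopologicalSpace Y] {f : X → Y}
    {D A B : Set X} (hA : IsClosed A) (hB : IsClosed B) (h1 : ContinuousOn f (D ∩ A))
    (h2 : ContinuousOn f (D ∩ B)) : ContinuousOn f (D ∩ (A ∪ B)) := by
  have key : ∀ C : Set X, IsClosed C → ContinuousOn f (D ∩ C) → ∀ x ∈ D,
      ContinuousWithinAt f (D ∩ C) x := by
    intro C hC h x hx
    by_cases hxC : x ∈ C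
    · exact h x ⟨hx, hxC⟩
    · exact continuousWithinAt_of_notMem_closure fun hc =>
        hxC ((hC.closure_subset_iff.2 Set.inter_subset_right) hc)
  rw [Set.inter_union_distrib_left]
  exact fun x hx => (key A hA h1 x (hx.elim And.left And.left)).union
    (key B hB h2 x (hx.elim And.left And.left))

variable {M E F X : Type*} [TopologicalSpace E] [TopologicalSpace F] [TopologicalSpace X]

/-- A trivialization, with fiber `F`, of the pullback of `p : E → M` along `c : X → M` over
`S ⊆ X`. The values of `toE` and `toF` at points that do not lie over `S` are irrelevant. -/
structure PullbackTrivialization (F : Type*) [TopologicalSpace F] (p : E → M) (c : X → M)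
    (S : Set X) where
  toE : X × F → E
  toF : X × E → F
  continuousOn_toE : ContinuousOn toE (S ×ˢ Set.univ)
  continuousOn_toF : ContinuousOn toF {z | p z.2 = c z.1 ∧ z.1 ∈ S}
  proj_toE : ∀ x ∈ S, ∀ v, p (toE (x, v)) = c x
  toF_toE : ∀ x ∈ S, ∀ v, toF (x, toE (x, v)) = v
  toE_toF : ∀ x ∈ S, ∀ e, p e = c x → toE (x, toF (x, e)) = e

namespace PullbackTrivialization

variable {p : E → M} {c : X → M} {S S₁ S₂ : Set X}

/-- The restriction of a trivialization to a smaller set. -/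
def mono (t : PullbackTrivialization F p c S) {S' : Set X} (h : S' ⊆ S) :
    PullbackTrivialization F p c S' where
  toE := t.toE
  toF := t.toF
  continuousOn_toE := t.continuousOn_toE.mono (Set.prod_mono h subset_rfl)
  continuousOn_toF := t.continuousOn_toF.mono fun _ hz => ⟨hz.1, h hz.2⟩
  proj_toE x hx := t.proj_toE x (h hx)
  toF_toE x hx := t.toF_toE x (h hx)
  toE_toF x hx := t.toE_toF x (h hx)

/-- The pullback of a local trivialization along a continuous map. -/
def ofTrivialization [TopologicalSpace M] (e : Bundle.Trivialization F p) (hc : Continuous c) :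
    PullbackTrivialization F p c (c ⁻¹' e.baseSet) where
  toE z := e.toOpenPartialHomeomorph.symm (c z.1, z.2)
  toF z := (e z.2).2
  continuousOn_toE := e.toOpenPartialHomeomorph.continuousOn_symm.comp (by fun_prop)
    fun _ hz => e.mem_target.2 hz.1
  continuousOn_toF := continuous_snd.comp_continuousOn <|
    ContinuousOn.comp (t := e.source) e.continuousOn_toFun continuous_snd.continuousOn
      fun _ hz => e.mem_source.2 (hz.1 ▸ hz.2)
  proj_toE x hx v := e.proj_symm_apply (x := (c x, v)) (e.mem_target.2 hx)
  toF_toE x hx v := congrArg Prod.snd (e.apply_symm_apply (x := (c x, v)) (e.mem_target.2 hx))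
  toE_toF x hx w hw := by
    rw [← hw]
    exact e.symm_apply_mk_proj (e.mem_source.2 (hw ▸ hx))

lemma toF_eq_toF {t₁ : PullbackTrivialization F p c S₁} {t₂ : PullbackTrivialization F p c S₂}
    {x : X} (hx : x ∈ S₁ ∩ S₂) (h : ∀ v, t₁.toE (x, v) = t₂.toE (x, v)) {e : E} (he : p e = c x) :
    t₁.toF (x, e) = t₂.toF (x, e) := by
  nth_rw 1 [← t₂.toE_toF x hx.2 e he, ← h, t₁.toF_toE x hx.1]

/-- Two trivializations that agree on the intersection of two closed sets define a trivialization
over the union. -/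
def glue (t₁ : PullbackTrivialization F p c S₁) (t₂ : PullbackTrivialization F p c S₂)
    (hS₁ : IsClosed S₁) (hS₂ : IsClosed S₂)
    (h : ∀ x ∈ S₁ ∩ S₂, ∀ v, t₁.toE (x, v) = t₂.toE (x, v)) :
    PullbackTrivialization F p c (S₁ ∪ S₂) := by
  classical
  let θ : X × F → E := fun z => if z.1 ∈ S₁ then t₁.toE z else t₂.toE z
  let ψ : X × E → F := fun z => if z.1 ∈ S₁ then t₁.toF z else t₂.toF z
  have θ_eq₁ : ∀ x ∈ S₁, ∀ v, θ (x, v) = t₁.toE (x, v) := fun x hx v => if_pos hx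
  have ψ_eq₁ : ∀ x ∈ S₁, ∀ e, ψ (x, e) = t₁.toF (x, e) := fun x hx e => if_pos hx
  have θ_eq₂ : ∀ x ∈ S₂, ∀ v, θ (x, v) = t₂.toE (x, v) := fun x hx v => by
    by_cases hx₁ : x ∈ S₁
    · rw [θ_eq₁ x hx₁, h x ⟨hx₁, hx⟩]
    · exact if_neg hx₁
  have ψ_eq₂ : ∀ x ∈ S₂, ∀ e, p e = c x → ψ (x, e) = t₂.toF (x, e) := fun x hx e he => by
    by_cases hx₁ : x ∈ S₁
    · rw [ψ_eq₁ x hx₁, toF_eq_toF ⟨hx₁, hx⟩ (h x ⟨hx₁, hx⟩) he]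
    · exact if_neg hx₁
  exact {
    toE := θ
    toF := ψ
    continuousOn_toE := by
      rw [Set.union_prod]
      exact (t₁.continuousOn_toE.congr fun z hz => θ_eq₁ _ hz.1 _).union_of_isClosed
        (t₂.continuousOn_toE.congr fun z hz => θ_eq₂ _ hz.1 _)
        (hS₁.prod isClosed_univ) (hS₂.prod isClosed_univ)
    continuousOn_toF :=
      continuousOn_inter_union (hS₁.preimage continuous_fst) (hS₂.preimage continuous_fst)
        (t₁.continuousOn_toF.congr fun z hz => ψ_eq₁ _ hz.2 _)
        (t₂.continuousOn_toF.congr fun z hz => ψ_eq₂ _ hz.2 _ hz.1)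
    proj_toE := by
      rintro x (hx | hx) v
      · rw [θ_eq₁ x hx, t₁.proj_toE x hx]
      · rw [θ_eq₂ x hx, t₂.proj_toE x hx]
    toF_toE := by
      rintro x (hx | hx) v
      · rw [θ_eq₁ x hx, ψ_eq₁ x hx, t₁.toF_toE x hx]
      · rw [θ_eq₂ x hx, ψ_eq₂ x hx _ (t₂.proj_toE x hx v), t₂.toF_toE x hx]
    toE_toF := by
      rintro x (hx | hx) e he
      · rw [ψ_eq₁ x hx, θ_eq₁ x hx, t₁.toE_toF x hx e he]
      · rw [ψ_eq₂ x hx e he, θ_eq₂ x hx, t₂.toE_toF x hx e he] }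

/-- Given a map `r : S₂ → S₁ ∩ S₂`, the trivialization `t₂` is changed over `x ∈ S₂` by the
transition function between `t₁` and `t₂` at `r x`. -/
def twist (t₁ : PullbackTrivialization F p c S₁) (t₂ : PullbackTrivialization F p c S₂) {r : X → X}
    (hr : Continuous r) (hrm : Set.MapsTo r S₂ (S₁ ∩ S₂)) : PullbackTrivialization F p c S₂ where
  toE z := t₂.toE (z.1, t₂.toF (r z.1, t₁.toE (r z.1, z.2)))
  toF z := t₁.toF (r z.1, t₂.toE (r z.1, t₂.toF z))
  continuousOn_toE := by
    have h₁ : ContinuousOn (fun z : X × F => t₁.toE (r z.1, z.2)) (S₂ ×ˢ Set.univ) :=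
      t₁.continuousOn_toE.comp (by fun_prop) fun z hz => ⟨(hrm hz.1).1, trivial⟩
    have h₂ : ContinuousOn (fun z : X × F => t₂.toF (r z.1, t₁.toE (r z.1, z.2)))
        (S₂ ×ˢ Set.univ) :=
      t₂.continuousOn_toF.comp (ContinuousOn.prodMk (by fun_prop) h₁) fun z hz =>
        ⟨t₁.proj_toE _ (hrm hz.1).1 _, (hrm hz.1).2⟩
    exact t₂.continuousOn_toE.comp (continuousOn_fst.prodMk h₂) fun z hz => ⟨hz.1, trivial⟩
  continuousOn_toF := by
    have h₂ : ContinuousOn (fun z : X × E => t₂.toE (r z.1, t₂.toF z))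
        {z | p z.2 = c z.1 ∧ z.1 ∈ S₂} :=
      t₂.continuousOn_toE.comp (ContinuousOn.prodMk (by fun_prop) t₂.continuousOn_toF)
        fun z hz => ⟨(hrm hz.2).2, trivial⟩
    exact t₁.continuousOn_toF.comp (ContinuousOn.prodMk (by fun_prop) h₂) fun z hz =>
      ⟨t₂.proj_toE _ (hrm hz.2).2 _, (hrm hz.2).1⟩
  proj_toE x hx v := t₂.proj_toE x hx _
  toF_toE x hx v := by
    dsimp only
    rw [t₂.toF_toE x hx, t₂.toE_toF _ (hrm hx).2 _ (t₁.proj_toE _ (hrm hx).1 v),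
      t₁.toF_toE _ (hrm hx).1]
  toE_toF x hx e he := by
    dsimp only
    rw [t₁.toE_toF _ (hrm hx).1 _ (t₂.proj_toE _ (hrm hx).2 _), t₂.toF_toE _ (hrm hx).2,
      t₂.toE_toF x hx e he]

/-- Trivializations over two closed sets give one over the union, if one of the sets retracts onto
the intersection. -/
def union (t₁ : PullbackTrivialization F p c S₁) (t₂ : PullbackTrivialization F p c S₂)
    (hS₁ : IsClosed S₁) (hS₂ : IsClosed S₂) {r : X → X} (hr : Continuous r)
    (hrm : Set.MapsTo r S₂ (S₁ ∩ S₂)) (hri : ∀ x ∈ S₁ ∩ S₂, r x = x) :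
    PullbackTrivialization F p c (S₁ ∪ S₂) :=
  t₁.glue (twist t₁ t₂ hr hrm) hS₁ hS₂ fun x hx v => by
    simp only [twist, hri x hx]
    exact (t₂.toE_toF x hx.2 _ (t₁.proj_toE x hx.1 v)).symm

end PullbackTrivialization

end PullbackTrivialization

section Box

open Function

variable {ι : Type*} {a b : ι → ℝ} {i : ι} {t : ℝ}

section Update

variable [DecidableEq ι]

lemma Icc_eq_union_of_mem_Icc (ht : t ∈ Set.Icc (a i) (b i)) :
    Set.Icc a b = Set.Icc a (update b i t) ∪ Set.Icc (update a i t) b := by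
  ext x
  constructor
  · rintro ⟨hx₁, hx₂⟩
    rcases le_total (x i) t with h | h
    · exact Or.inl ⟨hx₁, le_update_iff.2 ⟨h, fun j _ => hx₂ j⟩⟩
    · exact Or.inr ⟨update_le_iff.2 ⟨h, fun j _ => hx₁ j⟩, hx₂⟩
  · rintro (⟨hx₁, hx₂⟩ | ⟨hx₁, hx₂⟩)
    · exact ⟨hx₁, hx₂.trans (update_le_self_iff.2 ht.2)⟩
    · exact ⟨(le_update_self_iff.2 ht.1).trans hx₁, hx₂⟩

lemma mapsTo_update_Icc (ht : t ∈ Set.Icc (a i) (b i)) :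
    Set.MapsTo (fun x => update x i t) (Set.Icc (update a i t) b)
      (Set.Icc a (update b i t) ∩ Set.Icc (update a i t) b) := by
  rintro x ⟨hx₁, hx₂⟩
  have hax := (le_update_self_iff.2 ht.1).trans hx₁
  exact ⟨⟨le_update_iff.2 ⟨ht.1, fun j _ => hax j⟩,
      update_le_update_iff.2 ⟨le_rfl, fun j _ => hx₂ j⟩⟩,
    update_le_update_iff.2 ⟨le_rfl, fun j _ => hax j⟩, update_le_iff.2 ⟨ht.2, fun j _ => hx₂ j⟩⟩

lemma update_eq_self_of_mem_inter {x : ι → ℝ}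
    (hx : x ∈ Set.Icc a (update b i t) ∩ Set.Icc (update a i t) b) : update x i t = x := by
  have hxi : x i = t :=
    le_antisymm (by simpa using hx.1.2 i) (by simpa using hx.2.1 i)
  rw [← hxi, update_eq_self]

end Update

variable {M E F : Type*} [TopologicalSpace E] [TopologicalSpace F] {p : E → M} {c : (ι → ℝ) → M}

lemma nonempty_pullbackTrivialization_of_update [DecidableEq ι] (ht : t ∈ Set.Icc (a i) (b i))
    (h₁ : Nonempty (PullbackTrivialization F p c (Set.Icc a (update b i t))))
    (h₂ : Nonempty (PullbackTrivialization F p c (Set.Icc (update a i t) b))) :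
    Nonempty (PullbackTrivialization F p c (Set.Icc a b)) := by
  obtain ⟨t₁⟩ := h₁
  obtain ⟨t₂⟩ := h₂
  rw [Icc_eq_union_of_mem_Icc ht]
  exact ⟨t₁.union t₂ isClosed_Icc isClosed_Icc (continuous_id.update i continuous_const)
    (mapsTo_update_Icc ht) fun _ => update_eq_self_of_mem_inter⟩

lemma nonempty_pullbackTrivialization_of_slabs {P : (ι → ℝ) → (ι → ℝ) → Prop} {ε : ℝ} (hε : 0 < ε)
    (hP : ∀ {a b a' b'}, P a b → a ≤ a' → b' ≤ b → P a' b')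
    (h : ∀ a b, a ≤ b → P a b → b i - a i ≤ ε →
      Nonempty (PullbackTrivialization F p c (Set.Icc a b)))
    (N : ℕ) : ∀ a b, a ≤ b → P a b → b i - a i ≤ (N + 1) * ε →
      Nonempty (PullbackTrivialization F p c (Set.Icc a b)) := by
  classical
  induction N with
  | zero => exact fun a b hab hPab hN => h a b hab hPab (by simpa using hN)
  | succ N ih =>
    intro a b hab hPab hN
    push_cast at hN
    have hNε : 0 ≤ ((N : ℝ) + 1) * ε := by positivity
    let t := max (a i) (b i - ε)
    have hat : a i ≤ t := le_max_left _ _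
    have htb : t ≤ b i := max_le (hab i) (by linarith)
    have hbt : b i - ε ≤ t := le_max_right _ _
    have htN : t ≤ a i + (N + 1) * ε := max_le (by linarith) (by linarith)
    have hab₁ : a ≤ update b i t := le_update_iff.2 ⟨hat, fun j _ => hab j⟩
    have hab₂ : update a i t ≤ b := update_le_iff.2 ⟨htb, fun j _ => hab j⟩
    refine nonempty_pullbackTrivialization_of_update ⟨hat, htb⟩
      (ih _ _ hab₁ (hP hPab le_rfl (update_le_self_iff.2 htb)) ?_)
      (h _ _ hab₂ (hP hPab (le_update_self_iff.2 hat) le_rfl) ?_)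
    · rw [update_self]
      linarith
    · rw [update_self]
      linarith

end Box

section Cube

variable {M E F : Type*} [TopologicalSpace M] [TopologicalSpace E] [TopologicalSpace F]

theorem nonempty_pullbackTrivialization_Icc {ι : Type*} [Finite ι] {p : E → M}
    (hp : ∀ x, ∃ e : Bundle.Trivialization F p, x ∈ e.baseSet) {c : (ι → ℝ) → M}
    (hc : Continuous c) : Nonempty (PullbackTrivialization F p c (Set.Icc 0 1)) := by
  classical
  cases nonempty_fintype ι
  obtain ⟨δ, hδ, hball⟩ := lebesgue_number_lemma_of_metric
    (isCompact_Icc (a := (0 : ι → ℝ)) (b := 1))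
    (c := fun e : Bundle.Trivialization F p => c ⁻¹' e.baseSet)
    (fun e => e.open_baseSet.preimage hc) fun x _ => Set.mem_iUnion.2 (hp (c x))
  have small (a b : ι → ℝ) (ha : a ∈ Set.Icc 0 1) (h : ∀ i, b i - a i ≤ δ / 2) :
      Nonempty (PullbackTrivialization F p c (Set.Icc a b)) := by
    obtain ⟨e, he⟩ := hball a ha
    refine ⟨(PullbackTrivialization.ofTrivialization e hc).mono <|
      Set.Subset.trans (fun x hx => ?_) he⟩
    refine ((dist_pi_le_iff (half_pos hδ).le).2 fun i => ?_).trans_lt (half_lt_self hδ)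
    rw [Real.dist_eq, abs_of_nonneg (sub_nonneg.2 (hx.1 i))]
    linarith [h i, hx.2 i]
  suffices key : ∀ s : Finset ι, ∀ a b : ι → ℝ, a ≤ b →
      (0 ≤ a ∧ b ≤ 1 ∧ ∀ i ∉ s, b i - a i ≤ δ / 2) →
      Nonempty (PullbackTrivialization F p c (Set.Icc a b)) from
    key Finset.univ 0 1 zero_le_one
      ⟨le_rfl, le_rfl, fun i hi => absurd (Finset.mem_univ i) hi⟩
  intro s
  induction s using Finset.induction_on with
  | empty =>
    exact fun a b hab ⟨ha, hb, h⟩ =>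
      small a b ⟨ha, hab.trans hb⟩ fun i => h i (Finset.notMem_empty i)
  | insert i s hi ih =>
    intro a b hab h
    obtain ⟨N, hN⟩ := exists_nat_ge ((b i - a i) / (δ / 2))
    refine nonempty_pullbackTrivialization_of_slabs (i := i) (half_pos hδ)
      (P := fun a b => 0 ≤ a ∧ b ≤ 1 ∧ ∀ j ∉ insert i s, b j - a j ≤ δ / 2) ?_ ?_ N a b hab h ?_
    · exact fun ⟨ha, hb, h⟩ ha' hb' => ⟨ha.trans ha', hb'.trans hb, fun j hj =>
        (sub_le_sub (hb' j) (ha' j)).trans (h j hj)⟩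
    · refine fun a b hab ⟨ha, hb, h⟩ hi => ih a b hab ⟨ha, hb, fun j hj => ?_⟩
      rcases eq_or_ne j i with rfl | hji
      · exact hi
      · exact h j (by simp [hji, hj])
    · rw [div_le_iff₀ (half_pos hδ)] at hN
      linarith

lemma exists_retract_stdSimplex (ι : Type*) [Fintype ι] [Nonempty ι] :
    ∃ r : (ι → ℝ) → stdSimplex ℝ ι, Continuous r ∧ ∀ x : stdSimplex ℝ ι, r x.1 = x := by
  let s : (ι → ℝ) → ℝ := fun x => ∑ i, max (x i) 0
  have hs : Continuous s := by fun_prop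
  have hm : ∀ x, max 1 (s x) ≠ 0 := fun x => (lt_of_lt_of_le one_pos (le_max_left _ _)).ne'
  have hm0 : ∀ x, 0 < max 1 (s x) := fun x => lt_of_lt_of_le one_pos (le_max_left _ _)
  have hcard : (Fintype.card ι : ℝ) ≠ 0 := Nat.cast_ne_zero.2 Fintype.card_ne_zero
  refine ⟨fun x => ⟨fun i => (max (x i) 0 + max 0 (1 - s x) / Fintype.card ι) / max 1 (s x),
    fun i => ?_, ?_⟩, ?_, ?_⟩
  · have := hm0 x
    positivity
  · rw [← Finset.sum_div, div_eq_one_iff_eq (hm x), Finset.sum_add_distrib, Finset.sum_const,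
      Finset.card_univ, nsmul_eq_mul, mul_div_cancel₀ _ hcard]
    change s x + _ = _
    rcases le_total (s x) 1 with h | h
    · rw [max_eq_right (by linarith), max_eq_left h]; ring
    · rw [max_eq_left (by linarith), max_eq_right h]; ring
  · refine Continuous.subtype_mk (continuous_pi fun i => ?_) _
    fun_prop (disch := exact hm)
  · rintro ⟨x, hx0, hx1⟩
    have h0 : ∀ i, max (x i) 0 = x i := fun i => max_eq_left (hx0 i)
    have h1 : s x = 1 := by simp only [s, h0, hx1]
    ext i
    simp [h0, h1]

end Cube

/-! ### The topology of the geometric realization -/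

section Topology

variable {V : Type*} {K : AbstractSimplicialComplex V}

lemma continuous_simplexMap (s : {s : Finset V // s ∈ K.faces}) : Continuous (simplexMap K s) :=
  continuous_iff_coinduced_le.2 (le_iSup (fun s : {s : Finset V // s ∈ K.faces} =>
    TopologicalSpace.coinduced (simplexMap K s) inferInstance) s)

lemma isClosed_realization_iff {C : Set (Realization K)} :
    IsClosed C ↔ ∀ s, IsClosed (simplexMap K s ⁻¹' C) := by
  rw [isClosed_iSup_iff]
  simp only [isClosed_coinduced]

lemma continuous_realization_iff {Y : Type*} [TopologicalSpace Y] {f : Realization K → Y} :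
    Continuous f ↔ ∀ s, Continuous (f ∘ simplexMap K s) := by
  rw [continuous_iSup_dom]
  simp only [continuous_coinduced_dom]

lemma simplexMap_of_mem (s : {s : Finset V // s ∈ K.faces}) (x : stdSimplex ℝ s.1) {v : V}
    (hv : v ∈ s.1) : (simplexMap K s x).1 v = x.1 ⟨v, hv⟩ := dif_pos hv

lemma simplexMap_of_notMem (s : {s : Finset V // s ∈ K.faces}) (x : stdSimplex ℝ s.1) {v : V}
    (hv : v ∉ s.1) : (simplexMap K s x).1 v = 0 := dif_neg hv

lemma continuous_coord (v : V) : Continuous fun x : Realization K => x.1 v := by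
  refine continuous_realization_iff.2 fun s => ?_
  by_cases hv : v ∈ s.1
  · have : (fun x : Realization K => x.1 v) ∘ simplexMap K s = fun x => x.1 ⟨v, hv⟩ :=
      funext fun x => simplexMap_of_mem s x hv
    rw [this]
    exact (continuous_apply _).comp continuous_subtype_val
  · have : (fun x : Realization K => x.1 v) ∘ simplexMap K s = fun _ => 0 :=
      funext fun x => simplexMap_of_notMem s x hv
    rw [this]
    exact continuous_const

lemma isClosed_closedSimplex (s : Finset V) : IsClosed (closedSimplex K s) := by
  have : closedSimplex K s = ⋂ v, ⋂ (_ : v ∉ s), {x : Realization K | x.1 v = 0} := by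
    ext x; simp [closedSimplex]
  rw [this]
  exact isClosed_iInter fun v => isClosed_iInter fun _ =>
    isClosed_eq (continuous_coord v) continuous_const

lemma simplexMap_mem (s : {s : Finset V // s ∈ K.faces}) (x : stdSimplex ℝ s.1) :
    simplexMap K s x ∈ closedSimplex K s.1 := fun _ hv => simplexMap_of_notMem s x hv

lemma sum_eq_one_of_mem {s : Finset V} {x : Realization K} (hx : x ∈ closedSimplex K s) :
    ∑ v : s, x.1 v = 1 := by
  classical
  obtain ⟨-, t, -, h0, h1⟩ := x.2
  rw [Finset.univ_eq_attach, Finset.sum_attach s fun v => x.1 v]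
  refine Eq.trans ?_ h1
  rw [← Finset.sum_subset (Finset.inter_subset_left (s₁ := s) (s₂ := t)),
    ← Finset.sum_subset (Finset.inter_subset_right (s₁ := s) (s₂ := t))]
  · exact fun v hv hv' => hx v fun h => hv' (Finset.mem_inter.2 ⟨h, hv⟩)
  · exact fun v hv hv' => h0 v fun h => hv' (Finset.mem_inter.2 ⟨hv, h⟩)

/-- The barycentric coordinates of a point of a closed simplex. -/
def baryCoord {s : Finset V} (x : closedSimplex K s) : stdSimplex ℝ s :=
  ⟨fun v => x.1.1 v, fun v => x.1.2.1 v, sum_eq_one_of_mem x.2⟩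

lemma continuous_baryCoord {s : Finset V} : Continuous (baryCoord (K := K) (s := s)) :=
  Continuous.subtype_mk (f := fun (x : closedSimplex K s) (v : s) => x.1.1 v.1)
    (continuous_pi fun v : s => (continuous_coord v.1).comp continuous_subtype_val)
    fun x => (baryCoord x).2

lemma simplexMap_baryCoord {s : Finset V} (hs : s ∈ K.faces) (x : closedSimplex K s) :
    simplexMap K ⟨s, hs⟩ (baryCoord x) = x := by
  refine Subtype.ext (funext fun v => ?_)
  by_cases hv : v ∈ s
  · rw [simplexMap_of_mem _ _ hv]; rfl
  · rw [simplexMap_of_notMem _ _ hv, x.2 v hv]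

/-- The smallest simplex that contains the point `x`. -/
def carrier (x : Realization K) : Finset V :=
  open Classical in x.2.2.choose.filter fun v => x.1 v ≠ 0

lemma mem_carrier {x : Realization K} {v : V} : v ∈ carrier x ↔ x.1 v ≠ 0 := by
  classical
  simp only [carrier, Finset.mem_filter, and_iff_right_iff_imp]
  exact fun hv => by_contra fun h => hv (x.2.2.choose_spec.2.1 v h)

lemma mem_closedSimplex_iff {x : Realization K} {s : Finset V} :
    x ∈ closedSimplex K s ↔ carrier x ⊆ s :=
  ⟨fun h _ hv => by_contra fun hvs => mem_carrier.1 hv (h _ hvs),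
    fun h _ hv => by_contra fun hx => hv (h (mem_carrier.2 hx))⟩

lemma mem_closedSimplex_carrier (x : Realization K) : x ∈ closedSimplex K (carrier x) :=
  mem_closedSimplex_iff.2 subset_rfl

lemma carrier_mem_faces (x : Realization K) : carrier x ∈ K.faces := by
  obtain ⟨-, t, ht, h0, h1⟩ := x.2
  refine (K.isRelLowerSet_faces ht).2 (mem_closedSimplex_iff.1 h0) ?_
  by_contra hne
  rw [Finset.not_nonempty_iff_eq_empty] at hne
  have : ∑ v ∈ t, x.1 v = 0 := Finset.sum_eq_zero fun _ _ => by
    by_contra hv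
    have := mem_carrier.2 hv
    simp [hne] at this
  rw [this] at h1
  exact zero_ne_one h1

lemma mem_skeleton_iff {x : Realization K} {m : ℕ} :
    x ∈ skeleton K m ↔ (carrier x).card ≤ m + 1 :=
  ⟨fun ⟨_, _, h1, h2⟩ => (Finset.card_le_card (mem_closedSimplex_iff.1 h2)).trans h1,
    fun h => ⟨_, carrier_mem_faces x, h, mem_closedSimplex_carrier x⟩⟩

lemma skeleton_mono {m n : ℕ} (h : m ≤ n) : skeleton K m ⊆ skeleton K n :=
  fun _ ⟨s, hs, hc, hx⟩ => ⟨s, hs, hc.trans (Nat.succ_le_succ h), hx⟩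

lemma closedSimplex_subset_skeleton {s : Finset V} (hs : s ∈ K.faces) {m : ℕ}
    (hm : s.card ≤ m + 1) : closedSimplex K s ⊆ skeleton K m := fun _ hx => ⟨s, hs, hm, hx⟩

lemma continuousOn_skeleton {m : ℕ} {Y : Type*} [TopologicalSpace Y] {u : Realization K → Y}
    (h : ∀ s ∈ K.faces, s.card ≤ m + 1 → ContinuousOn u (closedSimplex K s)) :
    ContinuousOn u (skeleton K m) := by
  classical
  rw [continuousOn_iff_isClosed]
  refine fun C hC => ⟨u ⁻¹' C ∩ skeleton K m, ?_, by rw [Set.inter_assoc, Set.inter_self]⟩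
  refine isClosed_realization_iff.2 fun s => ?_
  have e : simplexMap K s ⁻¹' (u ⁻¹' C ∩ skeleton K m) =
      ⋃ t ∈ {t | t ∈ s.1.powerset ∧ t ∈ K.faces ∧ t.card ≤ m + 1},
        simplexMap K s ⁻¹' (closedSimplex K t ∩ u ⁻¹' C) := by
    ext x
    simp only [Set.mem_preimage, Set.mem_inter_iff, Set.mem_iUnion, Set.mem_ofPred_eq,
      Finset.mem_powerset, exists_prop]
    constructor
    · rintro ⟨h1, h2⟩
      exact ⟨_, ⟨mem_closedSimplex_iff.1 (simplexMap_mem s x), carrier_mem_faces _,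
        mem_skeleton_iff.1 h2⟩, mem_closedSimplex_carrier _, h1⟩
    · rintro ⟨t, ⟨-, ht, hc⟩, h1, h2⟩
      exact ⟨h2, t, ht, hc, h1⟩
  rw [e]
  refine Set.Finite.isClosed_biUnion ?_ fun t ht => ?_
  · exact (s.1.powerset.finite_toSet).subset fun t ht => ht.1
  · exact ((h t ht.2.1 ht.2.2).preimage_isClosed_of_isClosed (isClosed_closedSimplex t) hC).preimage
      (continuous_simplexMap s)

end Topology

/-! ### Trivializations over simplices -/

section SimplexTrivialization

variable {V M E F : Type*} [TopologicalSpace M] [TopologicalSpace E] [TopologicalSpace F]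
  {K : AbstractSimplicialComplex V} (T : Realization K ≃ₜ M)

lemma continuous_proj {p : E → M} (hp : ∀ x, ∃ e : Bundle.Trivialization F p, x ∈ e.baseSet) :
    Continuous p := continuous_iff_continuousAt.2 fun w => by
  obtain ⟨e, he⟩ := hp (p w)
  exact e.continuousAt_proj (e.mem_source.2 he)

/-- A trivialization of `p : E → M` over the set `S`. -/
structure SetTrivialization (F : Type*) [TopologicalSpace F] (p : E → M) (S : Set M) where
  toE : M × F → E
  toF : E → F
  continuousOn_toE : ContinuousOn toE (S ×ˢ Set.univ)
  continuousOn_toF : ContinuousOn toF (p ⁻¹' S)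
  proj_toE : ∀ x ∈ S, ∀ v, p (toE (x, v)) = x
  toF_toE : ∀ x ∈ S, ∀ v, toF (toE (x, v)) = v
  toE_toF : ∀ e, p e ∈ S → toE (p e, toF e) = e

theorem nonempty_setTrivialization {p : E → M}
    (hp : ∀ x, ∃ e : Bundle.Trivialization F p, x ∈ e.baseSet) {s : Finset V} (hs : s ∈ K.faces) :
    Nonempty (SetTrivialization F p (T '' closedSimplex K s)) := by
  have hne : Nonempty s := (K.isRelLowerSet_faces hs).1.to_subtype
  obtain ⟨r, hr, hri⟩ := exists_retract_stdSimplex s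
  obtain ⟨S⟩ := nonempty_pullbackTrivialization_Icc hp
    (T.continuous.comp ((continuous_simplexMap ⟨s, hs⟩).comp hr))
  let B : M → (s → ℝ) := fun x v => (T.symm x).1 v
  have hB : Continuous B := continuous_pi fun v => (continuous_coord v.1).comp T.symm.continuous
  have B_eq (x) (hx : x ∈ closedSimplex K s) : B (T x) = (baryCoord ⟨x, hx⟩).1 := by
    ext v
    simp [B, baryCoord]
  have hB_section : ∀ x ∈ T '' closedSimplex K s, (T ∘ simplexMap K ⟨s, hs⟩ ∘ r) (B x) = x := by
    rintro _ ⟨x, hx, rfl⟩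
    simp only [Function.comp_apply]
    rw [B_eq x hx, hri, simplexMap_baryCoord]
  have hB_mem : ∀ x ∈ T '' closedSimplex K s, B x ∈ Set.Icc (0 : s → ℝ) 1 := by
    rintro _ ⟨x, hx, rfl⟩
    rw [B_eq x hx]
    exact ⟨fun v => (mem_Icc_of_mem_stdSimplex (baryCoord ⟨x, hx⟩).2 v).1,
      fun v => (mem_Icc_of_mem_stdSimplex (baryCoord ⟨x, hx⟩).2 v).2⟩
  exact ⟨{
    toE := fun z => S.toE (B z.1, z.2)
    toF := fun e => S.toF (B (p e), e)
    continuousOn_toE := S.continuousOn_toE.comp (by fun_prop) fun z hz => ⟨hB_mem _ hz.1, trivial⟩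
    continuousOn_toF := S.continuousOn_toF.comp
      ((hB.comp (continuous_proj hp)).prodMk continuous_id).continuousOn
      fun e he => ⟨(hB_section _ he).symm, hB_mem _ he⟩
    proj_toE := fun x hx v => by rw [S.proj_toE _ (hB_mem x hx), hB_section x hx]
    toF_toE := fun x hx v => by
      rw [S.proj_toE _ (hB_mem x hx), hB_section x hx, S.toF_toE _ (hB_mem x hx)]
    toE_toF := fun e he => S.toE_toF _ (hB_mem _ he) e (hB_section _ he).symm }⟩

end SimplexTrivialization

/-! ### The cubical parametrization of simplices -/

section CubeCoord

variable {m : ℕ}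

lemma continuous_cubeCoord (i : Fin (m + 1)) : Continuous fun y : Fin m → I => cubeCoord y i := by
  unfold cubeCoord
  split_ifs <;> fun_prop

lemma cubeCoord_face_one_castSucc (i : Fin (m + 1)) (y : Fin m → I) :
    cubeCoord (face i 1 y) i.castSucc = 0 := by
  simp [cubeCoord, Nat.lt_succ_of_le i.is_le]

lemma cubeCoord_face_zero_one_succ (y : Fin m → I) (l : Fin (m + 1)) :
    cubeCoord (face 0 1 y) l.succ = cubeCoord y l := by
  rw [cubeCoord_succ, face_same]
  simp only [face_zero_succ, Set.Icc.coe_one, one_mul]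

lemma cubeCoord_face_one_succAbove (i : Fin (m + 1)) (y : Fin m → I) (l : Fin (m + 1)) :
    cubeCoord (face i 1 y) (i.castSucc.succAbove l) = cubeCoord y l := by
  induction m with
  | zero => rw [Fin.fin_one_eq_zero i, Fin.castSucc_zero, Fin.succAbove_zero,
      cubeCoord_face_zero_one_succ]
  | succ m ih =>
    induction i using Fin.cases with
    | zero => rw [Fin.castSucc_zero, Fin.succAbove_zero, cubeCoord_face_zero_one_succ]
    | succ i =>
      rw [← Fin.succ_castSucc]
      induction l using Fin.cases with
      | zero => rw [Fin.succ_succAbove_zero, cubeCoord_zero, face_succ_zero, cubeCoord_zero]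
      | succ l =>
        rw [Fin.succ_succAbove_succ, cubeCoord_succ, cubeCoord_succ, face_succ_zero]
        simp only [face_succ_succ, ih]

lemma cubeCoord_face_zero_of_lt {i : Fin (m + 1)} (y : Fin m → I) {j : Fin (m + 2)}
    (hj : i.castSucc < j) : cubeCoord (face i 0 y) j = 0 := by
  rw [cubeCoord, Finset.prod_eq_zero (i := i), zero_mul]
  · simpa using hj
  · simp

lemma cubeCoord_face_last (y : Fin m → I) (l : Fin (m + 1)) :
    cubeCoord (face (Fin.last m) 0 y) l.castSucc = cubeCoord y l := by
  induction m with
  | zero =>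
    obtain rfl : l = 0 := Fin.ext (by omega)
    rw [Fin.castSucc_zero, cubeCoord_zero, show (0 : Fin (0 + 1)) = Fin.last 0 from rfl, face_same]
    simp [cubeCoord]
  | succ m ih =>
    rw [← Fin.succ_last]
    induction l using Fin.cases with
    | zero => rw [Fin.castSucc_zero, cubeCoord_zero, face_succ_zero, cubeCoord_zero]
    | succ l =>
      rw [← Fin.succ_castSucc, cubeCoord_succ, cubeCoord_succ, face_succ_zero]
      simp only [face_succ_succ, ih]

lemma exists_cubeCoord_eq_zero_iff {y : Fin m → I} :
    (∃ j, cubeCoord y j = 0) ↔ y ∈ Cube.boundary (Fin m) := by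
  constructor
  · rintro ⟨j, hj⟩
    by_contra hb
    have h : ∀ i, y i ≠ 0 ∧ y i ≠ 1 := fun i =>
      ⟨fun h => hb ⟨i, Or.inl h⟩, fun h => hb ⟨i, Or.inr h⟩⟩
    rw [cubeCoord, mul_eq_zero, Finset.prod_eq_zero_iff] at hj
    rcases hj with ⟨i, -, hi⟩ | hj
    · exact (h i).1 (Subtype.ext hi)
    · split_ifs at hj with hlt
      · exact (h ⟨j, hlt⟩).2 (Subtype.ext (sub_eq_zero.1 hj).symm)
      · exact one_ne_zero hj
  · rintro ⟨i, hi | hi⟩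
    · refine ⟨Fin.last m, ?_⟩
      rw [cubeCoord, Finset.prod_eq_zero (i := i), zero_mul]
      · simp
      · rw [hi]; rfl
    · refine ⟨i.castSucc, ?_⟩
      rw [cubeCoord, dif_pos (by simp)]
      simp [hi]

lemma cubeCoord_injOn {y y' : Fin m → I} (hy : y ∉ Cube.boundary (Fin m))
    (h : ∀ j, cubeCoord y j = cubeCoord y' j) : y = y' := by
  induction m with
  | zero => exact Subsingleton.elim _ _
  | succ m ih =>
    have h0 : y 0 = y' 0 := by
      have := h 0
      rw [cubeCoord_zero, cubeCoord_zero] at this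
      exact Subtype.ext (by linarith)
    have hne : (y 0 : ℝ) ≠ 0 := fun h => hy ⟨0, Or.inl (Subtype.ext h)⟩
    have ht := ih (y := fun j => y j.succ) (y' := fun j => y' j.succ)
      (fun ⟨i, hi⟩ => hy ⟨i.succ, hi⟩) fun j => by
        have := h j.succ
        rw [cubeCoord_succ, cubeCoord_succ, ← h0] at this
        exact mul_left_cancel₀ hne this
    ext1 j
    induction j using Fin.cases with
    | zero => exact h0
    | succ j => exact congrFun ht j

lemma exists_cubeCoord_eq {x : Fin (m + 1) → ℝ} (h0 : ∀ j, 0 ≤ x j) (h1 : ∑ j, x j = 1) :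
    ∃ y : Fin m → I, ∀ j, cubeCoord y j = x j := by
  induction m with
  | zero =>
    refine ⟨fun j => j.elim0, fun j => ?_⟩
    obtain rfl : j = 0 := Fin.ext (by omega)
    rw [Fin.sum_univ_one] at h1
    rw [h1]
    simp [cubeCoord]
  | succ m ih =>
    rw [Fin.sum_univ_succ] at h1
    have hs : 0 ≤ ∑ j : Fin (m + 1), x j.succ := Finset.sum_nonneg fun j _ => h0 _
    have hle : x 0 ≤ 1 := by linarith
    let t : I := ⟨1 - x 0, by linarith, by linarith [h0 0]⟩
    rcases eq_or_ne (x 0) 1 with hx | hx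
    · refine ⟨face 0 t fun _ => 0, fun j => ?_⟩
      have hz : ∀ j : Fin (m + 1), x j.succ = 0 := fun j =>
        (Finset.sum_eq_zero_iff_of_nonneg fun j _ => h0 _).1 (by linarith) j (Finset.mem_univ j)
      induction j using Fin.cases with
      | zero => rw [cubeCoord_zero, face_same]; simp [t]
      | succ j => rw [cubeCoord_succ, face_same, hz]; simp [t, hx]
    · have hpos : 0 < 1 - x 0 := sub_pos.2 (lt_of_le_of_ne hle hx)
      obtain ⟨y, hy⟩ := ih (x := fun j => x j.succ / (1 - x 0))
        (fun j => div_nonneg (h0 _) hpos.le)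
        (by rw [← Finset.sum_div, div_eq_one_iff_eq hpos.ne']; linarith)
      refine ⟨face 0 t y, fun j => ?_⟩
      induction j using Fin.cases with
      | zero => rw [cubeCoord_zero, face_same]; simp [t]
      | succ j =>
        rw [cubeCoord_succ, face_same]
        simp only [face_zero_succ, hy, t]
        field_simp

end CubeCoord

section CubeMap

variable {V : Type*} [LinearOrder V] {K : AbstractSimplicialComplex V} {m : ℕ}

lemma cubeMap_vertex (s : Simplices K m) (y : Fin m → I) (i : Fin (m + 1)) :
    (cubeMap s y).1 (vertex s i) = cubeCoord y i := by
  rw [cubeMap, simplexMap_of_mem _ _ (vertex_mem s i)]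
  exact congrArg (cubeCoord y) ((s.1.orderIsoOfFin s.2.2).symm_apply_apply i)

lemma cubeMap_mem (s : Simplices K m) (y : Fin m → I) : cubeMap s y ∈ closedSimplex K s.1 :=
  simplexMap_mem ⟨s.1, s.2.1⟩ _

lemma exists_vertex {s : Simplices K m} {v : V} (hv : v ∈ s.1) : ∃ i, vertex s i = v := by
  have : v ∈ Set.range (s.1.orderEmbOfFin s.2.2) := by rwa [Finset.range_orderEmbOfFin]
  exact this

lemma vertex_injective (s : Simplices K m) : Function.Injective (vertex s) :=
  (s.1.orderEmbOfFin s.2.2).injective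

lemma eq_of_vertex {s : Simplices K m} {x x' : Realization K} (hx : x ∈ closedSimplex K s.1)
    (hx' : x' ∈ closedSimplex K s.1) (h : ∀ i, x.1 (vertex s i) = x'.1 (vertex s i)) : x = x' := by
  refine Subtype.ext (funext fun v => ?_)
  by_cases hv : v ∈ s.1
  · obtain ⟨i, rfl⟩ := exists_vertex hv
    exact h i
  · rw [hx v hv, hx' v hv]

lemma continuous_cubeMap (s : Simplices K m) : Continuous (cubeMap s) :=
  (continuous_simplexMap _).comp (Continuous.subtype_mk
    (continuous_pi fun v => continuous_cubeCoord ((s.1.orderIsoOfFin s.2.2).symm v)) _)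

lemma vertex_oppositeFace (s : Simplices K (m + 1)) (i : Fin (m + 2)) (l : Fin (m + 1)) :
    vertex (oppositeFace s i) l = vertex s (i.succAbove l) := by
  have h := Finset.orderEmbOfFin_unique' (oppositeFace s i).2.2
    (f := (Fin.succAboveOrderEmb i).trans (s.1.orderEmbOfFin s.2.2)) fun x =>
      Finset.mem_erase.2 ⟨fun h => Fin.succAbove_ne i x (vertex_injective s h), vertex_mem s _⟩
  exact (DFunLike.congr_fun h l).symm

lemma closedSimplex_oppositeFace_subset (s : Simplices K (m + 1)) (i : Fin (m + 2)) :
    closedSimplex K (oppositeFace s i).1 ⊆ closedSimplex K s.1 := fun _ hx v hv =>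
  hx v fun h => hv (Finset.mem_of_mem_erase h)

lemma cubeMap_eq_cubeMap_oppositeFace (s : Simplices K (m + 1)) (i : Fin (m + 2))
    {z : Fin (m + 1) → I} {y : Fin m → I} (h0 : cubeCoord z i = 0)
    (h1 : ∀ l, cubeCoord z (i.succAbove l) = cubeCoord y l) :
    cubeMap s z = cubeMap (oppositeFace s i) y := by
  refine eq_of_vertex (cubeMap_mem s _)
    (closedSimplex_oppositeFace_subset s _ (cubeMap_mem _ y)) fun j => ?_
  rw [cubeMap_vertex]
  rcases Fin.eq_self_or_eq_succAbove i j with rfl | ⟨l, rfl⟩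
  · rw [h0, cubeMap_mem (oppositeFace s j) y _ (Finset.notMem_erase _ _)]
  · rw [h1, ← vertex_oppositeFace, cubeMap_vertex]

lemma cubeMap_face_one (s : Simplices K (m + 1)) (i : Fin (m + 1)) (y : Fin m → I) :
    cubeMap s (face i 1 y) = cubeMap (oppositeFace s i.castSucc) y :=
  cubeMap_eq_cubeMap_oppositeFace s _ (cubeCoord_face_one_castSucc i y)
    (cubeCoord_face_one_succAbove i y)

lemma cubeMap_face_last (s : Simplices K (m + 1)) (y : Fin m → I) :
    cubeMap s (face (Fin.last m) 0 y) = cubeMap (oppositeFace s (Fin.last (m + 1))) y :=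
  cubeMap_eq_cubeMap_oppositeFace s _ (cubeCoord_face_zero_of_lt y (Fin.castSucc_lt_last _))
    fun l => by rw [Fin.succAbove_last, cubeCoord_face_last]

lemma cubeMap_face_zero_mem_skeleton (s : Simplices K (m + 1)) (i : Fin (m + 1)) (y : Fin m → I) :
    cubeMap s (face i 0 y) ∈ skeleton K i := by
  classical
  rw [mem_skeleton_iff]
  have : carrier (cubeMap s (face i 0 y)) ⊆ (Finset.Iic i.castSucc).image (vertex s) := by
    intro v hv
    obtain ⟨j, rfl⟩ := exists_vertex (mem_closedSimplex_iff.1 (cubeMap_mem s _) hv)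
    rw [mem_carrier, cubeMap_vertex] at hv
    refine Finset.mem_image_of_mem _ (Finset.mem_Iic.2 (not_lt.1 fun h => hv ?_))
    exact cubeCoord_face_zero_of_lt y h
  refine (Finset.card_le_card this).trans (Finset.card_image_le.trans ?_)
  simp

lemma carrier_cubeMap_card_le_iff (s : Simplices K m) (y : Fin m → I) :
    (carrier (cubeMap s y)).card ≤ m ↔ y ∈ Cube.boundary (Fin m) := by
  rw [← exists_cubeCoord_eq_zero_iff]
  have hsub := mem_closedSimplex_iff.1 (cubeMap_mem s y)
  constructor
  · intro h
    have : ∃ v ∈ s.1, v ∉ carrier (cubeMap s y) := by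
      by_contra! hc
      have := Finset.card_le_card hc
      rw [s.2.2] at this
      omega
    obtain ⟨v, hv, hvc⟩ := this
    obtain ⟨i, rfl⟩ := exists_vertex hv
    refine ⟨i, ?_⟩
    rwa [mem_carrier, cubeMap_vertex, not_not] at hvc
  · rintro ⟨i, hi⟩
    have : carrier (cubeMap s y) ⊂ s.1 := by
      refine ⟨hsub, fun h => ?_⟩
      have := h (vertex_mem s i)
      rw [mem_carrier, cubeMap_vertex] at this
      exact this hi
    have := Finset.card_lt_card this
    rw [s.2.2] at this
    omega

lemma cubeMap_mem_skeleton (s : Simplices K m) {N : ℕ} (hm : m ≤ N) (y : Fin m → I) :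
    cubeMap s y ∈ skeleton K N :=
  closedSimplex_subset_skeleton s.2.1 (by rw [s.2.2]; omega) (cubeMap_mem s y)

lemma mapsTo_cubeMap_boundary (s : Simplices K (m + 1)) :
    Set.MapsTo (cubeMap s) (Cube.boundary (Fin (m + 1))) (skeleton K m) := fun y hy =>
  mem_skeleton_iff.2 ((carrier_cubeMap_card_le_iff s y).2 hy)

lemma carrier_cubeMap (s : Simplices K m) {y : Fin m → I} (hy : y ∉ Cube.boundary (Fin m)) :
    carrier (cubeMap s y) = s.1 := by
  refine Finset.eq_of_subset_of_card_le (mem_closedSimplex_iff.1 (cubeMap_mem s y)) ?_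
  rw [s.2.2]
  exact Nat.succ_le_of_lt (not_le.1 fun h => hy ((carrier_cubeMap_card_le_iff s y).1 h))

lemma injective_openCells : Function.Injective
    fun c : Simplices K m × {y : Fin m → I // y ∉ Cube.boundary (Fin m)} => cubeMap c.1 c.2 := by
  rintro ⟨s, y, hy⟩ ⟨s', y', hy'⟩ h
  dsimp only at h
  obtain rfl : s = s' := Subtype.ext (by rw [← carrier_cubeMap s hy, h, carrier_cubeMap s' hy'])
  obtain rfl : y = y' := cubeCoord_injOn hy fun j => by rw [← cubeMap_vertex s, h, cubeMap_vertex]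
  rfl

lemma exists_cubeMap_eq {s : Simplices K m} {x : Realization K} (hx : x ∈ closedSimplex K s.1) :
    ∃ y, cubeMap s y = x := by
  obtain ⟨y, hy⟩ := exists_cubeCoord_eq (m := m) (x := fun i => x.1 (vertex s i))
    (fun i => x.2.1 _)
    (((s.1.orderIsoOfFin s.2.2).toEquiv.sum_comp fun v : s.1 => x.1 v).trans
      (sum_eq_one_of_mem hx))
  exact ⟨y, eq_of_vertex (cubeMap_mem s y) hx fun i => by rw [cubeMap_vertex, hy]⟩

end CubeMap

/-! ### Constructing maps skeleton by skeleton -/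

section Skeletal

variable {V : Type*} [LinearOrder V] {K : AbstractSimplicialComplex V}

instance : T2Space (Realization K) :=
  T2Space.of_injective_continuous (f := fun x : Realization K => x.1) Subtype.val_injective
    (continuous_pi continuous_coord)

lemma continuousOn_of_comp_cubeMap {m : ℕ} {Y : Type*} [TopologicalSpace Y] {s : Simplices K m}
    {u : Realization K → Y} (h : Continuous (u ∘ cubeMap s)) :
    ContinuousOn u (closedSimplex K s.1) := by
  rw [continuousOn_iff_isClosed]
  refine fun C hC => ⟨cubeMap s '' ((u ∘ cubeMap s) ⁻¹' C),
    ((hC.preimage h).isCompact.image (continuous_cubeMap s)).isClosed, ?_⟩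
  ext x
  constructor
  · rintro ⟨h1, h2⟩
    obtain ⟨y, rfl⟩ := exists_cubeMap_eq h2
    exact ⟨⟨y, h1, rfl⟩, h2⟩
  · rintro ⟨⟨y, h1, rfl⟩, h2⟩
    exact ⟨h1, h2⟩

lemma exists_eq_cubeMap_of_eqOn_boundary {m : ℕ} {Y : Type*} (u : Realization K → Y)
    (G : Simplices K m → (Fin m → I) → Y)
    (hG : ∀ s, Set.EqOn (G s) (u ∘ cubeMap s) (Cube.boundary (Fin m))) :
    ∃ u' : Realization K → Y, (∀ x, (carrier x).card ≤ m → u' x = u x) ∧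
      ∀ s y, u' (cubeMap s y) = G s y := by
  let cell : Simplices K m × {y : Fin m → I // y ∉ Cube.boundary (Fin m)} → Realization K :=
    fun c => cubeMap c.1 c.2
  let u' := Function.extend cell (fun c => G c.1 c.2) u
  have hu' : ∀ x, (carrier x).card ≤ m → u' x = u x := fun x hx =>
    Function.extend_apply' _ _ _ fun ⟨c, hc⟩ =>
      c.2.2 ((carrier_cubeMap_card_le_iff c.1 c.2).1 (by rwa [← hc] at hx))
  refine ⟨u', hu', fun s y => ?_⟩
  by_cases hy : y ∈ Cube.boundary (Fin m)
  · rw [hu' _ ((carrier_cubeMap_card_le_iff s y).2 hy), hG s hy, Function.comp_apply]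
  · exact injective_openCells.extend_apply _ _ (s, ⟨y, hy⟩)

lemma exists_cubeMap_eq_of_card_carrier {m : ℕ} {x : Realization K}
    (hx : (carrier x).card = m + 1) : ∃ (s : Simplices K m) (y : Fin m → I), cubeMap s y = x :=
  ⟨⟨carrier x, carrier_mem_faces x, hx⟩, exists_cubeMap_eq (mem_closedSimplex_carrier x)⟩

lemma continuousOn_comp_cubeMap_boundary {m : ℕ} {Y : Type*} [TopologicalSpace Y]
    {u : Realization K → Y}
    (hu : ∀ s ∈ K.faces, s.card ≤ m → ContinuousOn u (closedSimplex K s)) (s : Simplices K m) :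
    ContinuousOn (u ∘ cubeMap s) (Cube.boundary (Fin m)) := by
  cases m with
  | zero => exact fun y hy => hy.choose.elim0
  | succ m =>
    exact (continuousOn_skeleton hu).comp (continuous_cubeMap s).continuousOn
      (mapsTo_cubeMap_boundary s)

theorem exists_skeletal_map {Y : Type*} [TopologicalSpace Y] [Nonempty Y]
    (R : Realization K → Y → Prop) (N : ℕ)
    (hext : ∀ m ≤ N, ∀ (s : Simplices K m) (g : (Fin m → I) → Y),
      ContinuousOn g (Cube.boundary (Fin m)) →
      (∀ y ∈ Cube.boundary (Fin m), R (cubeMap s y) (g y)) →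
      ∃ G, Continuous G ∧ Set.EqOn G g (Cube.boundary (Fin m)) ∧ ∀ y, R (cubeMap s y) (G y)) :
    ∃ u : Realization K → Y, ContinuousOn u (skeleton K N) ∧ ∀ x ∈ skeleton K N, R x (u x) := by
  suffices H : ∀ n ≤ N + 1, ∃ u : Realization K → Y,
      (∀ s ∈ K.faces, s.card ≤ n → ContinuousOn u (closedSimplex K s)) ∧
        ∀ x, (carrier x).card ≤ n → R x (u x) by
    obtain ⟨u, hu, huR⟩ := H (N + 1) le_rfl
    exact ⟨u, continuousOn_skeleton hu, fun x hx => huR x (mem_skeleton_iff.1 hx)⟩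
  intro n
  induction n with
  | zero =>
    intro _
    have card_pos : ∀ s ∈ K.faces, 0 < s.card := fun s hs => (K.isRelLowerSet_faces hs).1.card_pos
    exact ⟨fun _ => Classical.arbitrary Y, fun s hs hc => absurd hc (card_pos s hs).not_ge,
      fun x hx => absurd hx (card_pos _ (carrier_mem_faces x)).not_ge⟩
  | succ n ih =>
    intro hn
    obtain ⟨u, hu, huR⟩ := ih (by omega)
    choose G hG hGu hGR using fun s : Simplices K n =>
      hext n (by omega) s _ (continuousOn_comp_cubeMap_boundary hu s) fun y hy =>
        huR _ ((carrier_cubeMap_card_le_iff s y).2 hy)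
    obtain ⟨u', hu', hG'⟩ := exists_eq_cubeMap_of_eqOn_boundary u G hGu
    refine ⟨u', fun s hs hc => ?_, fun x hx => ?_⟩
    · rcases hc.lt_or_eq with hlt | heq
      · refine (hu s hs (by omega)).congr fun x hx => hu' x ?_
        exact (Finset.card_le_card (mem_closedSimplex_iff.1 hx)).trans (by omega)
      · refine continuousOn_of_comp_cubeMap (s := ⟨s, hs, heq⟩) ?_
        exact (hG ⟨s, hs, heq⟩).congr fun y => (hG' _ y).symm
    · rcases hx.lt_or_eq with hlt | heq
      · rw [hu' x (by omega)]
        exact huR x (by omega)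
      · obtain ⟨s, y, rfl⟩ := exists_cubeMap_eq_of_card_carrier heq
        rw [hG']
        exact hGR s y

end Skeletal

/-! ### Homotopies on subsets -/

section HomotopicOn

variable {X Y Z : Type*} [TopologicalSpace X] [TopologicalSpace Y] [TopologicalSpace Z]

/-- The restrictions of `f` and `g` to `D` are homotopic as maps to `S`. -/
def HomotopicOn (D : Set X) (S : Set Y) (f g : X → Y) : Prop :=
  ∃ H : I × X → Y, ContinuousOn H (Set.univ ×ˢ D) ∧ (∀ t, ∀ x ∈ D, H (t, x) ∈ S) ∧
    (∀ x ∈ D, H (0, x) = f x) ∧ ∀ x ∈ D, H (1, x) = g x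

variable {D : Set X} {S : Set Y} {f g h : X → Y}

lemma HomotopicOn.refl (hf : ContinuousOn f D) (hS : Set.MapsTo f D S) : HomotopicOn D S f f :=
  ⟨fun z => f z.2, hf.comp continuous_snd.continuousOn fun _ hz => hz.2, fun _ _ hx => hS hx,
    fun _ _ => rfl, fun _ _ => rfl⟩

lemma HomotopicOn.congr {f' g' : X → Y} (h : HomotopicOn D S f g) (hf : Set.EqOn f f' D)
    (hg : Set.EqOn g g' D) : HomotopicOn D S f' g' := by
  obtain ⟨H, h1, h2, h3, h4⟩ := h
  exact ⟨H, h1, h2, fun x hx => (h3 x hx).trans (hf hx), fun x hx => (h4 x hx).trans (hg hx)⟩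

lemma HomotopicOn.symm (h : HomotopicOn D S f g) : HomotopicOn D S g f := by
  obtain ⟨H, h1, h2, h3, h4⟩ := h
  refine ⟨fun z => H (unitInterval.symm z.1, z.2), h1.comp (by fun_prop) fun z hz =>
    ⟨trivial, hz.2⟩, fun t x hx => h2 _ x hx, fun x hx => ?_, fun x hx => ?_⟩
  · simpa using h4 x hx
  · simpa using h3 x hx

lemma homotopicOn_iff : HomotopicOn D S f g ↔ ∃ H : C(I × D, Y),
    (∀ z, H z ∈ S) ∧ (∀ x : D, H (0, x) = f x) ∧ ∀ x : D, H (1, x) = g x := by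
  classical
  constructor
  · rintro ⟨H, hH, hS, H0, H1⟩
    exact ⟨⟨fun z => H (z.1, z.2), hH.comp_continuous (by fun_prop) fun z => ⟨trivial, z.2.2⟩⟩,
      fun z => hS _ _ z.2.2, fun x => H0 _ x.2, fun x => H1 _ x.2⟩
  · rintro ⟨H, hS, H0, H1⟩
    let G : I × X → Y := fun z => if h : z.2 ∈ D then H (z.1, ⟨z.2, h⟩) else f z.2
    have hG : ∀ t (x : D), G (t, x) = H (t, x) := fun t x => dif_pos x.2
    refine ⟨G, ?_, fun t x hx => (hG t ⟨x, hx⟩).symm ▸ hS _,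
      fun x hx => (hG 0 ⟨x, hx⟩).trans (H0 ⟨x, hx⟩), fun x hx => (hG 1 ⟨x, hx⟩).trans (H1 ⟨x, hx⟩)⟩
    rw [continuousOn_iff_continuous_domRestrict]
    exact (by fun_prop : Continuous fun z : ((Set.univ : Set I) ×ˢ D : Set (I × X)) =>
      H (z.1.1, ⟨z.1.2, z.2.2⟩)).congr fun z => (hG z.1.1 ⟨z.1.2, z.2.2⟩).symm

lemma HomotopicOn.trans (hfg : HomotopicOn D S f g) (hgh : HomotopicOn D S g h) :
    HomotopicOn D S f h := by
  obtain ⟨H, hS, H0, H1⟩ := homotopicOn_iff.1 hfg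
  obtain ⟨H', hS', H0', H1'⟩ := homotopicOn_iff.1 hgh
  let F : (H.curry 0).Homotopy (H.curry 1) := ⟨H, fun _ => rfl, fun _ => rfl⟩
  let F' : (H.curry 1).Homotopy (H'.curry 1) :=
    ⟨H', fun x => (H0' x).trans (H1 x).symm, fun _ => rfl⟩
  refine homotopicOn_iff.2 ⟨(F.trans F').toContinuousMap, fun z => ?_,
    fun x => ((F.trans F').apply_zero x).trans (H0 x),
    fun x => ((F.trans F').apply_one x).trans (H1' x)⟩
  change F.trans F' z ∈ S
  rw [ContinuousMap.Homotopy.trans_apply]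
  split_ifs
  · exact hS _
  · exact hS' _

lemma HomotopicOn.postcomp {S' : Set Z} (h : HomotopicOn D S f g) {φ : Y → Z}
    (hφ : ContinuousOn φ S) (hS : Set.MapsTo φ S S') : HomotopicOn D S' (φ ∘ f) (φ ∘ g) := by
  obtain ⟨H, h1, h2, h3, h4⟩ := h
  exact ⟨fun z => φ (H z), hφ.comp h1 fun z hz => h2 _ _ hz.2, fun t x hx => hS (h2 t x hx),
    fun x hx => congrArg φ (h3 x hx), fun x hx => congrArg φ (h4 x hx)⟩

lemma HomotopicOn.precomp {D' : Set Z} (h : HomotopicOn D S f g) {φ : Z → X}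
    (hφ : ContinuousOn φ D') (hD : Set.MapsTo φ D' D) : HomotopicOn D' S (f ∘ φ) (g ∘ φ) := by
  obtain ⟨H, h1, h2, h3, h4⟩ := h
  exact ⟨fun z => H (z.1, φ z.2), h1.comp (continuous_fst.continuousOn.prodMk
    (hφ.comp continuous_snd.continuousOn fun z hz => hz.2)) fun z hz => ⟨trivial, hD hz.2⟩,
    fun t x hx => h2 t _ (hD hx), fun x hx => h3 _ (hD hx), fun x hx => h4 _ (hD hx)⟩

lemma HomotopicOn.mono_codomain {S' : Set Y} (h : HomotopicOn D S f g) (hS : S ⊆ S') :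
    HomotopicOn D S' f g :=
  h.postcomp continuousOn_id hS

lemma HomotopicOn.joinedIn (h : HomotopicOn D S f g) {x : X} (hx : x ∈ D) :
    JoinedIn S (f x) (g x) := by
  obtain ⟨H, hH, hS, H0, H1⟩ := h
  exact ⟨⟨⟨fun t => H (t, x), hH.comp_continuous (by fun_prop) fun _ => ⟨trivial, hx⟩⟩, H0 x hx,
    H1 x hx⟩, fun t => hS t x hx⟩

lemma degree_eq_of_homotopicOn {k : ℕ} {f g : (Fin (k + 2) → I) → Sph (k + 2)}
    (h : HomotopicOn (Cube.boundary (Fin (k + 2))) Set.univ f g) : degree f = degree g := by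
  obtain ⟨H, h1, -, h3, h4⟩ := h
  rw [← degree_congr h3, degree_homotopy h1, degree_congr h4]

lemma CubeExtension.homotopicOn_const (hY : CubeExtension Y 1) (D : Set X) (a b : Y) :
    HomotopicOn D Set.univ (fun _ => a) fun _ => b := by
  obtain ⟨P, hP, P0, P1, -⟩ := hY.prism (m := 0) (g₀ := fun _ => a) (g₁ := fun _ => b)
    continuous_const continuous_const (H := fun _ => b) continuousOn_const
    (fun y hy => hy.choose.elim0) (fun y hy => hy.choose.elim0)
  exact ⟨fun z => P (z.1, fun j => j.elim0), (hP.comp (by fun_prop)).continuousOn,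
    fun _ _ _ => trivial, fun _ _ => P0 _, fun _ _ => P1 _⟩

/-- The boundary of the cube without the interior of its face `y 0 = 1`. -/
def openBox (d : ℕ) : Set (Fin (d + 1) → I) :=
  {y | y 0 = 0 ∨ (fun j : Fin d => y j.succ) ∈ Cube.boundary (Fin d)}

variable {d : ℕ}

lemma mem_boundary_iff_openBox {y : Fin (d + 1) → I} :
    y ∈ Cube.boundary (Fin (d + 1)) ↔ y 0 = 1 ∨ y ∈ openBox d := by
  rw [← face_zero_tail y, face_zero_mem_boundary_iff, face_zero_tail]
  exact or_assoc.trans or_left_comm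

lemma openBox_subset_boundary : openBox d ⊆ Cube.boundary (Fin (d + 1)) := fun _ hy =>
  mem_boundary_iff_openBox.2 (Or.inr hy)

lemma face_zero_mem_openBox (ε : I) {y : Fin d → I} (hy : y ∈ Cube.boundary (Fin d)) :
    face 0 ε y ∈ openBox d :=
  Or.inr (by simpa only [face_zero_succ] using hy)

lemma face_succ_mem_openBox (i : Fin d) {ε : I} (hε : ε = 0 ∨ ε = 1) (y : Fin d → I) :
    face i.succ ε y ∈ openBox d :=
  Or.inr ⟨i, by simpa only [face_same] using hε⟩

lemma homotopicOn_openBox : HomotopicOn (openBox d) (openBox d) id fun _ => 0 := by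
  have h₁ : HomotopicOn (openBox d) (openBox d) id fun y => face 0 0 fun j => y j.succ := by
    refine ⟨fun z => face 0 (unitInterval.symm z.1 * z.2 0) fun j => z.2 j.succ,
      ((continuous_face_uncurry 0).comp (by fun_prop : Continuous fun z : I × (Fin (d + 1) → I) =>
        (unitInterval.symm z.1 * z.2 0, fun j : Fin d => z.2 j.succ))).continuousOn, ?_,
      fun y _ => by simpa using face_zero_tail y, fun y _ => by simp⟩
    rintro t y (hy | hy)
    · exact Or.inl (by simp [hy])
    · exact face_zero_mem_openBox _ hy
  refine h₁.trans ⟨fun z => face 0 0 fun j => unitInterval.symm z.1 * z.2 j.succ,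
    ((continuous_face 0 0).comp (by fun_prop)).continuousOn, fun t y _ => Or.inl (face_same _ _ _),
    fun y _ => by simp, fun y _ => ?_⟩
  ext1 j
  induction j using Fin.cases <;> simp

lemma exists_homotopy_extension_boundary {g : (Fin (d + 1) → I) → X}
    (hg : ContinuousOn g (Cube.boundary (Fin (d + 1)))) {H : I × (Fin (d + 1) → I) → X}
    (hH : ContinuousOn H (Set.univ ×ˢ openBox d)) (H0 : ∀ y ∈ openBox d, H (0, y) = g y) :
    ∃ L : I × (Fin (d + 1) → I) → X,
      ContinuousOn L (Set.univ ×ˢ Cube.boundary (Fin (d + 1))) ∧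
      (∀ y ∈ Cube.boundary (Fin (d + 1)), L (0, y) = g y) ∧
      ∀ t, ∀ y ∈ openBox d, L (t, y) = H (t, y) := by
  classical
  obtain ⟨G, hG, G0, GH⟩ := exists_homotopy_extension (g := fun y => g (face 0 1 y))
    (H := fun z => H (z.1, face 0 1 z.2))
    (hg.comp_continuous (continuous_face 0 1) (face_mem_boundary 0 (Or.inr rfl)))
    (hH.comp (by fun_prop) fun z hz => ⟨trivial, face_zero_mem_openBox 1 hz.2⟩)
    fun y hy => H0 _ (face_zero_mem_openBox 1 hy)
  let L : I × (Fin (d + 1) → I) → X := fun z =>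
    if z.2 0 = 1 then G (z.1, fun j => z.2 j.succ) else H z
  have L_face : ∀ t y, L (t, face 0 1 y) = G (t, y) := fun t y => by
    simp only [L, face_same, face_zero_succ, if_true]
  have L_box : ∀ t, ∀ y ∈ openBox d, L (t, y) = H (t, y) := fun t y hy => by
    by_cases h1 : y 0 = 1
    · rw [← face_zero_tail y, h1, L_face]
      refine GH t _ (hy.resolve_left ?_)
      rw [h1]
      exact one_ne_zero
    · exact if_neg h1
  have hbox : ∀ i ε, (∀ y : Fin d → I, face i ε y ∈ openBox d) →
      Continuous fun z : I × (Fin d → I) => L (z.1, face i ε z.2) := fun i ε h => by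
    simp only [L_box _ _ (h _)]
    exact hH.comp_continuous (by fun_prop) fun z => ⟨trivial, h z.2⟩
  refine ⟨L, continuousOn_prod_boundary fun i ε hε => ?_, fun y hy => ?_, L_box⟩
  · induction i using Fin.cases with
    | zero =>
      rcases hε with rfl | rfl
      · exact hbox 0 0 fun y => Or.inl (face_same _ _ _)
      · simpa only [L_face] using hG
    | succ i => exact hbox _ ε (face_succ_mem_openBox i hε)
  · rcases mem_boundary_iff_openBox.1 hy with h1 | h
    · rw [← face_zero_tail y, h1, L_face, G0]
    · rw [L_box 0 y h, H0 y h]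

theorem exists_homotopicOn_onCubeBoundary (hX : CubeExtension X 1) (b : X)
    {g : (Fin (d + 1) → I) → X} (hg : ContinuousOn g (Cube.boundary (Fin (d + 1)))) :
    ∃ f : GenLoop (Fin d) X b,
      HomotopicOn (Cube.boundary (Fin (d + 1))) Set.univ g (onCubeBoundary f) := by
  obtain ⟨H, hH, -, H0, H1⟩ : HomotopicOn (openBox d) Set.univ g fun _ => b :=
    (homotopicOn_openBox.postcomp (hg.mono openBox_subset_boundary) (Set.mapsTo_univ _ _)).trans
      (hX.homotopicOn_const _ _ b)
  obtain ⟨L, hL, L0, LH⟩ := exists_homotopy_extension_boundary hg hH H0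
  have L1 : ∀ y ∈ openBox d, L (1, y) = b := fun y hy => (LH 1 y hy).trans (H1 y hy)
  refine ⟨⟨⟨fun y => L (1, face 0 1 y), hL.comp_continuous (by fun_prop)
      fun y => ⟨trivial, face_mem_boundary 0 (Or.inr rfl) y⟩⟩,
    fun y hy => L1 _ (face_zero_mem_openBox 1 hy)⟩, L, hL, fun _ _ _ => trivial, L0, fun y hy => ?_⟩
  unfold onCubeBoundary
  split_ifs with h1
  · exact congrArg (fun w => L (1, w)) (by rw [← h1]; exact (face_zero_tail y).symm)
  · exact L1 y ((mem_boundary_iff_openBox.1 hy).resolve_left h1)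

end HomotopicOn

/-! ### Sections over skeleta, and homotopies between them -/

section Sections

variable {M E F V : Type*} [TopologicalSpace M] [TopologicalSpace E] [TopologicalSpace F]
  {K : AbstractSimplicialComplex V} {T : Realization K ≃ₜ M} {p : E → M}
  {m N : ℕ} {s s' : Realization K → E}

lemma IsSkeletonSection.mono (hs : IsSkeletonSection T p N s) (h : m ≤ N) :
    IsSkeletonSection T p m s :=
  ⟨hs.1.mono (skeleton_mono h), fun x hx => hs.2 x (skeleton_mono h hx)⟩

lemma IsSkeletonSection.mem_preimage (hs : IsSkeletonSection T p N s) {x : Realization K}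
    (hx : x ∈ skeleton K N) {t : Finset V} (ht : x ∈ closedSimplex K t) :
    s x ∈ p ⁻¹' (T '' closedSimplex K t) :=
  ⟨x, ht, (hs.2 x hx).symm⟩

lemma IsSkeletonSection.postcomp {E' : Type*} [TopologicalSpace E'] {p' : E' → M} {φ : E → E'}
    (hφ : Continuous φ) (hp : ∀ w, p' (φ w) = p w) (h : IsSkeletonSection T p m s) :
    IsSkeletonSection T p' m (φ ∘ s) :=
  ⟨hφ.comp_continuousOn h.1, fun x hx => (hp _).trans (h.2 x hx)⟩

lemma SetTrivialization.exists_lift {S : Set M} (t : SetTrivialization F p S)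
    (hF : CubeExtension F m) {c : (Fin m → I) → M} (hc : Continuous c) (hcS : ∀ y, c y ∈ S)
    {g : (Fin m → I) → E} (hg : ContinuousOn g (Cube.boundary (Fin m)))
    (hgc : ∀ y ∈ Cube.boundary (Fin m), p (g y) = c y) :
    ∃ G, Continuous G ∧ Set.EqOn G g (Cube.boundary (Fin m)) ∧ ∀ y, p (G y) = c y := by
  have hgS : Set.MapsTo g (Cube.boundary (Fin m)) (p ⁻¹' S) := fun y hy => by
    rw [Set.mem_preimage, hgc y hy]
    exact hcS y
  obtain ⟨G, hG, hGg⟩ := hF (t.toF ∘ g) (t.continuousOn_toF.comp hg hgS)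
  refine ⟨fun y => t.toE (c y, G y), t.continuousOn_toE.comp_continuous (hc.prodMk hG)
    fun y => ⟨hcS y, trivial⟩, fun y hy => ?_, fun y => t.proj_toE _ (hcS y) _⟩
  dsimp only
  rw [hGg hy, ← hgc y hy]
  exact t.toE_toF _ (hgS hy)

lemma SetTrivialization.exists_lift_prism {S : Set M} (t : SetTrivialization F p S)
    (hF : CubeExtension F (m + 1)) {c : (Fin m → I) → M} (hc : Continuous c) (hcS : ∀ y, c y ∈ S)
    {g₀ g₁ : (Fin m → I) → E} (hg₀ : Continuous g₀) (hg₁ : Continuous g₁)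
    (hg₀c : ∀ y, p (g₀ y) = c y) (hg₁c : ∀ y, p (g₁ y) = c y)
    {g : (Fin m → I) → C(I, E)} (hg : ContinuousOn g (Cube.boundary (Fin m)))
    (hgR : ∀ y ∈ Cube.boundary (Fin m), (∀ a, p (g y a) = c y) ∧ g y 0 = g₀ y ∧ g y 1 = g₁ y) :
    ∃ G : (Fin m → I) → C(I, E), Continuous G ∧ Set.EqOn G g (Cube.boundary (Fin m)) ∧
      ∀ y, (∀ a, p (G y a) = c y) ∧ G y 0 = g₀ y ∧ G y 1 = g₁ y := by
  obtain ⟨β, hβ, β0, β1, βg⟩ := exists_continuousOn_prism_boundary hg₀ hg₁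
    (H := fun z => g z.2 z.1)
    ((hg.comp continuousOn_snd fun z hz => hz.2).eval continuousOn_fst)
    (fun y hy => (hgR y hy).2.1) (fun y hy => (hgR y hy).2.2)
  have hβp : ∀ w ∈ Cube.boundary (Fin (m + 1)), p (β w) = c fun j => w j.succ := by
    intro w hw
    rw [← face_zero_tail w, face_zero_mem_boundary_iff] at hw
    rw [← face_zero_tail w]
    simp only [face_zero_succ]
    rcases hw with (hw | hw) | hw
    · rw [hw, β0, hg₀c]
    · rw [hw, β1, hg₁c]
    · rw [βg _ _ hw, (hgR _ hw).1]
  obtain ⟨G, hG, hGβ, hGp⟩ := t.exists_lift hF (hc.comp continuous_tail) (fun w => hcS _) hβ hβp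
  have hG' : Continuous fun z : (Fin m → I) × I => G (face 0 z.2 z.1) :=
    hG.comp ((continuous_face_uncurry 0).comp continuous_swap)
  refine ⟨fun y => ⟨fun a => G (face 0 a y), hG'.comp (Continuous.prodMk_right y)⟩,
    ContinuousMap.continuous_of_continuous_uncurry _ hG', fun y hy => ?_, fun y =>
    ⟨fun a => (hGp _).trans (by simp only [Function.comp_apply, face_zero_succ]),
      (hGβ (face_mem_boundary 0 (Or.inl rfl) y)).trans (β0 y),
      (hGβ (face_mem_boundary 0 (Or.inr rfl) y)).trans (β1 y)⟩⟩
  ext1 a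
  exact (hGβ (face_zero_mem_boundary_iff.2 (Or.inr hy))).trans (βg a y hy)

variable (T p N s s') in
/-- A homotopy from `s` to `s'` through sections of `p` over the `N`-skeleton, written as a family
of paths in the fibers. -/
structure IsSkeletonHomotopy (u : Realization K → C(I, E)) : Prop where
  continuousOn : ContinuousOn u (skeleton K N)
  proj : ∀ x ∈ skeleton K N, ∀ t, p (u x t) = T x
  apply_zero : ∀ x ∈ skeleton K N, u x 0 = s x
  apply_one : ∀ x ∈ skeleton K N, u x 1 = s' x

variable [LinearOrder V]

lemma mem_image_cubeMap (T : Realization K ≃ₜ M) (τ : Simplices K m) (y : Fin m → I) :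
    T (cubeMap τ y) ∈ T '' closedSimplex K τ.1 :=
  Set.mem_image_of_mem T (cubeMap_mem τ y)

lemma IsSkeletonSection.continuous_comp_cubeMap (hs : IsSkeletonSection T p N s)
    (τ : Simplices K m) (hm : m ≤ N) : Continuous fun y => s (cubeMap τ y) :=
  hs.1.comp_continuous (continuous_cubeMap τ) (cubeMap_mem_skeleton τ hm)

theorem exists_isSkeletonSection [Nonempty F]
    (hp : ∀ x, ∃ e : Bundle.Trivialization F p, x ∈ e.baseSet)
    (hF : ∀ m ≤ N, CubeExtension F m) : ∃ s, IsSkeletonSection T p N s := by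
  rcases isEmpty_or_nonempty (Realization K) with h | ⟨⟨x⟩⟩
  · exact ⟨isEmptyElim, (continuous_of_const isEmptyElim).continuousOn, isEmptyElim⟩
  obtain ⟨e, -⟩ := hp (T x)
  have : Nonempty E := ⟨fiberMap e (T x) (Classical.arbitrary F)⟩
  refine exists_skeletal_map (fun x e => p e = T x) N fun m hm τ g hg hgp => ?_
  obtain ⟨t⟩ := nonempty_setTrivialization T hp τ.2.1
  exact t.exists_lift (hF m hm) (T.continuous.comp (continuous_cubeMap τ)) (mem_image_cubeMap T τ)
    hg hgp

theorem exists_isSkeletonHomotopy (hp : ∀ x, ∃ e : Bundle.Trivialization F p, x ∈ e.baseSet)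
    (hF : ∀ m ≤ N, CubeExtension F (m + 1)) (hs : IsSkeletonSection T p N s)
    (hs' : IsSkeletonSection T p N s') : ∃ u, IsSkeletonHomotopy T p N s s' u := by
  rcases isEmpty_or_nonempty (Realization K) with h | ⟨⟨x⟩⟩
  · exact ⟨isEmptyElim, (continuous_of_const isEmptyElim).continuousOn, isEmptyElim, isEmptyElim,
      isEmptyElim⟩
  have : Nonempty C(I, E) := ⟨ContinuousMap.const I (s x)⟩
  suffices h : ∃ u : Realization K → C(I, E), ContinuousOn u (skeleton K N) ∧
      ∀ x ∈ skeleton K N, (∀ t, p (u x t) = T x) ∧ u x 0 = s x ∧ u x 1 = s' x by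
    obtain ⟨u, hu, h⟩ := h
    exact ⟨u, hu, fun x hx => (h x hx).1, fun x hx => (h x hx).2.1, fun x hx => (h x hx).2.2⟩
  refine exists_skeletal_map
    (fun x (w : C(I, E)) => (∀ t, p (w t) = T x) ∧ w 0 = s x ∧ w 1 = s' x) N
    fun m hm τ g hg hgR => ?_
  obtain ⟨t⟩ := nonempty_setTrivialization T hp τ.2.1
  have hsk := cubeMap_mem_skeleton τ hm
  exact t.exists_lift_prism (hF m hm) (T.continuous.comp (continuous_cubeMap τ))
    (mem_image_cubeMap T τ) (hs.continuous_comp_cubeMap τ hm) (hs'.continuous_comp_cubeMap τ hm)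
    (fun y => hs.2 _ (hsk y)) (fun y => hs'.2 _ (hsk y)) hg hgR

end Sections

/-! ### Prisms over simplices -/

section Prisms

variable {M E V : Type*} [TopologicalSpace M] [TopologicalSpace E] [LinearOrder V]
  {K : AbstractSimplicialComplex V} {T : Realization K ≃ₜ M} {p : E → M} {m N : ℕ}
  {s s' : Realization K → E} {u : Realization K → C(I, E)}

open Classical in
/-- The map on the prism over the simplex `ρ` that is `s` on the bottom, `s'` on the top and `u` in
between. It is used on the boundary of the prism only. -/
def prismMap (s s' : Realization K → E) (u : Realization K → C(I, E)) (ρ : Simplices K m)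
    (w : Fin (m + 1) → I) : E :=
  if w 0 = 0 then s (cubeMap ρ fun j => w j.succ)
  else if w 0 = 1 then s' (cubeMap ρ fun j => w j.succ)
  else u (cubeMap ρ fun j => w j.succ) (w 0)

lemma prismMap_comp_face_zero_zero (ρ : Simplices K m) :
    prismMap s s' u ρ ∘ face 0 0 = s ∘ cubeMap ρ := by
  ext1 y
  simp only [prismMap, Function.comp_apply, face_same, face_zero_succ, if_true]

lemma prismMap_comp_face_zero_one (ρ : Simplices K m) :
    prismMap s s' u ρ ∘ face 0 1 = s' ∘ cubeMap ρ := by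
  ext1 y
  simp only [prismMap, Function.comp_apply, face_same, face_zero_succ, one_ne_zero, if_false,
    if_true]

lemma prismMap_comp_face_succ_one (τ : Simplices K (m + 1)) (i : Fin (m + 1)) :
    prismMap s s' u τ ∘ face i.succ 1 = prismMap s s' u (oppositeFace τ i.castSucc) := by
  ext1 w
  simp only [prismMap, Function.comp_apply, face_succ_zero, face_succ_succ, cubeMap_face_one]

lemma prismMap_comp_face_last_zero (τ : Simplices K (m + 1)) :
    prismMap s s' u τ ∘ face (Fin.last m).succ 0 =
      prismMap s s' u (oppositeFace τ (Fin.last (m + 1))) := by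
  ext1 w
  simp only [prismMap, Function.comp_apply, face_succ_zero, face_succ_succ, cubeMap_face_last]

namespace IsSkeletonHomotopy

variable (hu : IsSkeletonHomotopy T p N s s' u)
include hu

lemma prismMap_eq {ρ : Simplices K m} {w : Fin (m + 1) → I}
    (h : cubeMap ρ (fun j => w j.succ) ∈ skeleton K N) :
    prismMap s s' u ρ w = u (cubeMap ρ fun j => w j.succ) (w 0) := by
  unfold prismMap
  split_ifs with h0 h1
  · rw [h0, hu.apply_zero _ h]
  · rw [h1, hu.apply_one _ h]
  · rfl

lemma continuous_prismMap_comp_face (ρ : Simplices K (m + 1)) (i : Fin (m + 1)) {ε : I}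
    (h : ∀ y, cubeMap ρ (face i ε y) ∈ skeleton K N) :
    Continuous (prismMap s s' u ρ ∘ face i.succ ε) := by
  have hw : ∀ w : Fin (m + 1) → I, (prismMap s s' u ρ ∘ face i.succ ε) w =
      u (cubeMap ρ (face i ε fun j => w j.succ)) (w 0) := fun w => by
    rw [Function.comp_apply, hu.prismMap_eq] <;> simp only [face_succ_succ, face_succ_zero, h]
  rw [funext hw]
  exact (hu.continuousOn.comp_continuous ((continuous_cubeMap ρ).comp
    ((continuous_face i ε).comp continuous_tail)) fun _ => h _).eval (continuous_apply 0)

lemma prismMap_mem_preimage {ρ : Simplices K m} {w : Fin (m + 1) → I}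
    (h : cubeMap ρ (fun j => w j.succ) ∈ skeleton K N) :
    prismMap s s' u ρ w ∈ p ⁻¹' (T '' closedSimplex K ρ.1) := by
  rw [hu.prismMap_eq h, Set.mem_preimage, hu.proj _ h]
  exact mem_image_cubeMap T ρ _

lemma continuousOn_prismMap (hs : IsSkeletonSection T p (N + 1) s)
    (hs' : IsSkeletonSection T p (N + 1) s') (ρ : Simplices K (N + 1)) :
    ContinuousOn (prismMap s s' u ρ) (Cube.boundary (Fin (N + 2))) := by
  refine continuousOn_boundary fun i ε hε => ?_
  cases i using Fin.cases with
  | zero =>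
    rcases hε with rfl | rfl
    · exact (congrArg Continuous (prismMap_comp_face_zero_zero ρ)).mpr
        (hs.continuous_comp_cubeMap ρ le_rfl)
    · exact (congrArg Continuous (prismMap_comp_face_zero_one ρ)).mpr
        (hs'.continuous_comp_cubeMap ρ le_rfl)
  | succ i =>
    exact hu.continuous_prismMap_comp_face ρ i fun y =>
      mapsTo_cubeMap_boundary ρ (face_mem_boundary i hε y)

lemma mapsTo_prismMap (hs : IsSkeletonSection T p (N + 1) s)
    (hs' : IsSkeletonSection T p (N + 1) s') (ρ : Simplices K (N + 1)) :
    Set.MapsTo (prismMap s s' u ρ) (Cube.boundary (Fin (N + 2)))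
      (p ⁻¹' (T '' closedSimplex K ρ.1)) := by
  have hsk := cubeMap_mem_skeleton ρ le_rfl
  intro w hw
  rw [← face_zero_tail w, face_zero_mem_boundary_iff] at hw
  rcases hw with (hw | hw) | hw
  · rw [prismMap, if_pos hw]
    exact hs.mem_preimage (hsk _) (cubeMap_mem ρ _)
  · rw [prismMap, if_neg (hw ▸ one_ne_zero), if_pos hw]
    exact hs'.mem_preimage (hsk _) (cubeMap_mem ρ _)
  · exact hu.prismMap_mem_preimage (mapsTo_cubeMap_boundary ρ hw)

end IsSkeletonHomotopy

end Prisms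

/-! ### Obstruction cochains -/

section Obstruction

variable {M E F V : Type*} [TopologicalSpace M] [TopologicalSpace E] [TopologicalSpace F]
  {K : AbstractSimplicialComplex V} {T : Realization K ≃ₜ M} {p : E → M} {k : ℕ}
  {J : M → Set (Sph (k + 2) → E)} {s s' : Realization K → E} {r r' : E → Sph (k + 2)}
  {t t' : Finset V}

variable (T p J) in
/-- With respect to a family `J` of oriented maps from the sphere to the fibers of `p`: the map `r`
is, over the simplex `t`, a left homotopy inverse of the oriented maps. -/
structure IsOrientedRetraction (t : Finset V) (r : E → Sph (k + 2)) : Prop where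
  continuousOn : ContinuousOn r (p ⁻¹' (T '' closedSimplex K t))
  homotopicOn : ∀ x ∈ T '' closedSimplex K t, ∀ j ∈ J x, HomotopicOn Set.univ Set.univ (r ∘ j) id

variable (T p J) in
/-- Over each simplex, the oriented maps have homotopy inverses. -/
def HasRetractions : Prop :=
  ∀ t ∈ K.faces, ∀ x ∈ T '' closedSimplex K t, ∃ r, IsOrientedRetraction T p J t r ∧
    ∃ j ∈ J x, Continuous j ∧ (∀ v, p (j v) = x) ∧
      HomotopicOn (p ⁻¹' (T '' closedSimplex K t)) (p ⁻¹' (T '' closedSimplex K t)) id (j ∘ r)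

lemma image_closedSimplex_mono (h : t ⊆ t') : T '' closedSimplex K t ⊆ T '' closedSimplex K t' :=
  Set.image_mono fun _ hx v hv => hx v fun hs => hv (h hs)

lemma IsOrientedRetraction.mono (hr : IsOrientedRetraction T p J t' r) (h : t ⊆ t') :
    IsOrientedRetraction T p J t r :=
  ⟨hr.continuousOn.mono (Set.preimage_mono (image_closedSimplex_mono h)),
    fun x hx => hr.homotopicOn x (image_closedSimplex_mono h hx)⟩

lemma IsOrientedRetraction.degree_comp_eq_zero (hr : IsOrientedRetraction T p J t r)
    {g : (Fin (k + 2) → I) → E} (hg : Continuous g)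
    (hgt : ∀ y, g y ∈ p ⁻¹' (T '' closedSimplex K t)) : degree (r ∘ g) = 0 :=
  degree_eq_zero (hr.continuousOn.comp_continuous hg hgt)

lemma IsOrientedRetraction.degree_comp_eq {x : M} {j : Sph (k + 2) → E}
    (hr : IsOrientedRetraction T p J t r) (hr' : IsOrientedRetraction T p J t r')
    (hx : x ∈ T '' closedSimplex K t) (hj : j ∈ J x)
    (hjr : HomotopicOn (p ⁻¹' (T '' closedSimplex K t)) (p ⁻¹' (T '' closedSimplex K t)) id
      (j ∘ r')) {g : (Fin (k + 2) → I) → E} (hg : ContinuousOn g (Cube.boundary (Fin (k + 2))))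
    (hgt : Set.MapsTo g (Cube.boundary (Fin (k + 2))) (p ⁻¹' (T '' closedSimplex K t))) :
    degree (r ∘ g) = degree (r' ∘ g) :=
  degree_eq_of_homotopicOn <|
    ((hjr.precomp hg hgt).postcomp hr.continuousOn (Set.mapsTo_univ _ _)).trans
      ((hr.homotopicOn x hx j hj).precomp (hr'.continuousOn.comp hg hgt) (Set.mapsTo_univ _ _))

variable [LinearOrder V]

lemma oppositeFace_subset {m : ℕ} (τ : Simplices K (m + 1)) (i : Fin (m + 2)) :
    (oppositeFace τ i).1 ⊆ τ.1 :=
  Finset.erase_subset _ _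

lemma coboundary_eq_sum {A : Type*} [AddCommGroup A] {m : ℕ} {f : Simplices K m → A}
    {τ : Simplices K (m + 1)} {a₀ a₁ : Fin (m + 1) → A}
    (h₁ : ∀ i, a₁ i = f (oppositeFace τ i.castSucc))
    (h_last : a₀ (Fin.last m) = f (oppositeFace τ (Fin.last (m + 1))))
    (h₀ : ∀ i ≠ Fin.last m, a₀ i = 0) :
    coboundary K A m f τ = ∑ i : Fin (m + 1), (-1 : ℤ) ^ (i : ℕ) • (a₁ i - a₀ i) := by
  have h : ∑ i : Fin (m + 1), (-1 : ℤ) ^ (i : ℕ) • a₀ i =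
      (-1 : ℤ) ^ m • f (oppositeFace τ (Fin.last (m + 1))) := by
    rw [Finset.sum_eq_single_of_mem (Fin.last m) (Finset.mem_univ _) fun i _ hi => by
      rw [h₀ i hi, smul_zero], h_last, Fin.val_last]
  change ∑ i : Fin (m + 2), _ = _
  simp only [smul_sub, Finset.sum_sub_distrib, h, h₁]
  simp only [Fin.sum_univ_castSucc (n := m + 1), Fin.val_castSucc, Fin.val_last, pow_succ,
    mul_neg_one, neg_smul, sub_eq_add_neg]

variable (T p J) in
/-- The class `α` is the obstruction to extending the section `s` over the simplex `τ`, where the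
oriented maps play the role of the oriented parametrizations of the fibers. -/
def Represents (s : Realization K → E) (τ : Simplices K (k + 2)) (α : SphereCoeff k) : Prop :=
  ∃ f, SphereCoeff.mk f = α ∧ ∃ j ∈ J (T (cubeMap τ fun _ => 0)),
    HomotopicOn (Cube.boundary (Fin (k + 2))) (p ⁻¹' (T '' closedSimplex K τ.1)) (s ∘ cubeMap τ)
      (j ∘ onCubeBoundary f)

lemma Represents.postcomp {E' : Type*} [TopologicalSpace E'] {p' : E' → M}
    {J' : M → Set (Sph (k + 2) → E')} {φ : E → E'} (hφ : Continuous φ) (hp : ∀ w, p' (φ w) = p w)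
    (hJ : ∀ x, ∀ j ∈ J x, φ ∘ j ∈ J' x) {τ : Simplices K (k + 2)} {α : SphereCoeff k}
    (h : Represents T p J s τ α) : Represents T p' J' (φ ∘ s) τ α := by
  obtain ⟨f, hf, j, hj, h⟩ := h
  refine ⟨f, hf, _, hJ _ j hj, h.postcomp hφ.continuousOn fun w hw => ?_⟩
  rwa [Set.mem_preimage, hp]

lemma Represents.degree_eq {τ : Simplices K (k + 2)} {α : SphereCoeff k}
    (h : Represents T p J s τ α) (hr : IsOrientedRetraction T p J τ.1 r) :
    degree (r ∘ s ∘ cubeMap τ) = α := by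
  obtain ⟨f, rfl, j, hj, h⟩ := h
  rw [← degree_onCubeBoundary]
  exact degree_eq_of_homotopicOn ((h.postcomp hr.continuousOn (Set.mapsTo_univ _ _)).trans
    ((hr.homotopicOn _ (mem_image_cubeMap T τ _) j hj).precomp (continuousOn_onCubeBoundary f)
      (Set.mapsTo_univ _ _)))

lemma IsOrientedRetraction.coboundary_eq_sub {τ : Simplices K (k + 2)}
    (hr : IsOrientedRetraction T p J τ.1 r) {u : Realization K → C(I, E)}
    (hu : IsSkeletonHomotopy T p k s s' u) {α α' : SphereCoeff k} (h : Represents T p J s τ α)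
    (h' : Represents T p J s' τ α') {d : Simplices K (k + 1) → SphereCoeff k}
    (hd : ∀ i, d (oppositeFace τ i) = degree (r ∘ prismMap s s' u (oppositeFace τ i))) :
    coboundary K (SphereCoeff k) (k + 1) d τ = α' - α := by
  have hD := cubeD_degree (r ∘ prismMap s s' u τ)
  simp only [cubeD_eq_sub_sum, Function.comp_assoc, prismMap_comp_face_zero_zero,
    prismMap_comp_face_zero_one, h.degree_eq hr, h'.degree_eq hr] at hD
  rw [sub_eq_zero.1 hD]
  refine coboundary_eq_sum (fun i => ?_) ?_ fun i hi => ?_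
  · rw [prismMap_comp_face_succ_one, hd]
  · rw [prismMap_comp_face_last_zero, hd]
  · have hsk : ∀ y, cubeMap τ (face i 0 y) ∈ skeleton K k := fun y =>
      skeleton_mono (Nat.le_of_lt_succ (Fin.val_lt_last hi)) (cubeMap_face_zero_mem_skeleton τ i y)
    refine hr.degree_comp_eq_zero (hu.continuous_prismMap_comp_face τ i hsk) fun w =>
      hu.prismMap_mem_preimage ?_
    simp only [face_succ_succ, hsk]

namespace HasRetractions

variable (hJ : HasRetractions T p J)
include hJ

lemma exists_isOrientedRetraction {m : ℕ} (τ : Simplices K m) :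
    ∃ r, IsOrientedRetraction T p J τ.1 r :=
  (hJ τ.1 τ.2.1 _ (mem_image_cubeMap T τ fun _ => 0)).imp fun _ h => h.1

lemma exists_represents (hs : IsSkeletonSection T p (k + 1) s) (τ : Simplices K (k + 2)) :
    ∃ α, Represents T p J s τ α := by
  obtain ⟨r, hr, j, hj, hjc, hjx, hjr⟩ := hJ τ.1 τ.2.1 _ (mem_image_cubeMap T τ fun _ => 0)
  have hc : ContinuousOn (s ∘ cubeMap τ) (Cube.boundary (Fin (k + 2))) :=
    hs.1.comp (continuous_cubeMap τ).continuousOn (mapsTo_cubeMap_boundary τ)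
  have hm : Set.MapsTo (s ∘ cubeMap τ) (Cube.boundary (Fin (k + 2)))
      (p ⁻¹' (T '' closedSimplex K τ.1)) := fun y hy =>
    hs.mem_preimage (mapsTo_cubeMap_boundary τ hy) (cubeMap_mem τ y)
  have hjm : Set.MapsTo j Set.univ (p ⁻¹' (T '' closedSimplex K τ.1)) := fun v _ => by
    rw [Set.mem_preimage, hjx]
    exact mem_image_cubeMap T τ _
  obtain ⟨f, hf⟩ := exists_homotopicOn_onCubeBoundary (cubeExtension_sphere (by omega))
    (basePt (k + 1)) (hr.continuousOn.comp hc hm)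
  exact ⟨_, f, rfl, j, hj, (hjr.precomp hc hm).trans (hf.postcomp hjc.continuousOn hjm)⟩

theorem mem_cocycles (hs : IsSkeletonSection T p (k + 1) s)
    {z : Simplices K (k + 2) → SphereCoeff k} (hz : ∀ τ, Represents T p J s τ (z τ)) :
    z ∈ cocycles K (SphereCoeff k) (k + 2) := by
  refine AddMonoidHom.mem_ker.2 (funext fun τ => ?_)
  obtain ⟨r, hr⟩ := hJ.exists_isOrientedRetraction τ
  have hface : ∀ i, degree (r ∘ s ∘ cubeMap (oppositeFace τ i)) = z (oppositeFace τ i) := fun i =>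
    (hz _).degree_eq (hr.mono (oppositeFace_subset τ i))
  -- The faces of the cube on which `cubeMap` is degenerate contribute `0`, because `s` is defined
  -- on their images.
  refine (coboundary_eq_sum (fun i => ?_) ?_ fun i hi => ?_).trans
    (cubeD_degree (r ∘ s ∘ cubeMap τ))
  · rw [← hface]
    exact congrArg (fun c => degree (r ∘ s ∘ c)) (funext (cubeMap_face_one τ i))
  · rw [← hface]
    exact congrArg (fun c => degree (r ∘ s ∘ c)) (funext (cubeMap_face_last τ))
  · have hsk : ∀ y, cubeMap τ (face i 0 y) ∈ skeleton K (k + 1) := fun y =>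
      skeleton_mono (Nat.le_of_lt_succ (Fin.val_lt_last hi)) (cubeMap_face_zero_mem_skeleton τ i y)
    exact hr.degree_comp_eq_zero
      (hs.1.comp_continuous ((continuous_cubeMap τ).comp (continuous_face i 0)) hsk)
      fun y => hs.mem_preimage (hsk y) (cubeMap_mem τ _)

theorem sub_mem_coboundaries (hp : ∀ x, ∃ e : Bundle.Trivialization F p, x ∈ e.baseSet)
    (hF : ∀ m ≤ k + 1, CubeExtension F m) (hs : IsSkeletonSection T p (k + 1) s)
    (hs' : IsSkeletonSection T p (k + 1) s') {z z' : Simplices K (k + 2) → SphereCoeff k}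
    (hz : ∀ τ, Represents T p J s τ (z τ)) (hz' : ∀ τ, Represents T p J s' τ (z' τ)) :
    z' - z ∈ coboundaries K (SphereCoeff k) (k + 2) := by
  obtain ⟨u, hu⟩ := exists_isSkeletonHomotopy hp (fun m hm => hF (m + 1) (Nat.succ_le_succ hm))
    (hs.mono k.le_succ) (hs'.mono k.le_succ)
  choose r hr j hj _ _ hjr using fun ρ : Simplices K (k + 1) =>
    hJ ρ.1 ρ.2.1 _ (mem_image_cubeMap T ρ fun _ => 0)
  refine ⟨fun ρ => degree (r ρ ∘ prismMap s s' u ρ), funext fun τ => ?_⟩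
  obtain ⟨r', hr'⟩ := hJ.exists_isOrientedRetraction τ
  refine hr'.coboundary_eq_sub hu (hz τ) (hz' τ) fun i => Eq.symm ?_
  exact (hr'.mono (oppositeFace_subset τ i)).degree_comp_eq (hr _) (mem_image_cubeMap T _ _) (hj _)
    (hjr _) (hu.continuousOn_prismMap hs hs' _) (hu.mapsTo_prismMap hs hs' _)

end HasRetractions

variable (T p J) in
/-- The class `c` is the primary obstruction to a section of `p`, where fibers are oriented by the
family `J` of maps from the sphere: it is represented by the obstruction cochain of every section
over the `(k + 1)`-skeleton. -/
def IsPrimaryObstruction (c : Cohomology K (SphereCoeff k) (k + 2)) : Prop :=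
  ∀ s, IsSkeletonSection T p (k + 1) s → ∀ z, (∀ τ, Represents T p J s τ (z τ)) →
    ∃ hz : z ∈ cocycles K (SphereCoeff k) (k + 2), QuotientAddGroup.mk ⟨z, hz⟩ = c

theorem HasRetractions.exists_isPrimaryObstruction [Nonempty F] (hJ : HasRetractions T p J)
    (hp : ∀ x, ∃ e : Bundle.Trivialization F p, x ∈ e.baseSet)
    (hF : ∀ m ≤ k + 1, CubeExtension F m) : ∃ c, IsPrimaryObstruction T p J c := by
  obtain ⟨s, hs⟩ := exists_isSkeletonSection (T := T) hp hF
  choose z hz using hJ.exists_represents hs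
  refine ⟨QuotientAddGroup.mk ⟨z, hJ.mem_cocycles hs hz⟩, fun s' hs' z' hz' =>
    ⟨hJ.mem_cocycles hs' hz', QuotientAddGroup.eq.2 (AddSubgroup.mem_addSubgroupOf.2 ?_)⟩⟩
  have h := hJ.sub_mem_coboundaries hp hF hs' hs hz' hz
  rwa [sub_eq_neg_add] at h

lemma IsPrimaryObstruction.comap {E' : Type*} [TopologicalSpace E'] {p' : E' → M}
    {J' : M → Set (Sph (k + 2) → E')} {c : Cohomology K (SphereCoeff k) (k + 2)}
    (hc : IsPrimaryObstruction T p' J' c) {φ : E → E'} (hφ : Continuous φ)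
    (hp : ∀ w, p' (φ w) = p w) (hJ : ∀ x, ∀ j ∈ J x, φ ∘ j ∈ J' x) :
    IsPrimaryObstruction T p J c := fun _ hs z hz =>
  hc _ (hs.postcomp hφ hp) z fun τ => (hz τ).postcomp hφ hp hJ

end Obstruction

/-! ### Existence of oriented retractions -/

section Retractions

variable {M E F V : Type*} [TopologicalSpace M] [TopologicalSpace E] [TopologicalSpace F]
  {K : AbstractSimplicialComplex V} {T : Realization K ≃ₜ M} {k : ℕ} {p : E → M}
  {J : M → Set (Sph (k + 2) → E)} {S : Set M} {x x₀ : M} {j j' : Sph (k + 2) → E}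

lemma homotopicOn_closedSimplex {s : Finset V} (hs : s ∈ K.faces) {x₀ : Realization K}
    (hx₀ : x₀ ∈ closedSimplex K s) :
    HomotopicOn (closedSimplex K s) (closedSimplex K s) id fun _ => x₀ := by
  let b₀ : stdSimplex ℝ s := baryCoord ⟨x₀, hx₀⟩
  let c : I → stdSimplex ℝ s → stdSimplex ℝ s := fun t b =>
    ⟨(1 - (t : ℝ)) • b.1 + (t : ℝ) • b₀.1, convex_stdSimplex ℝ s b.2 b₀.2
      (sub_nonneg.2 t.2.2) t.2.1 (by ring)⟩
  have hc : Continuous fun z : I × stdSimplex ℝ s => c z.1 z.2 :=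
    Continuous.subtype_mk (by fun_prop) _
  refine homotopicOn_iff.2 ⟨⟨fun z => simplexMap K ⟨s, hs⟩ (c z.1 (baryCoord z.2)),
    (continuous_simplexMap _).comp (hc.comp (continuous_fst.prodMk
      (continuous_baryCoord.comp continuous_snd)))⟩, fun z => simplexMap_mem ⟨s, hs⟩ _,
    fun x => ?_, fun x => ?_⟩
  · have : c 0 (baryCoord x) = baryCoord x := Subtype.ext (by simp [c])
    exact (congrArg _ this).trans (simplexMap_baryCoord hs x)
  · have : c 1 (baryCoord x) = b₀ := Subtype.ext (by simp [c])
    exact (congrArg _ this).trans (simplexMap_baryCoord hs ⟨x₀, hx₀⟩)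

lemma homotopicOn_image_closedSimplex {s : Finset V} (hs : s ∈ K.faces)
    (hx₀ : x₀ ∈ T '' closedSimplex K s) :
    HomotopicOn (T '' closedSimplex K s) (T '' closedSimplex K s) id fun _ => x₀ := by
  obtain ⟨y, hy, rfl⟩ := hx₀
  have hT : Set.MapsTo T.symm (T '' closedSimplex K s) (closedSimplex K s) := by
    rintro _ ⟨x, hx, rfl⟩
    rwa [T.symm_apply_apply]
  exact (((homotopicOn_closedSimplex hs hy).precomp T.symm.continuous.continuousOn hT).postcomp
    T.continuous.continuousOn (Set.mapsTo_image _ _)).congr (fun x _ => T.apply_symm_apply x)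
    fun _ _ => rfl

namespace SetTrivialization

variable (t : SetTrivialization F p S)

/-- The map from the part of the bundle over `S` to the fiber over `x₀` given by the
trivialization. -/
def toFiber (x₀ : M) (w : E) : E := t.toE (x₀, t.toF w)

lemma continuousOn_toFiber (hx₀ : x₀ ∈ S) : ContinuousOn (t.toFiber x₀) (p ⁻¹' S) :=
  t.continuousOn_toE.comp (continuousOn_const.prodMk t.continuousOn_toF) fun _ _ => ⟨hx₀, trivial⟩

lemma mapsTo_toFiber (hx₀ : x₀ ∈ S) : Set.MapsTo (t.toFiber x₀) (p ⁻¹' S) (p ⁻¹' {x₀}) :=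
  fun _ _ => t.proj_toE _ hx₀ _

lemma toFiber_of_proj_eq {w : E} (hw : p w = x₀) (hx₀ : x₀ ∈ S) : t.toFiber x₀ w = w := by
  subst hw
  exact t.toE_toF w hx₀

lemma homotopicOn_toFiber (hp : Continuous p) (h : HomotopicOn S S id fun _ => x₀) :
    HomotopicOn (p ⁻¹' S) (p ⁻¹' S) id (t.toFiber x₀) := by
  obtain ⟨H, hH, hS, H0, H1⟩ := h
  refine ⟨fun z => t.toE (H (z.1, p z.2), t.toF z.2), ?_, fun a w hw => ?_, fun w hw => ?_,
    fun w hw => congrArg (fun x => t.toE (x, t.toF w)) (H1 _ hw)⟩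
  · exact t.continuousOn_toE.comp ((hH.comp (by fun_prop) fun z hz => ⟨trivial, hz.2⟩).prodMk
      (t.continuousOn_toF.comp continuousOn_snd fun z hz => hz.2))
      fun z hz => ⟨hS _ _ hz.2, trivial⟩
  · rw [Set.mem_preimage, t.proj_toE _ (hS a _ hw)]
    exact hS a _ hw
  · exact (congrArg (fun x => t.toE (x, t.toF w)) (H0 _ hw)).trans (t.toE_toF w hw)

end SetTrivialization

variable (p J) in
/-- A family of maps from the sphere to the fibers of `p`, unique up to homotopy and locally
represented by continuous families. -/
structure IsOrientation : Prop where
  continuous : ∀ x, ∀ j ∈ J x, Continuous j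
  proj : ∀ x, ∀ j ∈ J x, ∀ v, p (j v) = x
  homotopicOn : ∀ x, ∀ j ∈ J x, ∀ j' ∈ J x, HomotopicOn Set.univ (p ⁻¹' {x}) j j'
  exists_local : ∀ x, ∃ U ∈ 𝓝 x, ∃ φ : M × Sph (k + 2) → E, ContinuousOn φ (U ×ˢ Set.univ) ∧
    ∀ x' ∈ U, (fun v => φ (x', v)) ∈ J x'

namespace IsOrientation

variable (hJ : IsOrientation p J)
include hJ

lemma homotopicOn_of_mem (hj : j ∈ J x) (hj' : j' ∈ J x) (hx : x ∈ S) :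
    HomotopicOn Set.univ (p ⁻¹' S) j j' :=
  (hJ.homotopicOn x j hj j' hj').mono_codomain (Set.preimage_mono (Set.singleton_subset_iff.2 hx))

lemma homotopicOn_of_joinedIn_inter {U : Set M} {φ : M × Sph (k + 2) → E}
    (hφ : ContinuousOn φ (U ×ˢ Set.univ)) (hφJ : ∀ x ∈ U, (fun v => φ (x, v)) ∈ J x)
    (h : JoinedIn (U ∩ S) x x₀) (hj : j ∈ J x) (hj' : j' ∈ J x₀) :
    HomotopicOn Set.univ (p ⁻¹' S) j j' := by
  have hφxx₀ : HomotopicOn Set.univ (p ⁻¹' S) (fun v => φ (x, v)) fun v => φ (x₀, v) := by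
    obtain ⟨γ, hγ⟩ := h
    refine ⟨fun z => φ (γ z.1, z.2), (hφ.comp_continuous (by fun_prop)
      fun z => ⟨(hγ z.1).1, trivial⟩).continuousOn, fun t v _ => ?_, fun v _ => by simp,
      fun v _ => by simp⟩
    rw [Set.mem_preimage, hJ.proj _ _ (hφJ _ (hγ t).1) v]
    exact (hγ t).2
  exact ((hJ.homotopicOn_of_mem hj (hφJ x h.source_mem.1) h.source_mem.2).trans hφxx₀).trans
    (hJ.homotopicOn_of_mem (hφJ x₀ h.target_mem.1) hj' h.target_mem.2)

lemma homotopicOn_of_joinedIn (h : JoinedIn S x x₀) (hj : j ∈ J x) (hj' : j' ∈ J x₀) :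
    HomotopicOn Set.univ (p ⁻¹' S) j j' := by
  obtain ⟨γ, hγ⟩ := h
  let c : ℝ → M := γ.extend
  have hcS : ∀ t, c t ∈ S := fun t => hγ _
  let P : ℝ → ℝ → Prop := fun t t' => ∀ j ∈ J (c t), ∀ j' ∈ J (c t'),
    HomotopicOn Set.univ (p ⁻¹' S) j j'
  have : Std.Symm P := ⟨fun t t' h j hj j' hj' => (h j' hj' j hj).symm⟩
  have htrans : IsTrans ℝ P := ⟨fun t₁ t₂ t₃ h h' j hj j' hj' => by
    obtain ⟨U, hU, φ, -, hφ⟩ := hJ.exists_local (c t₂)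
    have hm := hφ _ (mem_of_mem_nhds hU)
    exact (h j hj _ hm).trans (h' _ hm j' hj')⟩
  have hlocal : ∀ t, ∀ᶠ t' in 𝓝 t, P t t' := fun t => by
    obtain ⟨U, hU, φ, hφ, hφJ⟩ := hJ.exists_local (c t)
    obtain ⟨W, ⟨hW, hWc⟩, hWU⟩ := (path_connected_basis t).mem_iff.1
      (γ.continuous_extend.continuousAt.preimage_mem_nhds hU)
    filter_upwards [hW] with t' ht' j hj j' hj'
    exact hJ.homotopicOn_of_joinedIn_inter hφ hφJ
      (((hWc.joinedIn t (mem_of_mem_nhds hW) t' ht').map γ.continuous_extend).mono <|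
        Set.image_subset_iff.2 fun a ha => ⟨hWU ha, hcS a⟩) hj hj'
  exact PreconnectedSpace.induction₂ P hlocal htrans 0 1 j
    (by rwa [show c 0 = x from γ.extend_zero]) j' (by rwa [show c 1 = x₀ from γ.extend_one])

end IsOrientation

variable (p) in
/-- The map `r` on the fiber of `p` over `x` is a homotopy inverse of the map `j` from the sphere to
this fiber. -/
structure IsFiberHomotopyInverse (x : M) (j : Sph (k + 2) → E) (r : E → Sph (k + 2)) : Prop where
  continuousOn : ContinuousOn r (p ⁻¹' {x})
  left : HomotopicOn Set.univ Set.univ (r ∘ j) id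
  right : HomotopicOn (p ⁻¹' {x}) (p ⁻¹' {x}) id (j ∘ r)

theorem IsOrientation.hasRetractions (hJ : IsOrientation p J)
    (hp : ∀ x, ∃ e : Bundle.Trivialization F p, x ∈ e.baseSet)
    (hr : ∀ x, ∃ j ∈ J x, ∃ r, IsFiberHomotopyInverse p x j r) : HasRetractions T p J := by
  intro s hs x₀ hx₀
  obtain ⟨t⟩ := nonempty_setTrivialization T hp hs
  obtain ⟨j, hj, r, hr⟩ := hr x₀
  have hcontract := homotopicOn_image_closedSimplex hs hx₀
  have hcont := t.continuousOn_toFiber hx₀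
  have hmaps := t.mapsTo_toFiber hx₀
  have hcomp : ContinuousOn (r ∘ t.toFiber x₀) (p ⁻¹' (T '' closedSimplex K s)) :=
    hr.continuousOn.comp hcont hmaps
  refine ⟨r ∘ t.toFiber x₀, ⟨hcomp, fun x hx j' hj' => ?_⟩, j, hj, hJ.continuous _ j hj,
    hJ.proj _ j hj, (t.homotopicOn_toFiber (continuous_proj hp) hcontract).trans
      ((hr.right.precomp hcont hmaps).mono_codomain
        (Set.preimage_mono (Set.singleton_subset_iff.2 hx₀)))⟩
  have hj'j := hJ.homotopicOn_of_joinedIn (hcontract.joinedIn hx) hj' hj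
  refine (hj'j.postcomp hcomp (Set.mapsTo_univ _ _)).trans
    (hr.left.congr (fun v _ => ?_) fun _ _ => rfl)
  simp only [Function.comp_apply, t.toFiber_of_proj_eq (hJ.proj _ j hj v) hx₀]

end Retractions

/-! ### Oriented sphere bundles -/

section SphereBundles

variable {M E F : Type*} [TopologicalSpace M] [TopologicalSpace E] [TopologicalSpace F]
  {p : E → M}

lemma continuousOn_fiberMap (e : Bundle.Trivialization F p) :
    ContinuousOn (fun z : M × F => fiberMap e z.1 z.2) (e.baseSet ×ˢ Set.univ) :=
  e.toOpenPartialHomeomorph.continuousOn_symm.mono fun _ hz => e.mem_target.2 hz.1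

lemma continuous_fiberMap {e : Bundle.Trivialization F p} {x : M} (hx : x ∈ e.baseSet) :
    Continuous (fiberMap e x) :=
  (continuousOn_fiberMap e).comp_continuous (by fun_prop : Continuous fun v : F => (x, v))
    fun _ => ⟨hx, trivial⟩

lemma proj_fiberMap {e : Bundle.Trivialization F p} {x : M} (hx : x ∈ e.baseSet) (v : F) :
    p (fiberMap e x v) = x := e.proj_symm_apply' hx

lemma apply_fiberMap {e : Bundle.Trivialization F p} {x : M} (hx : x ∈ e.baseSet) (v : F) :
    e (fiberMap e x v) = (x, v) := e.apply_symm_apply' hx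

lemma fiberMap_apply {e : Bundle.Trivialization F p} {w : E} (hw : p w ∈ e.baseSet) :
    fiberMap e (p w) (e w).2 = w := e.symm_apply_mk_proj (e.mem_source.2 hw)

lemma continuousOn_snd_apply {e : Bundle.Trivialization F p} {x : M} (hx : x ∈ e.baseSet) :
    ContinuousOn (fun w => (e w).2) (p ⁻¹' {x}) := by
  have he : ContinuousOn e e.source := e.continuousOn_toFun
  exact (continuous_snd.comp_continuousOn he).mono fun w hw => by
    rw [Set.mem_preimage, Set.mem_singleton_iff] at hw
    exact e.mem_source.2 (by rwa [hw])

lemma FiberHomotopic.homotopicOn {M E F : Type*} [TopologicalSpace E] [TopologicalSpace F]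
    {p : E → M} {x : M} {f g : F → E} (h : FiberHomotopic p x f g) :
    HomotopicOn Set.univ (p ⁻¹' {x}) f g := by
  obtain ⟨H, h1, h2, h3⟩ := h
  exact ⟨H, H.continuous.continuousOn, fun t v _ => h1 t v, fun v _ => h2 v, fun v _ => h3 v⟩

variable {k : ℕ} (ξ : OrientedSphereBundle (k + 2) p)

/-- The oriented parametrizations of the fibers. -/
def OrientedSphereBundle.orientedMaps (x : M) : Set (Sph (k + 2) → E) :=
  {j | ∃ e ∈ ξ.charts, x ∈ e.baseSet ∧ j = fiberMap e x}

lemma OrientedSphereBundle.exists_trivialization {n : ℕ} (ξ : OrientedSphereBundle n p) (x : M) :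
    ∃ e : Bundle.Trivialization (Sph n) p, x ∈ e.baseSet :=
  (ξ.exists_chart x).imp fun _ h => h.2

lemma OrientedSphereBundle.isOrientation : IsOrientation p ξ.orientedMaps where
  continuous := by
    rintro x _ ⟨e, -, hx, rfl⟩
    exact continuous_fiberMap hx
  proj := by
    rintro x _ ⟨e, -, hx, rfl⟩ v
    exact proj_fiberMap hx v
  homotopicOn := by
    rintro x _ ⟨e, he, hx, rfl⟩ _ ⟨e', he', hx', rfl⟩
    exact (ξ.oriented e he e' he' x ⟨hx, hx'⟩).homotopicOn
  exists_local x := by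
    obtain ⟨e, he, hx⟩ := ξ.exists_chart x
    exact ⟨e.baseSet, e.open_baseSet.mem_nhds hx, _, continuousOn_fiberMap e,
      fun x' hx' => ⟨e, he, hx', rfl⟩⟩

lemma isFiberHomotopyInverse_fiberMap {e : Bundle.Trivialization (Sph (k + 2)) p} {x : M}
    (hx : x ∈ e.baseSet) : IsFiberHomotopyInverse p x (fiberMap e x) fun w => (e w).2 where
  continuousOn := continuousOn_snd_apply hx
  left := (HomotopicOn.refl continuousOn_id (Set.mapsTo_univ _ _)).congr
    (fun v _ => (congrArg Prod.snd (apply_fiberMap hx v)).symm) fun _ _ => rfl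
  right := (HomotopicOn.refl continuousOn_id (Set.mapsTo_id _)).congr (fun _ _ => rfl) <| by
    rintro w rfl
    exact (fiberMap_apply hx).symm

variable {V : Type*} {K : AbstractSimplicialComplex V} {T : Realization K ≃ₜ M}

lemma OrientedSphereBundle.hasRetractions : HasRetractions T p ξ.orientedMaps :=
  ξ.isOrientation.hasRetractions ξ.exists_trivialization fun x =>
    let ⟨e, he, hx⟩ := ξ.exists_chart x
    ⟨_, ⟨e, he, hx, rfl⟩, _, isFiberHomotopyInverse_fiberMap hx⟩

variable [LinearOrder V]

lemma isObstruction_iff_represents {s : Realization K → E} {τ : Simplices K (k + 2)}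
    {α : SphereCoeff k} :
    IsObstruction T ξ s τ α ↔ Represents T p ξ.orientedMaps s τ α := by
  constructor
  · rintro ⟨f, hf, e, he, hx, H, hH, H0, H1⟩
    exact ⟨f, hf, _, ⟨e, he, hx, rfl⟩, homotopicOn_iff.2 ⟨H, fun z => hH z.1 z.2, H0, H1⟩⟩
  · rintro ⟨f, hf, _, ⟨e, he, hx, rfl⟩, h⟩
    obtain ⟨H, hH, H0, H1⟩ := homotopicOn_iff.1 h
    exact ⟨f, hf, e, he, hx, H, fun t y => hH (t, y), H0, H1⟩

lemma OrientedSphereBundle.isEulerClass {c : Cohomology K (SphereCoeff k) (k + 2)}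
    (hc : IsPrimaryObstruction T p ξ.orientedMaps c) : IsEulerClass T ξ c := by
  refine ⟨exists_isSkeletonSection ξ.exists_trivialization fun m hm => cubeExtension_sphere hm,
    fun s hs => ⟨?_, fun z hz => hc s hs z fun τ => (isObstruction_iff_represents ξ).1 (hz τ)⟩⟩
  choose z hz using ξ.hasRetractions.exists_represents hs
  exact ⟨z, fun τ => (isObstruction_iff_represents ξ).2 (hz τ)⟩

end SphereBundles

/-! ### Oriented bordisms -/

section OrientedBordism

variable {M E₀ E₁ W : Type*} [TopologicalSpace M] [TopologicalSpace E₀] [TopologicalSpace E₁]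
  [TopologicalSpace W] {k : ℕ} {p₀ : E₀ → M} {p₁ : E₁ → M} {q : W → M}

/-- The map from `E₀` to the total space of the bordism. -/
def FiberwiseBordism.incl₀ {F : Type*} [TopologicalSpace F] (B : FiberwiseBordism F p₀ p₁ q)
    (z : E₀) : W := B.iso₀ z

/-- The map from `E₁` to the total space of the bordism. -/
def FiberwiseBordism.incl₁ {F : Type*} [TopologicalSpace F] (B : FiberwiseBordism F p₀ p₁ q)
    (z : E₁) : W := B.iso₁ z

variable (B : FiberwiseBordism (Sph (k + 2)) p₀ p₁ q)
  (ξ₀ : OrientedSphereBundle (k + 2) p₀) (ξ₁ : OrientedSphereBundle (k + 2) p₁)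

lemma FiberwiseBordism.continuous_incl₀ {F : Type*} [TopologicalSpace F]
    (B : FiberwiseBordism F p₀ p₁ q) : Continuous B.incl₀ :=
  continuous_subtype_val.comp B.iso₀.continuous

lemma FiberwiseBordism.continuous_incl₁ {F : Type*} [TopologicalSpace F]
    (B : FiberwiseBordism F p₀ p₁ q) : Continuous B.incl₁ :=
  continuous_subtype_val.comp B.iso₁.continuous

/-- The maps from the sphere to the fibers of the bordism given by the oriented parametrizations of
its ends. -/
def FiberwiseBordism.orientedMaps (x : M) : Set (Sph (k + 2) → W) :=
  (B.incl₀ ∘ ·) '' ξ₀.orientedMaps x ∪ (B.incl₁ ∘ ·) '' ξ₁.orientedMaps x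

variable {B ξ₀ ξ₁}

lemma FiberwiseBordism.IsOriented.isOrientation (hB : B.IsOriented ξ₀ ξ₁) :
    IsOrientation q (B.orientedMaps ξ₀ ξ₁) where
  continuous := by
    rintro x _ (⟨j, hj, rfl⟩ | ⟨j, hj, rfl⟩)
    · exact B.continuous_incl₀.comp (ξ₀.isOrientation.continuous x j hj)
    · exact B.continuous_incl₁.comp (ξ₁.isOrientation.continuous x j hj)
  proj := by
    rintro x _ (⟨j, hj, rfl⟩ | ⟨j, hj, rfl⟩) v
    · exact (B.proj_iso₀ _).trans (ξ₀.isOrientation.proj x j hj v)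
    · exact (B.proj_iso₁ _).trans (ξ₁.isOrientation.proj x j hj v)
  homotopicOn x := by
    have h₀ : Set.MapsTo B.incl₀ (p₀ ⁻¹' {x}) (q ⁻¹' {x}) := fun z hz => (B.proj_iso₀ z).trans hz
    have h₁ : Set.MapsTo B.incl₁ (p₁ ⁻¹' {x}) (q ⁻¹' {x}) := fun z hz => (B.proj_iso₁ z).trans hz
    have h₂ : ∀ j ∈ ξ₀.orientedMaps x, ∀ j' ∈ ξ₁.orientedMaps x,
        HomotopicOn Set.univ (q ⁻¹' {x}) (B.incl₀ ∘ j) (B.incl₁ ∘ j') := by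
      rintro _ ⟨e, he, hx, rfl⟩ _ ⟨e', he', hx', rfl⟩
      exact (hB e he e' he' x ⟨hx, hx'⟩).homotopicOn
    rintro _ (⟨j, hj, rfl⟩ | ⟨j, hj, rfl⟩) _ (⟨j', hj', rfl⟩ | ⟨j', hj', rfl⟩)
    · exact (ξ₀.isOrientation.homotopicOn x j hj j' hj').postcomp B.continuous_incl₀.continuousOn h₀
    · exact h₂ j hj j' hj'
    · exact (h₂ j' hj' j hj).symm
    · exact (ξ₁.isOrientation.homotopicOn x j hj j' hj').postcomp B.continuous_incl₁.continuousOn h₁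
  exists_local x := by
    obtain ⟨U, hU, φ, hφ, hφJ⟩ := ξ₀.isOrientation.exists_local x
    exact ⟨U, hU, B.incl₀ ∘ φ, B.continuous_incl₀.comp_continuousOn hφ, fun x' hx' =>
      Or.inl ⟨_, hφJ x' hx', rfl⟩⟩

lemma IntervalBundle.apply_eq_zero {F : Type*} [TopologicalSpace F] {ω : IntervalBundle F q}
    {w : W} (hw : w ∈ ω.endSet 0) {e : Bundle.Trivialization (F × I) q} (he : e ∈ ω.charts)
    (hq : q w ∈ e.baseSet) : (e w).2.2 = 0 := by
  obtain ⟨e', he', hq', h0⟩ := hw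
  exact (ω.preserves_ends e he e' he' w ⟨hq, hq'⟩).1.2 h0

lemma FiberwiseBordism.exists_trivialization {F : Type*} [TopologicalSpace F]
    (B : FiberwiseBordism F p₀ p₁ q) (x : M) :
    ∃ e : Bundle.Trivialization (F × I) q, x ∈ e.baseSet :=
  (B.exists_chart x).imp fun _ h => h.2

lemma homotopicOn_fiberMap_zero {F : Type*} [TopologicalSpace F]
    {e : Bundle.Trivialization (F × I) q} {x : M} (hx : x ∈ e.baseSet) :
    HomotopicOn (q ⁻¹' {x}) (q ⁻¹' {x}) id fun w => fiberMap e x ((e w).2.1, 0) := by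
  refine ⟨fun z => fiberMap e x ((e z.2).2.1, unitInterval.symm z.1 * (e z.2).2.2), ?_,
    fun t w _ => proj_fiberMap hx _, fun w hw => ?_, fun w _ => by simp⟩
  · have he : ContinuousOn (fun z : I × W => (e z.2).2) (Set.univ ×ˢ (q ⁻¹' {x})) :=
      (continuousOn_snd_apply hx).comp continuousOn_snd fun z hz => hz.2
    exact (continuous_fiberMap hx).comp_continuousOn ((by fun_prop :
      Continuous fun z : I × (F × I) => (z.2.1, unitInterval.symm z.1 * z.2.2)).comp_continuousOn
        (continuousOn_fst.prodMk he))
  · obtain rfl : q w = x := hw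
    simpa using fiberMap_apply hx

lemma FiberwiseBordism.exists_fiberRetraction {F : Type*} [TopologicalSpace F]
    (B : FiberwiseBordism F p₀ p₁ q) (x : M) :
    ∃ b : W → E₀, ContinuousOn b (q ⁻¹' {x}) ∧ (∀ w, p₀ (b w) = x) ∧
      (∀ z, p₀ z = x → b (B.incl₀ z) = z) ∧
      HomotopicOn (q ⁻¹' {x}) (q ⁻¹' {x}) id (B.incl₀ ∘ b) := by
  obtain ⟨e, he, hx⟩ := B.exists_chart x
  let a : F → B.endSet 0 := fun v => ⟨fiberMap e x (v, 0), e, he, by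
    rwa [proj_fiberMap hx], by rw [apply_fiberMap hx]⟩
  have ha : Continuous a := Continuous.subtype_mk ((continuous_fiberMap hx).comp (by fun_prop)) _
  have hincl : ∀ w, B.incl₀ (B.iso₀.symm (a (e w).2.1)) = fiberMap e x ((e w).2.1, 0) := fun w =>
    congrArg Subtype.val (B.iso₀.apply_symm_apply _)
  refine ⟨fun w => B.iso₀.symm (a (e w).2.1), (B.iso₀.symm.continuous.comp ha).comp_continuousOn
    (continuous_fst.comp_continuousOn (continuousOn_snd_apply hx)), fun w => ?_, fun z hz => ?_,
    (homotopicOn_fiberMap_zero hx).congr (fun _ _ => rfl) fun w _ => (hincl w).symm⟩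
  · rw [← B.proj_iso₀, B.iso₀.apply_symm_apply]
    exact proj_fiberMap hx _
  · have hq : q (B.incl₀ z) = x := (B.proj_iso₀ z).trans hz
    have h0 : (e (B.incl₀ z)).2.2 = 0 := IntervalBundle.apply_eq_zero (B.iso₀ z).2 he (hq.symm ▸ hx)
    refine B.iso₀.symm_apply_eq.2 (Subtype.ext ?_)
    calc fiberMap e x ((e (B.incl₀ z)).2.1, 0)
      _ = fiberMap e (q (B.incl₀ z)) (e (B.incl₀ z)).2 := by rw [hq, ← h0]
      _ = B.incl₀ z := fiberMap_apply (hq.symm ▸ hx)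

omit [TopologicalSpace M] in
lemma IsFiberHomotopyInverse.postcomp {E : Type*} [TopologicalSpace E] {p : E → M} {x : M}
    {j : Sph (k + 2) → E} {r : E → Sph (k + 2)} (hr : IsFiberHomotopyInverse p x j r)
    (hj : ∀ v, p (j v) = x) {i : E → W} (hi : Continuous i) (hq : ∀ z, q (i z) = p z) {b : W → E}
    (hb : ContinuousOn b (q ⁻¹' {x})) (hbx : ∀ w, p (b w) = x) (hbi : ∀ z, p z = x → b (i z) = z)
    (hib : HomotopicOn (q ⁻¹' {x}) (q ⁻¹' {x}) id (i ∘ b)) :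
    IsFiberHomotopyInverse q x (i ∘ j) (r ∘ b) where
  continuousOn := hr.continuousOn.comp hb fun w _ => hbx w
  left := hr.left.congr (fun v _ => congrArg r (hbi _ (hj v)).symm) fun _ _ => rfl
  right := hib.trans ((hr.right.precomp hb fun w _ => hbx w).postcomp hi.continuousOn
    fun z hz => (hq z).trans hz)

lemma FiberwiseBordism.IsOriented.hasRetractions (hB : B.IsOriented ξ₀ ξ₁) {V : Type*}
    {K : AbstractSimplicialComplex V} {T : Realization K ≃ₜ M} :
    HasRetractions T q (B.orientedMaps ξ₀ ξ₁) := by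
  refine hB.isOrientation.hasRetractions B.exists_trivialization fun x => ?_
  obtain ⟨e, he, hx⟩ := ξ₀.exists_chart x
  obtain ⟨b, hb, hbx, hbi, hib⟩ := B.exists_fiberRetraction x
  exact ⟨_, Or.inl ⟨_, ⟨e, he, hx, rfl⟩, rfl⟩, _, (isFiberHomotopyInverse_fiberMap hx).postcomp
    (proj_fiberMap hx) B.continuous_incl₀ B.proj_iso₀ hb hbx hbi hib⟩

end OrientedBordism

end EulerBordism

end

/-- Fiberwise bordant oriented `S^{n-1}`-bundles over a triangulated space `M` have the same Euler
class in `H^n(M; π_{n-1}(S^{n-1}))`. Here `n = k + 2` is an arbitrary integer `≥ 2`. -/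
theorem lemma4p1 {M E₀ E₁ W V : Type*}
    [TopologicalSpace M] [TopologicalSpace E₀] [TopologicalSpace E₁] [TopologicalSpace W]
    [LinearOrder V] (K : AbstractSimplicialComplex V) (T : EulerBordism.Realization K ≃ₜ M)
    (k : ℕ) {p₀ : E₀ → M} {p₁ : E₁ → M} {q : W → M}
    (ξ₀ : EulerBordism.OrientedSphereBundle (k + 2) p₀)
    (ξ₁ : EulerBordism.OrientedSphereBundle (k + 2) p₁)
    (B : EulerBordism.FiberwiseBordism (EulerBordism.Sph (k + 2)) p₀ p₁ q)
    (hB : B.IsOriented ξ₀ ξ₁) :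
    ∃ c : EulerBordism.Cohomology K (EulerBordism.SphereCoeff k) (k + 2),
      EulerBordism.IsEulerClass T ξ₀ c ∧ EulerBordism.IsEulerClass T ξ₁ c := by
  open EulerBordism in
  obtain ⟨c, hc⟩ := hB.hasRetractions.exists_isPrimaryObstruction (T := T) B.exists_trivialization
    fun m hm => (cubeExtension_sphere hm).prod (cubeExtension_unitInterval m)
  exact ⟨c, ξ₀.isEulerClass (hc.comap B.continuous_incl₀ B.proj_iso₀ fun _ j hj =>
      Or.inl ⟨j, hj, rfl⟩),
    ξ₁.isEulerClass (hc.comap B.continuous_incl₁ B.proj_iso₁ fun _ j hj => Or.inr ⟨j, hj, rfl⟩)⟩
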